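/- Let $D\subset\mathbb R^d$, $d\ge 1$, be a bounded open set, $H=L^2(D)$, and let $A$ be the realization in $H$ of the Laplace operator with Dirichlet boundary conditions. Let $(e_k)_{k\ge1}$ be a complete orthonormal basis of $H$ with $Ae_k=-\alpha_k e_k$, $0<\alpha_1\le\alpha_k\le\alpha_{k+1}$, and assume $\alpha_k\sim k^{2/d}$ (i.e. the two sequences are comparable up to constants). For $\delta\in\mathbb R$ let $H^\delta$ be the Hilbert space of all $x=\sum_k x_ke_k$ with $|x|_{H^\delta}^2=\sum_k\alpha_k^\delta x_k^2<\infty$, and put $\mathcal H=H\times H^{-1}$, $\Pi_1(u,v)=u$. Assume: (i) $Q$ is a bounded linear operator on $H$ with $Qe_k=\lambda_ke_k$ and $\frac1c\alpha_k^{-\beta}\le\lambda_k\le c\,\alpha_k^{-\beta}$ for all $k$, for some $c>0$ and $\beta>(d-2)/4$; (ii) $B:H\to H$ satisfies $B(0)=0$; for every $\delta\in[0,1+2\beta]$ it maps $H^\delta$ to $H^\delta$ and is Lipschitz continuous there with Lipschitz constant $\gamma_\delta<\alpha_1$; and $B$ is Fréchet differentiable on $H^{2\beta}$. For $\mu>0$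 let $S_\mu(t)$ be the semigroup on $\mathcal H$ generated by $A_\mu(u,v)=\big(v,\frac1\mu Au-\frac1\mu v\big)$, and let $B_\mu(u,v)=\frac1\mu(0,B(u))$, $Q_\mu u=\frac1\mu(0,Qu)$. For $t_1<t_2$ and $z\in C([t_1,t_2];\mathcal H)$ let $$I^\mu_{t_1,t_2}(z)=\tfrac12\inf\big\{|\psi|^2_{L^2((t_1,t_2);H)}\big\}\in[0,+\infty],$$ where the infimum is over all $\psi\in L^2((t_1,t_2);H)$ such that $$z(t)=S_\mu(t-t_1)z(t_1)+\int_{t_1}^tS_\mu(t-s)B_\mu(z(s))\,ds+\int_{t_1}^tS_\mu(t-s)Q_\mu\psi(s)\,ds,\qquad t\in[t_1,t_2]$$ (and $\inf\emptyset=+\infty$). For $z\in C((-\infty,0];\mathcal H)$ let $I^\mu_{-\infty}(z)=\sup_{t>0}I^\mu_{-t,0}(z)$. For $x\in H$, $y\in H^{-1}$ define the quasi-potentials $$V^\mu(x,y)=\inf\{I^\mu_{0,T}(z):\ T>0,\ z\in C([0,T];\mathcal H),\ z(0)=0,\ z(T)=(x,y)\},\qquad V_\mu(x)=\inf_{y\in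 H^{-1}}V^\mu(x,y).$$ **Theorem.** There is $\mu_0>0$ such that for all $0<\mu<\mu_0$ the following holds. For all $(x,y)\in\mathcal H$, $$V^\mu(x,y)=\inf\Big\{I^\mu_{-\infty}(z):\ z\in C((-\infty,0];\mathcal H),\ \lim_{t\to-\infty}|z(t)|_{\mathcal H}=0,\ z(0)=(x,y)\Big\},$$ and if this quantity is finite, the infimum is a minimum. For all $x\in H$, $$V_\mu(x)=\inf\Big\{I^\mu_{-\infty}(z):\ z\in C((-\infty,0];\mathcal H),\ \lim_{t\to-\infty}|z(t)|_{\mathcal H}=0,\ \Pi_1z(0)=x\Big\},$$ and if this quantity is finite, the infimum is a minimum. -/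

import Mathlib

open MeasureTheory Filter Topology Set
open scoped ENNReal NNReal ContDiff

noncomputable section

namespace WaveQuasipotential

/-! ## The Dirichlet Laplacian on a domain of `ℝ^d` -/

/-- The space `H = L²(D)`. -/
abbrev L2 {d : ℕ} (D : Set (EuclideanSpace ℝ (Fin d))) : Type :=
  Lp ℝ 2 (volume.restrict D)

/-- `φ ∈ C_c^∞(D)`. -/
structure IsTestFunction {d : ℕ} (D : Set (EuclideanSpace ℝ (Fin d)))
    (φ : EuclideanSpace ℝ (Fin d) → ℝ) : Prop where
  smooth : ContDiff ℝ ∞ φ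
  compact_support : HasCompactSupport φ
  support_subset : tsupport φ ⊆ D

/-- `u ∈ H¹₀(D)`, the closure of `C_c^∞(D)` in `H¹(D)`, with weak gradient `G ∈ L²(D; ℝ^d)`. -/
def HasH10Gradient {d : ℕ} (D : Set (EuclideanSpace ℝ (Fin d))) (u : L2 D)
    (G : EuclideanSpace ℝ (Fin d) → EuclideanSpace ℝ (Fin d)) : Prop :=
  MemLp G 2 (volume.restrict D) ∧
  ∃ φ : ℕ → EuclideanSpace ℝ (Fin d) → ℝ,
    (∀ n, IsTestFunction D (φ n)) ∧
    Tendsto (fun n => eLpNorm (fun ξ => u ξ - φ n ξ) 2 (volume.restrict D)) atTop (𝓝 0) ∧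
    Tendsto (fun n => eLpNorm (fun ξ => G ξ - gradient (φ n) ξ) 2 (volume.restrict D))
      atTop (𝓝 0)

/-- `u ∈ D(A)` and `A u = f`, where `A` is the realization in `L²(D)` of the Laplace operator with
Dirichlet boundary conditions: `u ∈ H¹₀(D)` and `∫ ∇u · ∇η = - ∫ f η` for all `η ∈ C_c^∞(D)`. -/
def IsDirichletLaplacian {d : ℕ} (D : Set (EuclideanSpace ℝ (Fin d))) (u f : L2 D) : Prop :=
  ∃ G : EuclideanSpace ℝ (Fin d) → EuclideanSpace ℝ (Fin d), HasH10Gradient D u G ∧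
    ∀ η : EuclideanSpace ℝ (Fin d) → ℝ, IsTestFunction D η →
      ∫ ξ in D, inner ℝ (G ξ) (gradient η ξ) = - ∫ ξ in D, f ξ * η ξ

/-- A complete orthonormal basis `e_k` of `L²(D)` of eigenfunctions of the Dirichlet Laplacian,
`A e_k = - α_k e_k`, with `0 < α_0 ≤ α_k ≤ α_{k+1}` (numbered from `0`). -/
structure DirichletEigensystem {d : ℕ} (D : Set (EuclideanSpace ℝ (Fin d))) where
  /-- the eigenfunctions -/
  e : HilbertBasis ℕ ℝ (L2 D)
  /-- the eigenvalues of `-A` -/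
  α : ℕ → ℝ
  α_zero_pos : 0 < α 0
  α_mono : Monotone α
  eigen : ∀ k, IsDirichletLaplacian D (e k) (-(α k) • e k)

section Spaces

variable {d : ℕ} {D : Set (EuclideanSpace ℝ (Fin d))}

theorem DirichletEigensystem.α_pos (S : DirichletEigensystem D) (k : ℕ) : 0 < S.α k :=
  S.α_zero_pos.trans_le (S.α_mono (Nat.zero_le k))

/-! ## The spaces `H^δ` -/

/-- The Hilbert space `H^δ`, `δ ∈ ℝ`. It consists of the sequences `(x_k)` of Fourier coefficients
with `∑ α_k^δ x_k² < ∞`. An element is stored through its coordinates `α_k^{δ/2} x_k` with respect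
to the orthonormal basis `α_k^{-δ/2} e_k` of `H^δ`, which form a sequence in `ℓ²`; the Fourier
coefficients `x_k` are `Sob.coeff`. -/
def Sob (_S : DirichletEigensystem D) (_δ : ℝ) : Type := lp (fun _ : ℕ => ℝ) 2

variable (S : DirichletEigensystem D) (δ : ℝ)

instance : NormedAddCommGroup (Sob S δ) :=
  inferInstanceAs (NormedAddCommGroup (lp (fun _ : ℕ => ℝ) 2))

instance : InnerProductSpace ℝ (Sob S δ) :=
  inferInstanceAs (InnerProductSpace ℝ (lp (fun _ : ℕ => ℝ) 2))

instance : CompleteSpace (Sob S δ) :=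
  inferInstanceAs (CompleteSpace (lp (fun _ : ℕ => ℝ) 2))

variable {S δ}

/-- The orthonormal coordinates of an element of `H^δ`. -/
def Sob.toLp (x : Sob S δ) : lp (fun _ : ℕ => ℝ) 2 := x

/-- The `k`-th Fourier coefficient `x_k` of an element of `H^δ`. -/
def Sob.coeff (x : Sob S δ) (k : ℕ) : ℝ := S.α k ^ (-δ / 2) * x.toLp k

theorem memLp_two_iff (c : ℕ → ℝ) :
    Memℓp (E := fun _ : ℕ => ℝ) c 2 ↔ Summable fun k => c k ^ 2 := by
  rw [memℓp_gen_iff (by norm_num)]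
  simp

theorem rpow_half_sq (S : DirichletEigensystem D) (δ : ℝ) (k : ℕ) :
    (S.α k ^ (δ / 2)) ^ 2 = S.α k ^ δ := by
  rw [← Real.rpow_natCast, ← Real.rpow_mul (S.α_pos k).le]
  norm_num

/-- The element of `H^δ` with given Fourier coefficients. -/
def Sob.ofCoeff (c : ℕ → ℝ) (hc : Summable fun k => S.α k ^ δ * c k ^ 2) : Sob S δ :=
  (⟨fun k => S.α k ^ (δ / 2) * c k, (memLp_two_iff _).2 (by
    simpa only [mul_pow, rpow_half_sq] using hc)⟩ : lp (fun _ : ℕ => ℝ) 2)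

theorem Sob.coeff_ofCoeff (c : ℕ → ℝ) (hc : Summable fun k => S.α k ^ δ * c k ^ 2) (k : ℕ) :
    (Sob.ofCoeff c hc).coeff k = c k := by
  change S.α k ^ (-δ / 2) * (S.α k ^ (δ / 2) * c k) = c k
  rw [← mul_assoc, ← Real.rpow_add (S.α_pos k), show -δ / 2 + δ / 2 = 0 by ring, Real.rpow_zero,
    one_mul]

theorem Sob.weight_mul_coeff_sq (x : Sob S δ) (k : ℕ) :
    S.α k ^ δ * x.coeff k ^ 2 = (x.toLp k) ^ 2 := by
  rw [Sob.coeff, mul_pow, rpow_half_sq, ← mul_assoc, ← Real.rpow_add (S.α_pos k)]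
  simp

theorem Sob.summable_coeff (x : Sob S δ) : Summable fun k => S.α k ^ δ * x.coeff k ^ 2 := by
  simp only [Sob.weight_mul_coeff_sq]
  exact (memLp_two_iff _).1 (lp.memℓp x.toLp)

/-- The inner product of `H^δ` is `∑ α_k^δ x_k y_k`. -/
theorem Sob.inner_eq_tsum (x y : Sob S δ) :
    inner ℝ x y = ∑' k, S.α k ^ δ * x.coeff k * y.coeff k := by
  have h : inner ℝ x y = ∑' k, inner ℝ (x.toLp k) (y.toLp k) := lp.inner_eq_tsum x.toLp y.toLp
  rw [h]
  refine tsum_congr fun k => ?_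
  have h1 : S.α k ^ δ * (S.α k ^ (-δ / 2) * S.α k ^ (-δ / 2)) = 1 := by
    rw [← Real.rpow_add (S.α_pos k), ← Real.rpow_add (S.α_pos k)]
    ring_nf
    simp
  simp only [Sob.coeff, RCLike.inner_apply, conj_trivial]
  linear_combination (-(x.toLp k * y.toLp k)) * h1

/-- `x ∈ H^δ` and `u ∈ L²(D)` are the same function: they have the same Fourier coefficients. -/
def Sob.Represents (x : Sob S δ) (u : L2 D) : Prop :=
  ∀ k, x.coeff k = inner ℝ (S.e k) u

variable (S) in
theorem summable_coeff_L2 (u : L2 D) : Summable fun k => (inner ℝ (S.e k) u) ^ 2 := by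
  have h := (memLp_two_iff _).1 (lp.memℓp (S.e.repr u))
  simpa only [HilbertBasis.repr_apply_apply] using h

variable (S) in
theorem summable_coeff_L2_neg (u : L2 D) :
    Summable fun k => S.α k ^ (-1 : ℝ) * (inner ℝ (S.e k) u) ^ 2 := by
  refine Summable.of_nonneg_of_le
    (fun k => mul_nonneg (Real.rpow_nonneg (S.α_pos k).le _) (sq_nonneg _)) (fun k => ?_)
    ((summable_coeff_L2 S u).mul_left (S.α 0)⁻¹)
  rw [Real.rpow_neg_one]
  exact mul_le_mul_of_nonneg_right (inv_anti₀ S.α_zero_pos (S.α_mono (Nat.zero_le k)))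
    (sq_nonneg _)

variable (S) in
/-- The embedding of `H = L²(D)` in `H^{-1}`. -/
def embedNegOne (u : L2 D) : Sob S (-1) :=
  Sob.ofCoeff (fun k => inner ℝ (S.e k) u) (summable_coeff_L2_neg S u)

/-! ## The phase space and the semigroup -/

variable (S) in
/-- The phase space `𝓗 = L²(D) × H^{-1}` of pairs (position, velocity). Only its linear and
topological structure is used, so the (equivalent) sup norm of the product is harmless. -/
abbrev Phase : Type := L2 D × Sob S (-1)

end Spaces

/-- The generator `(p, q) ↦ (q, (-a p - q)/μ)` of the first order system of the scalar
damped oscillator `μ p'' + p' = - a p`. -/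
def modeGenerator (μ a : ℝ) : (ℝ × ℝ) →L[ℝ] (ℝ × ℝ) :=
  (ContinuousLinearMap.snd ℝ ℝ ℝ).prod
    (μ⁻¹ • (-(a • ContinuousLinearMap.fst ℝ ℝ ℝ) - ContinuousLinearMap.snd ℝ ℝ ℝ))

/-- The flow `(p(0), p'(0)) ↦ (p(t), p'(t))` of the damped oscillator `μ p'' + p' = - a p`. -/
def modeFlow (μ a t : ℝ) : (ℝ × ℝ) →L[ℝ] (ℝ × ℝ) :=
  NormedSpace.exp (t • modeGenerator μ a)

theorem modeFlow_zero (μ a : ℝ) (w : ℝ × ℝ) : modeFlow μ a 0 w = w := by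
  simp [modeFlow]

theorem hasDerivAt_modeFlow (μ a t : ℝ) (w : ℝ × ℝ) :
    HasDerivAt (fun s => modeFlow μ a s w) (modeGenerator μ a (modeFlow μ a t w)) t := by
  have h := hasDerivAt_exp_smul_const' (𝕂 := ℝ) (modeGenerator μ a) t
  exact h.clm_apply (hasDerivAt_const t w) |>.congr_deriv (by simp [modeFlow])

/-- The energy of the oscillator grows at most by a constant factor in a fixed time. -/
theorem modeFlow_energy {μ a : ℝ} (hμ : 0 < μ) (ha : 0 < a) (t : ℝ) (w : ℝ × ℝ) :
    μ * (modeFlow μ a t w).2 ^ 2 + a * (modeFlow μ a t w).1 ^ 2 ≤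
      Real.exp (2 * |t| / μ) * (μ * w.2 ^ 2 + a * w.1 ^ 2) := by
  set P : ℝ → ℝ := fun s => (modeFlow μ a s w).1 with hP
  set R : ℝ → ℝ := fun s => (modeFlow μ a s w).2 with hR
  set E : ℝ → ℝ := fun s => μ * R s ^ 2 + a * P s ^ 2 with hE
  have hPd : ∀ s, HasDerivAt P (R s) s := fun s => by
    have h := (hasDerivAt_modeFlow μ a s w)
    exact (ContinuousLinearMap.fst ℝ ℝ ℝ).hasFDerivAt.comp_hasDerivAt s h
  have hRd : ∀ s, HasDerivAt R (μ⁻¹ * (-(a * P s) - R s)) s := fun s => by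
    have h := (hasDerivAt_modeFlow μ a s w)
    exact (ContinuousLinearMap.snd ℝ ℝ ℝ).hasFDerivAt.comp_hasDerivAt s h
  have hEd : ∀ s, HasDerivAt E (-2 * R s ^ 2) s := fun s => by
    have h := (((hRd s).pow 2).const_mul μ).add (((hPd s).pow 2).const_mul a)
    refine h.congr_deriv ?_
    field_simp
    ring
  have hE0 : E 0 = μ * w.2 ^ 2 + a * w.1 ^ 2 := by
    simp [hE, hP, hR, modeFlow_zero]
  have hEnn : ∀ s, 0 ≤ E s := fun s => by simp only [hE]; positivity
  change E t ≤ _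
  rw [← hE0]
  rcases le_total 0 t with ht | ht
  · have hanti : Antitone E := antitone_of_hasDerivAt_nonpos hEd fun s => by
      change -2 * R s ^ 2 ≤ 0
      nlinarith [sq_nonneg (R s)]
    have h1 : (1 : ℝ) ≤ Real.exp (2 * |t| / μ) := Real.one_le_exp (by positivity)
    calc E t ≤ E 0 := hanti ht
      _ ≤ _ := le_mul_of_one_le_left (hEnn 0) h1
  · have hFd : ∀ s, HasDerivAt (fun s => Real.exp (2 * s / μ) * E s)
        (Real.exp (2 * s / μ) * (2 / μ * (a * P s ^ 2))) s := fun s => by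
      have h1 : HasDerivAt (fun s : ℝ => 2 * s / μ) (2 / μ) s := by
        simpa using ((hasDerivAt_id s).const_mul 2).div_const μ
      refine (h1.exp.mul (hEd s)).congr_deriv ?_
      simp only [hE]
      field_simp
      ring
    have hmono : Monotone (fun s => Real.exp (2 * s / μ) * E s) :=
      monotone_of_hasDerivAt_nonneg hFd fun s => by positivity
    have h2 := hmono ht
    simp only [mul_zero, zero_div, Real.exp_zero, one_mul] at h2
    rw [abs_of_nonpos ht]
    have h3 : Real.exp (2 * -t / μ) * Real.exp (2 * t / μ) = 1 := by
      rw [← Real.exp_add, show 2 * -t / μ + 2 * t / μ = 0 by ring, Real.exp_zero]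
    calc E t = Real.exp (2 * -t / μ) * (Real.exp (2 * t / μ) * E t) := by
          rw [← mul_assoc, h3, one_mul]
      _ ≤ _ := mul_le_mul_of_nonneg_left h2 (Real.exp_pos _).le

section Dynamics

variable {d : ℕ} {D : Set (EuclideanSpace ℝ (Fin d))} (S : DirichletEigensystem D)

/-- The pair of `k`-th Fourier coefficients of a point of the phase space. -/
def phaseCoeff (z : Phase S) (k : ℕ) : ℝ × ℝ := (inner ℝ (S.e k) z.1, z.2.coeff k)

theorem summable_energy (μ : ℝ) (z : Phase S) : Summable fun k =>
    μ * (S.α k ^ (-1 : ℝ) * (phaseCoeff S z k).2 ^ 2) + (phaseCoeff S z k).1 ^ 2 :=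
  ((Sob.summable_coeff z.2).mul_left μ).add (summable_coeff_L2 S z.1)

theorem modeFlow_energy_scaled {μ : ℝ} (hμ : 0 < μ) (t : ℝ) (k : ℕ) (w : ℝ × ℝ) :
    μ * (S.α k ^ (-1 : ℝ) * (modeFlow μ (S.α k) t w).2 ^ 2) + (modeFlow μ (S.α k) t w).1 ^ 2 ≤
      Real.exp (2 * |t| / μ) * (μ * (S.α k ^ (-1 : ℝ) * w.2 ^ 2) + w.1 ^ 2) := by
  have ha := S.α_pos k
  have h := mul_le_mul_of_nonneg_left (modeFlow_energy hμ ha t w) (inv_pos.2 ha).le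
  rw [Real.rpow_neg_one]
  have e1 : ∀ p q : ℝ, (S.α k)⁻¹ * (μ * q ^ 2 + S.α k * p ^ 2) =
      μ * ((S.α k)⁻¹ * q ^ 2) + p ^ 2 := fun p q => by
    field_simp
  rw [mul_left_comm, e1, e1] at h
  exact h

theorem summable_flow_fst {μ : ℝ} (hμ : 0 < μ) (t : ℝ) (z : Phase S) :
    Summable fun k => (modeFlow μ (S.α k) t (phaseCoeff S z k)).1 ^ 2 := by
  refine Summable.of_nonneg_of_le (fun k => sq_nonneg _) (fun k => ?_)
    ((summable_energy S μ z).mul_left (Real.exp (2 * |t| / μ)))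
  refine le_trans ?_ (modeFlow_energy_scaled S hμ t k _)
  have := Real.rpow_nonneg (S.α_pos k).le (-1)
  exact le_add_of_nonneg_left (by positivity)

theorem summable_flow_snd {μ : ℝ} (hμ : 0 < μ) (t : ℝ) (z : Phase S) :
    Summable fun k =>
      S.α k ^ (-1 : ℝ) * (modeFlow μ (S.α k) t (phaseCoeff S z k)).2 ^ 2 := by
  refine Summable.of_nonneg_of_le
    (fun k => mul_nonneg (Real.rpow_nonneg (S.α_pos k).le _) (sq_nonneg _)) (fun k => ?_)
    (((summable_energy S μ z).mul_left (Real.exp (2 * |t| / μ))).mul_left μ⁻¹)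
  rw [← div_eq_inv_mul, le_div_iff₀' hμ]
  exact le_trans (le_add_of_nonneg_right (sq_nonneg _)) (modeFlow_energy_scaled S hμ t k _)

/-- The semigroup `S_μ(t)` on `𝓗` of the linear damped wave equation `μ u'' + u' = A u`, that is,
the semigroup generated by `A_μ (u, v) = (v, (A u - v)/μ)`: on the span of the eigenfunction `e_k`
of `A` it is the flow of the oscillator `μ p'' + p' = - α_k p`. -/
def semigroup {μ : ℝ} (hμ : 0 < μ) (t : ℝ) (z : Phase S) : Phase S :=
  (S.e.repr.symm ⟨fun k => (modeFlow μ (S.α k) t (phaseCoeff S z k)).1,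
      (memLp_two_iff _).2 (summable_flow_fst S hμ t z)⟩,
    Sob.ofCoeff (fun k => (modeFlow μ (S.α k) t (phaseCoeff S z k)).2)
      (summable_flow_snd S hμ t z))

theorem phaseCoeff_semigroup {μ : ℝ} (hμ : 0 < μ) (t : ℝ) (z : Phase S) (k : ℕ) :
    phaseCoeff S (semigroup S hμ t z) k = modeFlow μ (S.α k) t (phaseCoeff S z k) := by
  refine Prod.ext ?_ (Sob.coeff_ofCoeff _ (summable_flow_snd S hμ t z) k)
  change inner ℝ (S.e k) (semigroup S hμ t z).1 = _
  rw [← HilbertBasis.repr_apply_apply]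
  simp [semigroup]

/-! ## The assumptions on the noise and on the nonlinearity -/

/-- `Q` is a bounded operator on `L²(D)` (this is in its type), diagonal with respect to `e_k`, and
its eigenvalues `λ_k` satisfy `c⁻¹ α_k^{-β} ≤ λ_k ≤ c α_k^{-β}` with `c > 0`, `β > (d-2)/4`. -/
structure NoiseAssumption (β : ℝ) (Q : L2 D →L[ℝ] L2 D) : Prop where
  β_gt : ((d : ℝ) - 2) / 4 < β
  diagonal : ∃ lam : ℕ → ℝ, (∀ k, Q (S.e k) = lam k • S.e k) ∧
    ∃ c : ℝ, 0 < c ∧ ∀ k, c⁻¹ * S.α k ^ (-β) ≤ lam k ∧ lam k ≤ c * S.α k ^ (-β)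

/-- `B` maps `H^δ` to itself, and `Bδ` is its restriction to `H^δ` (used with `δ ≥ 0` only). -/
def IsRestriction (δ : ℝ) (B : L2 D → L2 D) (Bδ : Sob S δ → Sob S δ) : Prop :=
  ∀ (x : Sob S δ) (u : L2 D), x.Represents u → (Bδ x).Represents (B u)

/-- For each `δ ∈ [0, 1+2β]`, `B` maps `H^δ` to itself with a Lipschitz constant smaller than the
first eigenvalue; `B(0) = 0`; and `B` is Fréchet differentiable on `H^{2β}`. (The supremum over
`H^{2β}` of the operator norms of its derivatives is then its Lipschitz constant on `H^{2β}`.) -/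
structure NonlinearityAssumption (β : ℝ) (B : L2 D → L2 D) : Prop where
  lipschitz : ∀ δ ∈ Icc 0 (1 + 2 * β), ∃ Bδ : Sob S δ → Sob S δ, IsRestriction S δ B Bδ ∧
    ∃ γ : ℝ≥0, (γ : ℝ) < S.α 0 ∧ LipschitzWith γ Bδ
  map_zero : B 0 = 0
  differentiable : ∃ B' : Sob S (2 * β) → Sob S (2 * β), IsRestriction S (2 * β) B B' ∧
    Differentiable ℝ B'

/-! ## The skeleton equation, the action functionals and the quasi-potentials -/

/-- `B_μ(u, v) = (0, B(u)/μ)`. -/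
def Bmu (μ : ℝ) (B : L2 D → L2 D) (z : Phase S) : Phase S := (0, μ⁻¹ • embedNegOne S (B z.1))

/-- `Q_μ u = (0, Q u/μ)`. -/
def Qmu (μ : ℝ) (Q : L2 D →L[ℝ] L2 D) (u : L2 D) : Phase S := (0, μ⁻¹ • embedNegOne S (Q u))

/-- `z` is a mild solution on `[t₁, t₂]`, with initial value `z(t₁)` and control `ψ`, of
`dz/dt = A_μ z + B_μ(z) + Q_μ ψ`. -/
def IsMildSolution (Q : L2 D →L[ℝ] L2 D) (B : L2 D → L2 D) {μ : ℝ} (hμ : 0 < μ) (t₁ t₂ : ℝ)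
    (ψ : ℝ → L2 D) (z : ℝ → Phase S) : Prop :=
  ContinuousOn z (Icc t₁ t₂) ∧ ∀ t ∈ Icc t₁ t₂,
    z t = semigroup S hμ (t - t₁) (z t₁) + (∫ r in t₁..t, semigroup S hμ (t - r) (Bmu S μ B (z r)))
      + ∫ r in t₁..t, semigroup S hμ (t - r) (Qmu S μ Q (ψ r))

/-- The action functional `I^μ_{t₁,t₂}(z) = ½ inf { |ψ|²_{L²((t₁,t₂);H)} : z = z^μ_ψ }`, with
`inf ∅ = ∞`. -/
def action (Q : L2 D →L[ℝ] L2 D) (B : L2 D → L2 D) {μ : ℝ} (hμ : 0 < μ) (t₁ t₂ : ℝ)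
    (z : ℝ → Phase S) : ℝ≥0∞ :=
  2⁻¹ * ⨅ ψ ∈ {ψ : ℝ → L2 D | MemLp ψ 2 (volume.restrict (Ioo t₁ t₂)) ∧
    IsMildSolution S Q B hμ t₁ t₂ ψ z}, eLpNorm ψ 2 (volume.restrict (Ioo t₁ t₂)) ^ 2

/-- `I^μ_{-∞}(z) = sup_{t > 0} I^μ_{-t,0}(z)`. -/
def actionInfty (Q : L2 D →L[ℝ] L2 D) (B : L2 D → L2 D) {μ : ℝ} (hμ : 0 < μ)
    (z : ℝ → Phase S) : ℝ≥0∞ :=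
  ⨆ t ∈ Ioi (0 : ℝ), action S Q B hμ (-t) 0 z

/-- The quasi-potential `V^μ(x,y) = inf { I^μ_{0,T}(z) : z(0) = 0, z(T) = (x,y), T > 0 }`. -/
def quasipotential (Q : L2 D →L[ℝ] L2 D) (B : L2 D → L2 D) {μ : ℝ} (hμ : 0 < μ)
    (x : L2 D) (y : Sob S (-1)) : ℝ≥0∞ :=
  ⨅ T ∈ Ioi (0 : ℝ), ⨅ z ∈ {z : ℝ → Phase S | ContinuousOn z (Icc 0 T) ∧ z 0 = 0 ∧ z T = (x, y)},
    action S Q B hμ 0 T z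

/-- `V_μ(x) = inf { V^μ(x,y) : y ∈ H^{-1} }`. -/
def quasipotentialFst (Q : L2 D →L[ℝ] L2 D) (B : L2 D → L2 D) {μ : ℝ} (hμ : 0 < μ)
    (x : L2 D) : ℝ≥0∞ :=
  ⨅ y : Sob S (-1), quasipotential S Q B hμ x y

/-- The paths `z ∈ C((-∞,0]; 𝓗)` with `z(t) → 0` as `t → -∞`. (The values of the function `z` at
positive times play no role.) -/
def pathsFromZero : Set (ℝ → Phase S) :=
  {z | ContinuousOn z (Iic 0) ∧ Tendsto z atBot (𝓝 0)}

end Dynamics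

end WaveQuasipotential

end

/-! Two inequalities are needed. Both rest on an energy estimate for the damped oscillators
satisfied by the Fourier coefficients, and on controllability of the equation in unit time.

Energy. For `μ p'' + p' = -a p + f` with `r = p'`, the energy `(μ r + p)²/2 + (μ r)²/2 + μ a p²` has
derivative `-a p² - μ r² + f p + 2 μ r f`, so half of the dissipation survives at the price of
`((2a)⁻¹ + 2μ) f²`. Weighting by `α_k^δ` and summing gives an estimate in `H^{δ+1} × H^δ`. At `δ =
-1` the contribution of `B` is absorbed by the dissipation as soon as `((2α₀)⁻¹ + 2μ) α₀⁻¹ γ² <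
1/2`. For `μ → 0` this reads `γ < α₀`, so it holds for all small `μ`; this is the only smallness
imposed on `μ` (`exists_phase_estimate`). For a solution that vanishes at `-∞`, a bootstrap in `δ`
then bounds the energy in `H^{1+2β} × H^{2β}` at time `t` by the control energy spent before `t`
(`exists_regularity_estimate`).

The quasi-potential is at most the action of a path from `-∞` (`quasipotential_le_actionInfty`). A
path of finite action has one square integrable control on the whole half-line. By the regularity
estimate `z(a)` is small in `H^{1+2β} × H^{2β}` when `a → -∞`, and a state of this space can be
reached from `0` in unit time at a cost proportional to its energy (`exists_control_to`). Replacing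
the path before `a` by such a bridge gives an admissible finite-time path whose extra cost tends to
zero.

Conversely, a minimizer exists (`exists_minimizer`). Almost optimal finite-time paths, extended by
zero to the past, have bounded controls. The regularity estimate confines all their states to one
compact subset of `𝓗`, because `∑ α_k^{-(2β+1)} < ∞`, which is where `β > (d-2)/4` and the growth of
`α_k` enter. Along an ultrafilter the states converge pointwise in time, hence uniformly on compact
intervals by equicontinuity, and the controls converge weakly. The limit solves the equation, its
control is no more expensive, and being bounded with a square integrable control it tends to zero at
`-∞` (`exists_limit_solution`). -/

noncomputable section

namespace WaveQuasipotential

/-! ### Primitives of integrable functions -/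

/-- `F` is a primitive on `[a, b]` of the integrable function `f`. -/
def IsPrimitiveOn (F f : ℝ → ℝ) (a b : ℝ) : Prop :=
  IntervalIntegrable f volume a b ∧ ∀ t ∈ Icc a b, F t = F a + ∫ s in a..t, f s

namespace IsPrimitiveOn

variable {F G f g : ℝ → ℝ} {a b c t : ℝ}

theorem intervalIntegrable_left (h : IsPrimitiveOn F f a b) (ht : t ∈ Icc a b) :
    IntervalIntegrable f volume a t :=
  h.1.mono_set (by rw [uIcc_of_le ht.1, uIcc_of_le (ht.1.trans ht.2)]; exact
    Icc_subset_Icc_right ht.2)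

theorem absolutelyContinuousOnInterval (hab : a ≤ b) (h : IsPrimitiveOn F f a b) :
    AbsolutelyContinuousOnInterval F a b := by
  have h1 := h.1.absolutelyContinuousOnInterval_intervalIntegral (c := a) (by simp)
  have h2 : AbsolutelyContinuousOnInterval (fun _ : ℝ => F a) a b :=
    (contDiff_const.contDiffOn).absolutelyContinuousOnInterval
  have h3 := h2.add h1
  rw [absolutelyContinuousOnInterval_iff] at h3 ⊢
  intro ε hε
  obtain ⟨δ, hδ, H⟩ := h3 ε hε
  refine ⟨δ, hδ, fun E hE hE' => ?_⟩
  refine lt_of_eq_of_lt (Finset.sum_congr rfl fun i hi => ?_) (H E hE hE')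
  have h4 := hE.1 i hi
  rw [uIcc_of_le hab] at h4
  rw [h.2 _ h4.1, h.2 _ h4.2]
  rfl

theorem continuousOn (hab : a ≤ b) (h : IsPrimitiveOn F f a b) : ContinuousOn F (Icc a b) := by
  simpa [uIcc_of_le hab] using (h.absolutelyContinuousOnInterval hab).continuousOn

theorem ae_hasDerivAt (hab : a ≤ b) (h : IsPrimitiveOn F f a b) :
    ∀ᵐ t, t ∈ Icc a b → HasDerivAt F (f t) t := by
  -- The integral formula is known on `[a, b]` only, so a two-sided derivative is available only in
  -- the interior; the endpoints are a null set.
  have h1 : ∀ᵐ x : ℝ, x ≠ a := by simp [ae_iff, measure_singleton]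
  have h2 : ∀ᵐ x : ℝ, x ≠ b := by simp [ae_iff, measure_singleton]
  filter_upwards [h.1.ae_hasDerivAt_integral, h1, h2] with t ht hta htb htm
  rw [uIcc_of_le hab] at ht
  have h3 := (ht htm a (left_mem_Icc.2 hab)).const_add (F a)
  refine h3.congr_of_eventuallyEq ?_
  filter_upwards [Icc_mem_nhds (lt_of_le_of_ne htm.1 hta.symm) (lt_of_le_of_ne htm.2 htb)] with s hs
  exact h.2 s hs

theorem mono (h : IsPrimitiveOn F f a b) {a' b' : ℝ} (haa : a ≤ a') (hab : a' ≤ b') (hbb : b' ≤ b) :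
    IsPrimitiveOn F f a' b' := by
  have h1 : IntervalIntegrable f volume a' b' := h.1.mono_set (by
    rw [uIcc_of_le hab, uIcc_of_le (haa.trans (hab.trans hbb))]; exact Icc_subset_Icc haa hbb)
  refine ⟨h1, fun t ht => ?_⟩
  have ha' : a' ∈ Icc a b := ⟨haa, hab.trans hbb⟩
  have ht' : t ∈ Icc a b := ⟨haa.trans ht.1, ht.2.trans hbb⟩
  rw [h.2 t ht', h.2 a' ha', add_assoc, intervalIntegral.integral_add_adjacent_intervals
    (h.intervalIntegrable_left ha') ((h.intervalIntegrable_left ha').symm.trans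
      (h.intervalIntegrable_left ht'))]

theorem integral_eq (h : IsPrimitiveOn F f a b) (hab : a ≤ b) : ∫ s in a..b, f s = F b - F a := by
  rw [h.2 b ⟨hab, le_rfl⟩]; ring

theorem congr (h : IsPrimitiveOn F f a b) (hF : ∀ t ∈ Icc a b, F t = G t) 
    (hf : ∀ᵐ t, t ∈ Ioc a b → f t = g t) (hab : a ≤ b) : IsPrimitiveOn G g a b := by
  refine ⟨h.1.congr_ae ?_, fun t ht => ?_⟩
  · rw [uIoc_of_le hab]; exact (ae_restrict_iff' measurableSet_Ioc).2 hf
  · rw [← hF t ht, ← hF a ⟨le_rfl, hab⟩, h.2 t ht]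
    congr 1
    refine intervalIntegral.integral_congr_ae ?_
    filter_upwards [hf] with s hs hs'
    rw [uIoc_of_le ht.1] at hs'
    exact hs ⟨hs'.1, hs'.2.trans ht.2⟩

theorem concat (h : IsPrimitiveOn F f a b) (h' : IsPrimitiveOn F f b c) (hab : a ≤ b) :
    IsPrimitiveOn F f a c := by
  refine ⟨h.1.trans h'.1, fun t ht => ?_⟩
  rcases le_total t b with htb | htb
  · exact h.2 t ⟨ht.1, htb⟩
  · rw [h'.2 t ⟨htb, ht.2⟩, h.2 b ⟨hab, le_rfl⟩, add_assoc,
      intervalIntegral.integral_add_adjacent_intervals h.1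
        (h'.intervalIntegrable_left ⟨htb, ht.2⟩)]

theorem comp_sub (h : IsPrimitiveOn F f a b) (c : ℝ) :
    IsPrimitiveOn (fun t => F (t - c)) (fun t => f (t - c)) (a + c) (b + c) := by
  refine ⟨by simpa using h.1.comp_sub_right c, fun t ht => ?_⟩
  have h1 := h.2 (t - c) ⟨by linarith [ht.1], by linarith [ht.2]⟩
  simp only [add_sub_cancel_right]
  rw [h1, intervalIntegral.integral_comp_sub_right (fun x => f x) c]
  simp

protected theorem add (h : IsPrimitiveOn F f a b) (h' : IsPrimitiveOn G g a b) :
    IsPrimitiveOn (fun t => F t + G t) (fun t => f t + g t) a b := by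
  refine ⟨h.1.add h'.1, fun t ht => ?_⟩
  simp only
  rw [intervalIntegral.integral_add (h.intervalIntegrable_left ht) (h'.intervalIntegrable_left ht),
    h.2 t ht, h'.2 t ht]
  ring

theorem const_mul (h : IsPrimitiveOn F f a b) (c : ℝ) :
    IsPrimitiveOn (fun t => c * F t) (fun t => c * f t) a b := by
  refine ⟨h.1.const_mul c, fun t ht => ?_⟩
  simp only
  rw [intervalIntegral.integral_const_mul, h.2 t ht]
  ring

theorem of_integral (hf : IntervalIntegrable f volume a b) (c : ℝ) :
    IsPrimitiveOn (fun t => c + ∫ s in a..t, f s) f a b :=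
  ⟨hf, fun t _ => by simp⟩

theorem of_hasDerivAt (hd : ∀ t, HasDerivAt F (f t) t) (hf : Continuous f) :
    IsPrimitiveOn F f a b := by
  refine ⟨hf.intervalIntegrable a b, fun t ht => ?_⟩
  rw [intervalIntegral.integral_eq_sub_of_hasDerivAt (fun x _ => hd x) (hf.intervalIntegrable a t)]
  ring

/-- Integration by parts for absolutely continuous functions. Controls are merely square integrable
in time, so velocities are differentiable only almost everywhere; this product rule replaces the
chain rule in the energy identity and in Duhamel's formula. -/
protected theorem mul (hab : a ≤ b) (h : IsPrimitiveOn F f a b) (h' : IsPrimitiveOn G g a b) :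
    IsPrimitiveOn (fun t => F t * G t) (fun t => f t * G t + F t * g t) a b := by
  have hc := h.continuousOn hab
  have hc' := h'.continuousOn hab
  rw [← uIcc_of_le hab] at hc hc'
  refine ⟨(h.1.mul_continuousOn hc').add (h'.1.continuousOn_mul hc), fun t ht => ?_⟩
  have k := h.mono le_rfl ht.1 ht.2
  have k' := h'.mono le_rfl ht.1 ht.2
  have h1 := (k.absolutelyContinuousOnInterval ht.1).integral_deriv_mul_eq_sub
    (k'.absolutelyContinuousOnInterval ht.1)
  have h2 : ∫ s in a..t, f s * G s + F s * g s = F t * G t - F a * G a := by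
    rw [← h1]
    refine intervalIntegral.integral_congr_ae ?_
    filter_upwards [k.ae_hasDerivAt ht.1, k'.ae_hasDerivAt ht.1] with s hs hs' hm
    rw [uIoc_of_le ht.1] at hm
    rw [(hs (Ioc_subset_Icc_self hm)).deriv, (hs' (Ioc_subset_Icc_self hm)).deriv]
  simp only
  rw [h2]
  ring

end IsPrimitiveOn

/-! ### The forced damped oscillator -/

/-- `p` and `r = p'` solve `μ p'' + p' = -a p + f` on `[t₁, t₂]`. -/
structure IsModeSolution (μ a t₁ t₂ : ℝ) (f p r : ℝ → ℝ) : Prop where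
  pos : IsPrimitiveOn p r t₁ t₂
  vel : IsPrimitiveOn (fun t => μ * r t) (fun t => -(a * p t) - r t + f t) t₁ t₂

/-- The modified energy of the damped oscillator. -/
def modeEnergy (μ a p r : ℝ) : ℝ := (μ * r + p) ^ 2 / 2 + (μ * r) ^ 2 / 2 + μ * a * p ^ 2

theorem modeEnergy_nonneg {μ a : ℝ} (hμ : 0 < μ) (ha : 0 < a) (p r : ℝ) :
    0 ≤ modeEnergy μ a p r := by
  unfold modeEnergy; positivity

theorem le_modeEnergy (μ a p r : ℝ) :
    (μ * r) ^ 2 / 2 + μ * a * p ^ 2 ≤ modeEnergy μ a p r := by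
  unfold modeEnergy; nlinarith [sq_nonneg (μ * r + p)]

theorem modeEnergy_le (μ a p r : ℝ) :
    modeEnergy μ a p r ≤ 3 / 2 * (μ * r) ^ 2 + p ^ 2 + μ * a * p ^ 2 := by
  unfold modeEnergy; nlinarith [sq_nonneg (μ * r - p)]

namespace IsModeSolution

variable {μ a t₁ t₂ : ℝ} {f p r : ℝ → ℝ}

theorem mono (h : IsModeSolution μ a t₁ t₂ f p r) {s₁ s₂ : ℝ} (h1 : t₁ ≤ s₁) (h2 : s₁ ≤ s₂)
    (h3 : s₂ ≤ t₂) : IsModeSolution μ a s₁ s₂ f p r :=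
  ⟨h.pos.mono h1 h2 h3, h.vel.mono h1 h2 h3⟩

theorem vel' (hμ : μ ≠ 0) (h : IsModeSolution μ a t₁ t₂ f p r) :
    IsPrimitiveOn r (fun t => μ⁻¹ * (-(a * p t) - r t + f t)) t₁ t₂ := by
  have := h.vel.const_mul μ⁻¹
  simpa only [inv_mul_cancel_left₀ hμ] using this

/-- The natural energy `μ r² + a p²` dissipates only the velocity. Adding the square of `μ r + p`,
whose derivative is `-a p + f`, also produces the damping `-a p²`, while the cross terms `a p r`
cancel. -/
theorem energy_le (hμ : 0 < μ) (ha : 0 < a) (h12 : t₁ ≤ t₂)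
    (h : IsModeSolution μ a t₁ t₂ f p r) (hf : IntervalIntegrable (fun t => f t ^ 2) volume t₁ t₂) :
    modeEnergy μ a (p t₂) (r t₂) + ∫ t in t₁..t₂, (a * p t ^ 2 + μ * r t ^ 2) / 2 ≤
      modeEnergy μ a (p t₁) (r t₁) + ∫ t in t₁..t₂, ((2 * a)⁻¹ + 2 * μ) * f t ^ 2 := by
  have hy := h.vel
  have hs := h.vel.add h.pos
  have hE := (((hs.mul h12 hs).const_mul (1 / 2)).add ((hy.mul h12 hy).const_mul (1 / 2))).add
    ((h.pos.mul h12 h.pos).const_mul (μ * a))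
  have h1 := hE.integral_eq h12
  have hpc : ContinuousOn p (uIcc t₁ t₂) := by
    rw [uIcc_of_le h12]; exact h.pos.continuousOn h12
  have hrc : ContinuousOn r (uIcc t₁ t₂) := by
    rw [uIcc_of_le h12]; exact (h.vel' hμ.ne').continuousOn h12
  have hi1 : IntervalIntegrable (fun t => (a * p t ^ 2 + μ * r t ^ 2) / 2) volume t₁ t₂ :=
    ContinuousOn.intervalIntegrable (by fun_prop)
  have hi2 : IntervalIntegrable (fun t => ((2 * a)⁻¹ + 2 * μ) * f t ^ 2) volume t₁ t₂ :=
    hf.const_mul _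
  -- Young's inequality twice: `f p ≤ a p²/2 + f²/(2a)` and `2 μ f r ≤ μ r²/2 + 2 μ f²`.
  have h2 := intervalIntegral.integral_mono_on h12 hE.1 (hi2.sub hi1) (fun t _ => by
    have e1 : (2 * a)⁻¹ * f t ^ 2 = a * (f t / a) ^ 2 / 2 := by field_simp
    have e2 : f t * p t = a * ((f t / a) * p t) := by field_simp
    simp only [add_mul, e1]
    nlinarith [mul_nonneg ha.le (sq_nonneg (f t / a - p t)), mul_nonneg hμ.le
      (sq_nonneg (2 * f t - r t)), e2])
  rw [intervalIntegral.integral_sub hi2 hi1, h1] at h2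
  unfold modeEnergy
  nlinarith [h2]

end IsModeSolution

/-! ### The variation of constants formula for a mode -/

theorem modeFlow_add (μ a s t : ℝ) (w : ℝ × ℝ) :
    modeFlow μ a (s + t) w = modeFlow μ a s (modeFlow μ a t w) := by
  have h : Commute (s • modeGenerator μ a) (t • modeGenerator μ a) :=
    ((Commute.refl _).smul_left s).smul_right t
  unfold modeFlow
  let _ : NormedAlgebra ℚ ((ℝ × ℝ) →L[ℝ] (ℝ × ℝ)) := NormedAlgebra.restrictScalars ℚ ℝ _
  rw [add_smul, NormedSpace.exp_add_of_commute h]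
  rfl

theorem modeGenerator_modeFlow (μ a t : ℝ) (w : ℝ × ℝ) :
    modeGenerator μ a (modeFlow μ a t w) = modeFlow μ a t (modeGenerator μ a w) := by
  have h : Commute (modeGenerator μ a) (modeFlow μ a t) :=
    ((Commute.refl (modeGenerator μ a)).smul_right t).exp_right
  exact DFunLike.congr_fun h.eq w

theorem modeGenerator_apply (μ a : ℝ) (w : ℝ × ℝ) :
    modeGenerator μ a w = (w.2, μ⁻¹ * (-(a * w.1) - w.2)) := by
  simp [modeGenerator]

theorem continuous_modeFlow (μ a : ℝ) (w : ℝ × ℝ) : Continuous fun t => modeFlow μ a t w :=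
  continuous_iff_continuousAt.2 fun t => (hasDerivAt_modeFlow μ a t w).continuousAt

theorem clm_prod_apply (L : (ℝ × ℝ) →L[ℝ] ℝ) (x y : ℝ) :
    L (x, y) = x * L (1, 0) + y * L (0, 1) := by
  have : ((x, y) : ℝ × ℝ) = x • (1, 0) + y • (0, 1) := by simp
  rw [this, map_add, map_smul, map_smul]
  rfl

/-- The product rule for `t ↦ L (M(ε t + c) (p(t), r(t)))`, `M` the flow of the oscillator. -/
theorem IsPrimitiveOn.modeFlow_apply {μ a t₁ t₂ : ℝ} (h12 : t₁ ≤ t₂) {p r p' r' : ℝ → ℝ}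
    (hp : IsPrimitiveOn p p' t₁ t₂) (hr : IsPrimitiveOn r r' t₁ t₂) (ε c : ℝ)
    (L : (ℝ × ℝ) →L[ℝ] ℝ) :
    IsPrimitiveOn (fun t => L (modeFlow μ a (ε * t + c) (p t, r t)))
      (fun t => L (modeFlow μ a (ε * t + c) (ε • modeGenerator μ a (p t, r t) + (p' t, r' t))))
      t₁ t₂ := by
  -- For a fixed vector the flow is smooth in time; by linearity the moving vector `(p, r)` is
  -- reduced to the two basis vectors with scalar coefficients.
  have key : ∀ w : ℝ × ℝ, IsPrimitiveOn (fun t => L (modeFlow μ a (ε * t + c) w))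
      (fun t => ε * L (modeGenerator μ a (modeFlow μ a (ε * t + c) w))) t₁ t₂ := fun w => by
    refine of_hasDerivAt (fun t => ?_) ?_
    · have h1 : HasDerivAt (fun t => ε * t + c) ε t := by
        simpa using ((hasDerivAt_id t).const_mul ε).add_const c
      have h2 := (hasDerivAt_modeFlow μ a (ε * t + c) w).scomp t h1
      have h3 := L.hasFDerivAt.comp_hasDerivAt t h2
      refine h3.congr_deriv ?_
      simp
    · have h1 := (continuous_modeFlow μ a w).comp (by fun_prop : Continuous fun t : ℝ => ε * t + c)
      exact continuous_const.mul (L.continuous.comp ((modeGenerator μ a).continuous.comp h1))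
  have h := (hp.mul h12 (key (1, 0))).add (hr.mul h12 (key (0, 1)))
  have e1 : ∀ t x y, L (modeFlow μ a t (x, y)) =
      x * L (modeFlow μ a t (1, 0)) + y * L (modeFlow μ a t (0, 1)) := fun t x y =>
    clm_prod_apply (L.comp (modeFlow μ a t)) x y
  have e2 : ∀ t x y, L (modeFlow μ a t (modeGenerator μ a (x, y))) =
      x * L (modeFlow μ a t (modeGenerator μ a (1, 0))) +
        y * L (modeFlow μ a t (modeGenerator μ a (0, 1))) := fun t x y =>
    clm_prod_apply ((L.comp (modeFlow μ a t)).comp (modeGenerator μ a)) x y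
  refine h.congr (fun t _ => (e1 _ _ _).symm) (Eventually.of_forall fun t _ => ?_) h12
  simp only [map_add, map_smul, smul_eq_mul, modeGenerator_modeFlow]
  rw [e2 _ (p t) (r t), e1 _ (p' t) (r' t)]
  ring

/-- From the equation to the formula, integrate the derivative of `s ↦ M(t - s)(p(s), r(s))`, `M`
being the flow: the generator terms cancel and only the force remains. In the other direction the
flow is undone, which is possible because it is a group. -/
theorem isModeSolution_iff_duhamel {μ a t₁ t₂ : ℝ} (hμ : μ ≠ 0) (h12 : t₁ ≤ t₂) {f p r : ℝ → ℝ}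
    (hf : IntervalIntegrable f volume t₁ t₂) :
    IsModeSolution μ a t₁ t₂ f p r ↔ ∀ t ∈ Icc t₁ t₂, (p t, r t) =
      modeFlow μ a (t - t₁) (p t₁, r t₁) + ∫ s in t₁..t, modeFlow μ a (t - s) (0, μ⁻¹ * f s) := by
  have hint : ∀ t ∈ Icc t₁ t₂, ∀ c : ℝ,
      IntervalIntegrable (fun s => modeFlow μ a (c - s) (0, μ⁻¹ * f s)) volume t₁ t := by
    intro t ht c
    have h1 : (fun s => modeFlow μ a (c - s) (0, μ⁻¹ * f s)) =
        fun s => (μ⁻¹ * f s) • modeFlow μ a (c - s) (0, 1) := by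
      funext s
      rw [← map_smul]
      simp
    rw [h1]
    refine IntervalIntegrable.smul_continuousOn ?_ ?_
    · exact (hf.mono_set (by
        rw [uIcc_of_le ht.1, uIcc_of_le h12]; exact Icc_subset_Icc_right ht.2)).const_mul _
    · exact ((continuous_modeFlow μ a (0, 1)).comp
        (by fun_prop : Continuous fun s : ℝ => c - s)).continuousOn
  constructor
  · intro h t ht
    have hL : ∀ L : (ℝ × ℝ) →L[ℝ] ℝ, L (p t, r t) = L (modeFlow μ a (t - t₁) (p t₁, r t₁) +
        ∫ s in t₁..t, modeFlow μ a (t - s) (0, μ⁻¹ * f s)) := by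
      intro L
      have h' := h.mono le_rfl ht.1 ht.2
      have h1 := (IsPrimitiveOn.modeFlow_apply (μ := μ) (a := a) ht.1 h'.pos (h'.vel' hμ) (-1) t
        L).integral_eq ht.1
      rw [map_add, ← L.intervalIntegral_comp_comm (hint t ht t)]
      have e1 : -1 * t + t = 0 := by ring
      have e2 : ∀ s, -1 * s + t = t - s := fun s => by ring
      simp only [e1, e2, modeFlow_zero, modeGenerator_apply] at h1
      have e3 : ∀ s, (-1 : ℝ) • ((r s, μ⁻¹ * (-(a * p s) - r s)) : ℝ × ℝ) +
          (r s, μ⁻¹ * (-(a * p s) - r s + f s)) = (0, μ⁻¹ * f s) := fun s => by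
        ext
        · simp
        · simp; ring
      simp only [e3] at h1
      linarith
    exact Prod.ext (hL (ContinuousLinearMap.fst ℝ ℝ ℝ)) (hL (ContinuousLinearMap.snd ℝ ℝ ℝ))
  · intro h
    -- The force pulled back to time `t₁`: the state is `M(t - t₁)` applied to an absolutely
    -- continuous curve with derivative `g`, so the product rule applies.
    set g : ℝ → ℝ × ℝ := fun s => modeFlow μ a (t₁ - s) (0, μ⁻¹ * f s) with hg
    have hgi : IntervalIntegrable g volume t₁ t₂ := hint t₂ ⟨h12, le_rfl⟩ t₁
    have hg1 : IntervalIntegrable (fun s => (g s).1) volume t₁ t₂ :=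
      ⟨hgi.1.fst, hgi.2.fst⟩
    have hg2 : IntervalIntegrable (fun s => (g s).2) volume t₁ t₂ :=
      ⟨hgi.1.snd, hgi.2.snd⟩
    have P1 := IsPrimitiveOn.of_integral hg1 (p t₁)
    have P2 := IsPrimitiveOn.of_integral hg2 (r t₁)
    have hw : ∀ t ∈ Icc t₁ t₂, (p t, r t) = modeFlow μ a (1 * t + -t₁)
        (p t₁ + ∫ s in t₁..t, (g s).1, r t₁ + ∫ s in t₁..t, (g s).2) := by
      intro t ht
      have e1 : ∫ s in t₁..t, g s = (∫ s in t₁..t, (g s).1, ∫ s in t₁..t, (g s).2) := by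
        have h1 := (ContinuousLinearMap.fst ℝ ℝ ℝ).intervalIntegral_comp_comm (hint t ht t₁)
        have h2 := (ContinuousLinearMap.snd ℝ ℝ ℝ).intervalIntegral_comp_comm (hint t ht t₁)
        exact Prod.ext h1.symm h2.symm
      have e2 : ((p t₁ + ∫ s in t₁..t, (g s).1, r t₁ + ∫ s in t₁..t, (g s).2) : ℝ × ℝ) =
          (p t₁, r t₁) + ∫ s in t₁..t, g s := by rw [e1]; rfl
      rw [e2, map_add, h t ht, one_mul, ← sub_eq_add_neg,
        ← (modeFlow μ a (t - t₁)).intervalIntegral_comp_comm (hint t ht t₁)]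
      congr 1
      refine intervalIntegral.integral_congr fun s _ => ?_
      simp only [← modeFlow_add]
      congr 2
      ring
    have hd : ∀ t, modeFlow μ a (1 * t + -t₁) (g t) = (0, μ⁻¹ * f t) := fun t => by
      simp only [hg, ← modeFlow_add]
      rw [show 1 * t + -t₁ + (t₁ - t) = 0 by ring, modeFlow_zero]
    have hprim : ∀ L : (ℝ × ℝ) →L[ℝ] ℝ, IsPrimitiveOn (fun t => L (p t, r t))
        (fun t => L (r t, μ⁻¹ * (-(a * p t) - r t + f t))) t₁ t₂ := by
      intro L
      refine (IsPrimitiveOn.modeFlow_apply (μ := μ) (a := a) h12 P1 P2 1 (-t₁) L).congr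
        (fun t ht => by rw [← hw t ht]) (Eventually.of_forall fun t ht => ?_) h12
      rw [one_smul, map_add, ← modeGenerator_modeFlow, ← hw t (Ioc_subset_Icc_self ht)]
      rw [show ((g t).1, (g t).2) = g t from rfl, hd, modeGenerator_apply]
      congr 1
      ext
      · simp
      · simp; ring
    refine ⟨hprim (ContinuousLinearMap.fst ℝ ℝ ℝ), ?_⟩
    have := (hprim (ContinuousLinearMap.snd ℝ ℝ ℝ)).const_mul μ
    simpa only [ContinuousLinearMap.coe_snd', mul_inv_cancel_left₀ hμ] using this

section Coefficients

variable {d : ℕ} {D : Set (EuclideanSpace ℝ (Fin d))} {S : DirichletEigensystem D} {δ : ℝ}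

/-! ### Fourier coefficients and norms -/

theorem Sob.coeff_add (x y : Sob S δ) (k : ℕ) : (x + y).coeff k = x.coeff k + y.coeff k :=
  mul_add _ _ _

theorem Sob.coeff_smul (c : ℝ) (x : Sob S δ) (k : ℕ) : (c • x).coeff k = c * x.coeff k :=
  mul_left_comm _ _ _

theorem Sob.coeff_zero (k : ℕ) : (0 : Sob S δ).coeff k = 0 :=
  mul_zero _

theorem Sob.coeff_sub (x y : Sob S δ) (k : ℕ) : (x - y).coeff k = x.coeff k - y.coeff k :=
  mul_sub _ _ _

theorem Sob.ext {x y : Sob S δ} (h : ∀ k, x.coeff k = y.coeff k) : x = y := by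
  have h1 : ∀ k, x.toLp k = y.toLp k := fun k =>
    mul_left_cancel₀ (Real.rpow_pos_of_pos (S.α_pos k) (-δ / 2)).ne' (h k)
  exact lp.ext (funext h1)

theorem Sob.hasSum_norm_sq (x : Sob S δ) :
    HasSum (fun k => S.α k ^ δ * x.coeff k ^ 2) (‖x‖ ^ 2) := by
  have h := Sob.inner_eq_tsum x x
  rw [real_inner_self_eq_norm_sq] at h
  rw [h]
  have h2 := (Sob.summable_coeff x).hasSum
  simpa only [pow_two, mul_assoc] using h2

theorem Sob.abs_coeff_le (x : Sob S δ) (k : ℕ) : |x.coeff k| ≤ S.α k ^ (-δ / 2) * ‖x‖ := by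
  have h := le_hasSum x.hasSum_norm_sq k fun j _ =>
    mul_nonneg (Real.rpow_nonneg (S.α_pos j).le _) (sq_nonneg _)
  rw [Sob.weight_mul_coeff_sq] at h
  have h1 := abs_le_of_sq_le_sq' h (norm_nonneg _)
  rw [Sob.coeff, abs_mul, abs_of_nonneg (Real.rpow_nonneg (S.α_pos k).le _)]
  exact mul_le_mul_of_nonneg_left (abs_le.2 h1) (Real.rpow_nonneg (S.α_pos k).le _)

variable (S δ) in
/-- The `k`-th Fourier coefficient as a continuous linear functional on `H^δ`. -/
def Sob.coeffL (k : ℕ) : Sob S δ →L[ℝ] ℝ :=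
  LinearMap.mkContinuous
    { toFun := fun x => x.coeff k
      map_add' := fun x y => Sob.coeff_add x y k
      map_smul' := fun c x => Sob.coeff_smul c x k } (S.α k ^ (-δ / 2)) fun x => x.abs_coeff_le k

variable (S) in
theorem hasSum_inner_sq (u : L2 D) : HasSum (fun k => (inner ℝ (S.e k) u) ^ 2) (‖u‖ ^ 2) := by
  have h := S.e.hasSum_inner_mul_inner u u
  rw [real_inner_self_eq_norm_sq] at h
  convert! h using 2 with k
  rw [real_inner_comm (S.e k) u, pow_two]

theorem L2_ext {u v : L2 D} (h : ∀ k, inner ℝ (S.e k) u = inner ℝ (S.e k) v) : u = v := by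
  refine S.e.repr.injective (lp.ext (funext fun k => ?_))
  simpa only [HilbertBasis.repr_apply_apply] using h k

variable (S) in
/-- The function in `L²(D)` with given Fourier coefficients. -/
def L2ofCoeff (c : ℕ → ℝ) (hc : Summable fun k => c k ^ 2) : L2 D :=
  S.e.repr.symm ⟨c, (memLp_two_iff _).2 hc⟩

theorem inner_L2ofCoeff (c : ℕ → ℝ) (hc : Summable fun k => c k ^ 2) (k : ℕ) :
    inner ℝ (S.e k) (L2ofCoeff S c hc) = c k := by
  rw [← HilbertBasis.repr_apply_apply]
  simp [L2ofCoeff]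

variable (S) in
/-- The `k`-th pair of Fourier coefficients as a continuous linear map. -/
def phaseCoeffL (k : ℕ) : Phase S →L[ℝ] ℝ × ℝ :=
  ((innerSL ℝ (S.e k)).comp (ContinuousLinearMap.fst ℝ _ _)).prod
    ((Sob.coeffL S (-1) k).comp (ContinuousLinearMap.snd ℝ _ _))

theorem phaseCoeffL_apply (k : ℕ) (z : Phase S) : phaseCoeffL S k z = phaseCoeff S z k := rfl

theorem phase_ext {z w : Phase S} (h : ∀ k, phaseCoeff S z k = phaseCoeff S w k) : z = w :=
  Prod.ext (L2_ext fun k => congrArg Prod.fst (h k)) (Sob.ext fun k => congrArg Prod.snd (h k))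

variable (S) in
/-- `embedNegOne` as a continuous linear map. -/
def embedNegOneL : L2 D →L[ℝ] Sob S (-1) :=
  LinearMap.mkContinuous
    { toFun := embedNegOne S
      map_add' := fun x y => Sob.ext fun k => by
        simp only [embedNegOne, Sob.coeff_add, Sob.coeff_ofCoeff, inner_add_right]
      map_smul' := fun c x => Sob.ext fun k => by
        simp only [embedNegOne, Sob.coeff_smul, Sob.coeff_ofCoeff, inner_smul_right,
          RingHom.id_apply] } (√((S.α 0)⁻¹)) fun u => by
    have h1 := (embedNegOne S u).hasSum_norm_sq
    have h2 := (hasSum_inner_sq S u).mul_left (S.α 0)⁻¹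
    have h3 := hasSum_le (fun k => ?_) h1 h2
    · change ‖embedNegOne S u‖ ≤ _
      refine abs_le_of_sq_le_sq' ?_ (by positivity) |>.2
      rwa [mul_pow, Real.sq_sqrt (inv_pos.2 S.α_zero_pos).le]
    · simp only [embedNegOne, Sob.coeff_ofCoeff, Real.rpow_neg_one]
      exact mul_le_mul_of_nonneg_right (inv_anti₀ S.α_zero_pos (S.α_mono (Nat.zero_le k)))
        (sq_nonneg _)

theorem embedNegOne_coeff (u : L2 D) (k : ℕ) : (embedNegOne S u).coeff k = inner ℝ (S.e k) u :=
  Sob.coeff_ofCoeff _ _ k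

theorem continuous_embedNegOne : Continuous (embedNegOne S) := (embedNegOneL S).continuous

theorem phaseCoeff_Bmu (μ : ℝ) (B : L2 D → L2 D) (z : Phase S) (k : ℕ) :
    phaseCoeff S (Bmu S μ B z) k = (0, μ⁻¹ * inner ℝ (S.e k) (B z.1)) := by
  simp [phaseCoeff, Bmu, Sob.coeff_smul, embedNegOne_coeff]

theorem phaseCoeff_Qmu (μ : ℝ) (Q : L2 D →L[ℝ] L2 D) (u : L2 D) (k : ℕ) :
    phaseCoeff S (Qmu S μ Q u) k = (0, μ⁻¹ * inner ℝ (S.e k) (Q u)) := by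
  simp [phaseCoeff, Qmu, Sob.coeff_smul, embedNegOne_coeff]

/-! ### Convergence in the phase space -/

theorem phaseCoeff_sub (z w : Phase S) (k : ℕ) :
    phaseCoeff S (z - w) k = phaseCoeff S z k - phaseCoeff S w k := (phaseCoeffL S k).map_sub z w

theorem tendsto_zero_of_sq {ι E : Type*} [SeminormedAddCommGroup E] {l : Filter ι} {F : ι → E}
    (h : Tendsto (fun i => ‖F i‖ ^ 2) l (𝓝 0)) : Tendsto F l (𝓝 0) := by
  rw [tendsto_zero_iff_norm_tendsto_zero]
  have := (Real.continuous_sqrt.tendsto 0).comp h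
  simpa [Function.comp_def, Real.sqrt_sq (norm_nonneg _)] using this

/-- Dominated convergence in the two series for the squared norms of `F i - z`, with `(x - y)² ≤ 2x²
+ 2y²` supplying the dominating sequence. -/
theorem tendsto_phase_of_dominated {ι : Type*} {l : Filter ι} {F : ι → Phase S} {z : Phase S}
    (hc : ∀ k, Tendsto (fun i => phaseCoeff S (F i) k) l (𝓝 (phaseCoeff S z k))) {g : ℕ → ℝ}
    (hg : Summable g)
    (hb : ∀ᶠ i in l, ∀ k, (phaseCoeff S (F i) k).1 ^ 2 ≤ g k ∧
      S.α k ^ (-1 : ℝ) * (phaseCoeff S (F i) k).2 ^ 2 ≤ g k) : Tendsto F l (𝓝 z) := by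
  have hpos : ∀ k, 0 ≤ S.α k ^ (-1 : ℝ) := fun k => Real.rpow_nonneg (S.α_pos k).le _
  have hfst : Tendsto (fun i => (F i - z).1) l (𝓝 0) := by
    apply tendsto_zero_of_sq
    have h1 : ∀ i, ‖(F i - z).1‖ ^ 2 = ∑' k, (phaseCoeff S (F i - z) k).1 ^ 2 := fun i =>
      (hasSum_inner_sq S (F i - z).1).tsum_eq.symm
    simp only [h1]
    have h2 := tendsto_tsum_of_dominated_convergence (𝓕 := l)
      (f := fun i k => (phaseCoeff S (F i - z) k).1 ^ 2) (g := fun _ => (0 : ℝ))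
      (bound := fun k => 2 * (g k + (phaseCoeff S z k).1 ^ 2))
      ((hg.add (summable_coeff_L2 S z.1)).mul_left 2) (fun k => ?_) ?_
    · simpa using h2
    · have := ((continuous_fst.tendsto _).comp (hc k)).sub_const (phaseCoeff S z k).1
      simpa [phaseCoeff_sub] using this.pow 2
    · filter_upwards [hb] with i hi k
      rw [Real.norm_of_nonneg (sq_nonneg _), phaseCoeff_sub, Prod.fst_sub]
      nlinarith [(hi k).1, sq_nonneg ((phaseCoeff S (F i) k).1 + (phaseCoeff S z k).1)]
  have hsnd : Tendsto (fun i => (F i - z).2) l (𝓝 0) := by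
    apply tendsto_zero_of_sq
    have h1 : ∀ i, ‖(F i - z).2‖ ^ 2 =
        ∑' k, S.α k ^ (-1 : ℝ) * (phaseCoeff S (F i - z) k).2 ^ 2 := fun i =>
      ((F i - z).2.hasSum_norm_sq).tsum_eq.symm
    simp only [h1]
    have h2 := tendsto_tsum_of_dominated_convergence (𝓕 := l)
      (f := fun i k => S.α k ^ (-1 : ℝ) * (phaseCoeff S (F i - z) k).2 ^ 2)
      (g := fun _ => (0 : ℝ))
      (bound := fun k => 2 * (g k + S.α k ^ (-1 : ℝ) * (phaseCoeff S z k).2 ^ 2))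
      ((hg.add (Sob.summable_coeff z.2)).mul_left 2) (fun k => ?_) ?_
    · simpa using h2
    · have := ((continuous_snd.tendsto _).comp (hc k)).sub_const (phaseCoeff S z k).2
      simpa [phaseCoeff_sub] using (this.pow 2).const_mul (S.α k ^ (-1 : ℝ))
    · filter_upwards [hb] with i hi k
      rw [Real.norm_of_nonneg (mul_nonneg (hpos k) (sq_nonneg _)), phaseCoeff_sub, Prod.snd_sub]
      nlinarith [(hi k).2, mul_nonneg (hpos k)
        (sq_nonneg ((phaseCoeff S (F i) k).2 + (phaseCoeff S z k).2))]
  have h := hfst.prodMk_nhds hsnd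
  have h2 := h.add_const z
  rw [show ((0, 0) : Phase S) + z = z from zero_add z] at h2
  exact h2.congr fun i => sub_add_cancel (F i) z

end Coefficients

section Semigroup

variable {d : ℕ} {D : Set (EuclideanSpace ℝ (Fin d))} {S : DirichletEigensystem D}

/-! ### The semigroup -/

theorem semigroup_add_apply {μ : ℝ} (hμ : 0 < μ) (t : ℝ) (z w : Phase S) :
    semigroup S hμ t (z + w) = semigroup S hμ t z + semigroup S hμ t w :=
  phase_ext fun k => by
    simp only [← phaseCoeffL_apply, map_add]
    simp only [phaseCoeffL_apply, phaseCoeff_semigroup, ← map_add]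
    simp only [← phaseCoeffL_apply, map_add]

theorem semigroup_energy {μ : ℝ} (hμ : 0 < μ) (t : ℝ) (z : Phase S) :
    μ * ‖(semigroup S hμ t z).2‖ ^ 2 + ‖(semigroup S hμ t z).1‖ ^ 2 ≤
      Real.exp (2 * |t| / μ) * (μ * ‖z.2‖ ^ 2 + ‖z.1‖ ^ 2) := by
  have H : ∀ w : Phase S, HasSum (fun k => μ * (S.α k ^ (-1 : ℝ) * (phaseCoeff S w k).2 ^ 2) +
      (phaseCoeff S w k).1 ^ 2) (μ * ‖w.2‖ ^ 2 + ‖w.1‖ ^ 2) := fun w =>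
    (w.2.hasSum_norm_sq.mul_left μ).add (hasSum_inner_sq S w.1)
  refine hasSum_le (fun k => ?_) (H _) ((H z).mul_left _)
  rw [phaseCoeff_semigroup]
  exact modeFlow_energy_scaled S hμ t k _

theorem norm_semigroup_le {μ : ℝ} (hμ : 0 < μ) (T : ℝ) :
    ∃ C, 0 ≤ C ∧ ∀ t, |t| ≤ T → ∀ z, ‖semigroup S hμ t z‖ ≤ C * ‖z‖ := by
  set E := Real.exp (2 * T / μ) with hE
  refine ⟨√(E * (μ + 1) * (μ⁻¹ + 1)), Real.sqrt_nonneg _, fun t ht z => ?_⟩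
  have h1 := semigroup_energy hμ t z
  have h2 : Real.exp (2 * |t| / μ) ≤ E := by
    rw [hE]; gcongr
  have h3 : μ * ‖z.2‖ ^ 2 + ‖z.1‖ ^ 2 ≤ (μ + 1) * ‖z‖ ^ 2 := by
    have a1 := norm_fst_le z
    have a2 := norm_snd_le z
    have b1 := pow_le_pow_left₀ (norm_nonneg _) a1 2
    have b2 := pow_le_pow_left₀ (norm_nonneg _) a2 2
    nlinarith
  have h4 : μ * ‖(semigroup S hμ t z).2‖ ^ 2 + ‖(semigroup S hμ t z).1‖ ^ 2 ≤
      E * ((μ + 1) * ‖z‖ ^ 2) := by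
    refine h1.trans (mul_le_mul h2 h3 (by positivity) (by positivity))
  have hX : 0 ≤ E * ((μ + 1) * ‖z‖ ^ 2) := by positivity
  have hE0 : 0 ≤ E * (μ + 1) * (μ⁻¹ + 1) := by positivity
  rw [Prod.norm_def]
  refine max_le ?_ ?_
  · refine abs_le_of_sq_le_sq' ?_ (by positivity) |>.2
    rw [mul_pow, Real.sq_sqrt hE0]
    have : ‖(semigroup S hμ t z).1‖ ^ 2 ≤ E * ((μ + 1) * ‖z‖ ^ 2) := by
      nlinarith [mul_nonneg hμ.le (sq_nonneg ‖(semigroup S hμ t z).2‖)]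
    nlinarith [mul_nonneg hX (inv_pos.2 hμ).le]
  · refine abs_le_of_sq_le_sq' ?_ (by positivity) |>.2
    rw [mul_pow, Real.sq_sqrt hE0]
    have h5 : μ * ‖(semigroup S hμ t z).2‖ ^ 2 ≤ E * ((μ + 1) * ‖z‖ ^ 2) := by
      nlinarith [sq_nonneg ‖(semigroup S hμ t z).1‖]
    have h6 := mul_le_mul_of_nonneg_left h5 (inv_pos.2 hμ).le
    rw [inv_mul_cancel_left₀ hμ.ne'] at h6
    nlinarith

theorem continuous_semigroup_apply {μ : ℝ} (hμ : 0 < μ) (z : Phase S) :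
    Continuous fun t => semigroup S hμ t z := by
  refine continuous_iff_continuousAt.2 fun t => ?_
  refine tendsto_phase_of_dominated (fun k => ?_)
    (((summable_energy S μ z).mul_left (Real.exp (2 * (|t| + 1) / μ))).mul_left (1 + μ⁻¹)) ?_
  · simp only [phaseCoeff_semigroup]
    exact (continuous_modeFlow μ (S.α k) _).tendsto t
  · have : ∀ᶠ s in 𝓝 t, |s| < |t| + 1 :=
      continuous_abs.continuousAt.eventually_lt continuousAt_const (lt_add_one _)
    filter_upwards [this] with s hs k
    rw [phaseCoeff_semigroup]
    have h1 := modeFlow_energy_scaled S hμ s k (phaseCoeff S z k)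
    have h2 : Real.exp (2 * |s| / μ) ≤ Real.exp (2 * (|t| + 1) / μ) := by gcongr
    have hα := Real.rpow_nonneg (S.α_pos k).le (-1)
    have h3 : 0 ≤ μ * (S.α k ^ (-1 : ℝ) * (phaseCoeff S z k).2 ^ 2) + (phaseCoeff S z k).1 ^ 2 := by
      positivity
    have h4 := h1.trans (mul_le_mul_of_nonneg_right h2 h3)
    set X := Real.exp (2 * (|t| + 1) / μ) *
      (μ * (S.α k ^ (-1 : ℝ) * (phaseCoeff S z k).2 ^ 2) + (phaseCoeff S z k).1 ^ 2)
    set P := (modeFlow μ (S.α k) s (phaseCoeff S z k)).1 ^ 2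
    set R := S.α k ^ (-1 : ℝ) * (modeFlow μ (S.α k) s (phaseCoeff S z k)).2 ^ 2
    have hP : 0 ≤ P := sq_nonneg _
    have hR : 0 ≤ R := mul_nonneg hα (sq_nonneg _)
    have hX : 0 ≤ X := by positivity
    have hi := inv_pos.2 hμ
    constructor
    · nlinarith [mul_nonneg hμ.le hR, mul_nonneg hi.le hX]
    · have h5 := mul_le_mul_of_nonneg_left h4 hi.le
      rw [mul_add, inv_mul_cancel_left₀ hμ.ne'] at h5
      nlinarith [mul_nonneg hi.le hP]

/-- Strong continuity together with a bound uniform for bounded times. The joint continuity makes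
the integrands `r ↦ S_μ(c - r) F(r)` measurable, so that the Bochner integrals in the mild
formulation are genuine. -/
theorem continuous_semigroup {μ : ℝ} (hμ : 0 < μ) :
    Continuous fun q : ℝ × Phase S => semigroup S hμ q.1 q.2 := by
  refine continuous_iff_continuousAt.2 fun q => ?_
  obtain ⟨C, _, hC⟩ := norm_semigroup_le (S := S) hμ (|q.1| + 1)
  have h1 : Tendsto (fun p : ℝ × Phase S => semigroup S hμ p.1 (p.2 - q.2)) (𝓝 q) (𝓝 0) := by
    have hb : ∀ᶠ p : ℝ × Phase S in 𝓝 q, |p.1| < |q.1| + 1 :=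
      (continuous_abs.comp continuous_fst).continuousAt.eventually_lt continuousAt_const
        (lt_add_one _)
    refine squeeze_zero_norm' (hb.mono fun p hp => hC p.1 hp.le (p.2 - q.2)) ?_
    have : Continuous fun p : ℝ × Phase S => C * ‖p.2 - q.2‖ := by fun_prop
    simpa using this.tendsto q
  have h2 : Tendsto (fun p : ℝ × Phase S => semigroup S hμ p.1 q.2) (𝓝 q)
      (𝓝 (semigroup S hμ q.1 q.2)) :=
    ((continuous_semigroup_apply hμ q.2).comp continuous_fst).tendsto q
  have h3 := h1.add h2
  rw [zero_add] at h3
  refine h3.congr fun p => ?_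
  rw [← semigroup_add_apply, sub_add_cancel]

theorem intervalIntegrable_semigroup {μ : ℝ} (hμ : 0 < μ) {a b : ℝ} (c : ℝ) {F : ℝ → Phase S}
    (hF : IntervalIntegrable F volume a b) :
    IntervalIntegrable (fun r => semigroup S hμ (c - r) (F r)) volume a b := by
  obtain ⟨C, _, hC⟩ := norm_semigroup_le (S := S) hμ (|c| + (|a| + |b|))
  rw [intervalIntegrable_iff] at hF ⊢
  refine Integrable.mono' (hF.norm.const_mul C) ?_ ?_
  · have hm : AEStronglyMeasurable (fun r => (c - r, F r)) (volume.restrict (uIoc a b)) :=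
      (by fun_prop : Continuous fun r : ℝ => c - r).aestronglyMeasurable.prodMk hF.1
    have h := Continuous.comp_aestronglyMeasurable
      (g := fun q : ℝ × Phase S => semigroup S hμ q.1 q.2) (continuous_semigroup hμ) hm
    exact h
  · refine (ae_restrict_iff' measurableSet_uIoc).2 (Eventually.of_forall fun r hr => hC _ ?_ _)
    refine (abs_sub _ _).trans (add_le_add le_rfl ?_)
    rcases mem_uIoc.1 hr with h | h
    · rcases abs_cases r with h' | h' <;> rcases abs_cases a with h'' | h'' <;>
        rcases abs_cases b with h3 | h3 <;> linarith [h.1, h.2]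
    · rcases abs_cases r with h' | h' <;> rcases abs_cases a with h'' | h'' <;>
        rcases abs_cases b with h3 | h3 <;> linarith [h.1, h.2]

/-! ### Mild solutions, mode by mode -/

variable (S) in
/-- `z` solves `dz/dt = A_μ z + B_μ(z) + Q_μ ψ` on `[t₁, t₂]` in the sense that its Fourier
coefficients solve the forced oscillator equations. -/
structure IsWeakSolution (Q : L2 D →L[ℝ] L2 D) (B : L2 D → L2 D) (μ t₁ t₂ : ℝ)
    (ψ : ℝ → L2 D) (z : ℝ → Phase S) : Prop where
  cont : ContinuousOn z (Icc t₁ t₂)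
  mode : ∀ k, IsModeSolution μ (S.α k) t₁ t₂
    (fun t => inner ℝ (S.e k) (B (z t).1) + inner ℝ (S.e k) (Q (ψ t)))
    (fun t => inner ℝ (S.e k) (z t).1) (fun t => (z t).2.coeff k)

theorem intervalIntegrable_of_memLp {E : Type*} [NormedAddCommGroup E] {ψ : ℝ → E} {a b : ℝ}
    (hab : a ≤ b) (h : MemLp ψ 2 (volume.restrict (Ioo a b))) : IntervalIntegrable ψ volume a b := by
  rw [intervalIntegrable_iff_integrableOn_Ioo_of_le hab]
  exact h.integrable (by norm_num)

/-- The Fourier coefficients separate the points of `𝓗` and, the integrands being integrable,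
commute with the Bochner integrals. The mild equation is therefore the family of Duhamel formulas of
the modes. All later arguments use the mode equations only. -/
theorem isMildSolution_iff {Q : L2 D →L[ℝ] L2 D} {B : L2 D → L2 D} (hB : Continuous B) {μ : ℝ}
    (hμ : 0 < μ) {t₁ t₂ : ℝ} (h12 : t₁ ≤ t₂) {ψ : ℝ → L2 D} {z : ℝ → Phase S}
    (hψ : MemLp ψ 2 (volume.restrict (Ioo t₁ t₂))) :
    IsMildSolution S Q B hμ t₁ t₂ ψ z ↔ IsWeakSolution S Q B μ t₁ t₂ ψ z := by
  suffices H : ContinuousOn z (Icc t₁ t₂) → ((∀ t ∈ Icc t₁ t₂,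
      z t = semigroup S hμ (t - t₁) (z t₁) +
        (∫ r in t₁..t, semigroup S hμ (t - r) (Bmu S μ B (z r))) +
        ∫ r in t₁..t, semigroup S hμ (t - r) (Qmu S μ Q (ψ r))) ↔
      ∀ k, IsModeSolution μ (S.α k) t₁ t₂
        (fun t => inner ℝ (S.e k) (B (z t).1) + inner ℝ (S.e k) (Q (ψ t)))
        (fun t => inner ℝ (S.e k) (z t).1) (fun t => (z t).2.coeff k)) from
    ⟨fun h => ⟨h.1, (H h.1).1 h.2⟩, fun h => ⟨h.1, (H h.1).2 h.2⟩⟩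
  intro hz
  have hψi := intervalIntegrable_of_memLp h12 hψ
  have hBz : ContinuousOn (fun t => B (z t).1) (Icc t₁ t₂) :=
    hB.comp_continuousOn (continuous_fst.comp_continuousOn hz)
  have hBzi : IntervalIntegrable (fun t => B (z t).1) volume t₁ t₂ := by
    apply ContinuousOn.intervalIntegrable
    rwa [uIcc_of_le h12]
  have hLi : ∀ u : ℝ → L2 D, IntervalIntegrable u volume t₁ t₂ →
      IntervalIntegrable (fun t => ((0, μ⁻¹ • embedNegOne S (u t)) : Phase S)) volume t₁ t₂ := by
    intro u hu
    let L : L2 D →L[ℝ] Phase S := (0 : L2 D →L[ℝ] L2 D).prod (μ⁻¹ • embedNegOneL S)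
    exact ⟨L.integrable_comp hu.1, L.integrable_comp hu.2⟩
  have hI1 : IntervalIntegrable (fun t => Bmu S μ B (z t)) volume t₁ t₂ := hLi _ hBzi
  have hI2 : IntervalIntegrable (fun t => Qmu S μ Q (ψ t)) volume t₁ t₂ :=
    hLi (fun t => Q (ψ t)) ⟨Q.integrable_comp hψi.1, Q.integrable_comp hψi.2⟩
  have hf : ∀ k, IntervalIntegrable (fun t => inner ℝ (S.e k) (B (z t).1) +
      inner ℝ (S.e k) (Q (ψ t))) volume t₁ t₂ := fun k =>
    IntervalIntegrable.add ⟨(innerSL ℝ (S.e k)).integrable_comp hBzi.1,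
      (innerSL ℝ (S.e k)).integrable_comp hBzi.2⟩
      ⟨((innerSL ℝ (S.e k)).comp Q).integrable_comp hψi.1,
        ((innerSL ℝ (S.e k)).comp Q).integrable_comp hψi.2⟩
  rw [forall_congr' fun k => isModeSolution_iff_duhamel (a := S.α k) hμ.ne' h12 (hf k)]
  rw [forall_comm]
  refine forall_congr' fun t => ?_
  rw [forall_comm]
  refine forall_congr' fun ht => ?_
  have hsub : uIcc t₁ t ⊆ uIcc t₁ t₂ := by
    rw [uIcc_of_le ht.1, uIcc_of_le h12]; exact Icc_subset_Icc_right ht.2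
  have J1 := intervalIntegrable_semigroup hμ t (hI1.mono_set hsub)
  have J2 := intervalIntegrable_semigroup hμ t (hI2.mono_set hsub)
  have key : ∀ k, phaseCoeff S (semigroup S hμ (t - t₁) (z t₁) +
        (∫ r in t₁..t, semigroup S hμ (t - r) (Bmu S μ B (z r))) +
        ∫ r in t₁..t, semigroup S hμ (t - r) (Qmu S μ Q (ψ r))) k =
      modeFlow μ (S.α k) (t - t₁) (inner ℝ (S.e k) (z t₁).1, (z t₁).2.coeff k) +
        ∫ s in t₁..t, modeFlow μ (S.α k) (t - s) (0, μ⁻¹ *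
          (inner ℝ (S.e k) (B (z s).1) + inner ℝ (S.e k) (Q (ψ s)))) := by
    intro k
    rw [← phaseCoeffL_apply, map_add, map_add,
      ← (phaseCoeffL S k).intervalIntegral_comp_comm J1,
      ← (phaseCoeffL S k).intervalIntegral_comp_comm J2, phaseCoeffL_apply, phaseCoeff_semigroup,
      add_assoc, ← intervalIntegral.integral_add
        ⟨(phaseCoeffL S k).integrable_comp J1.1, (phaseCoeffL S k).integrable_comp J1.2⟩
        ⟨(phaseCoeffL S k).integrable_comp J2.1, (phaseCoeffL S k).integrable_comp J2.2⟩]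
    congr 1
    refine intervalIntegral.integral_congr fun s _ => ?_
    simp only [phaseCoeffL_apply, phaseCoeff_semigroup, phaseCoeff_Bmu, phaseCoeff_Qmu]
    rw [← map_add]
    congr 1
    ext
    · simp
    · simp; ring
  constructor
  · intro h k
    rw [← key k, ← h]
    rfl
  · intro h
    refine phase_ext fun k => ?_
    rw [key k, ← h k]
    rfl

end Semigroup

section Operations

variable {d : ℕ} {D : Set (EuclideanSpace ℝ (Fin d))} {S : DirichletEigensystem D}
  {Q : L2 D →L[ℝ] L2 D} {B : L2 D → L2 D} {μ t₁ t₂ t₃ : ℝ} {ψ ψ' : ℝ → L2 D} {z z' : ℝ → Phase S}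

/-! ### Restriction, concatenation and translation of solutions -/

theorem IsWeakSolution.mono (h : IsWeakSolution S Q B μ t₁ t₂ ψ z) {s₁ s₂ : ℝ} (h1 : t₁ ≤ s₁)
    (h2 : s₁ ≤ s₂) (h3 : s₂ ≤ t₂) : IsWeakSolution S Q B μ s₁ s₂ ψ z :=
  ⟨h.cont.mono (Icc_subset_Icc h1 h3), fun k => (h.mode k).mono h1 h2 h3⟩

theorem IsWeakSolution.congr (h : IsWeakSolution S Q B μ t₁ t₂ ψ z) (h12 : t₁ ≤ t₂)
    (hz : ∀ t ∈ Icc t₁ t₂, z t = z' t) (hψ : ∀ᵐ t, t ∈ Ioc t₁ t₂ → ψ t = ψ' t) :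
    IsWeakSolution S Q B μ t₁ t₂ ψ' z' := by
  refine ⟨h.cont.congr fun t ht => (hz t ht).symm, fun k => ⟨?_, ?_⟩⟩
  · refine (h.mode k).pos.congr (fun t ht => by rw [hz t ht])
      (Eventually.of_forall fun t ht => by rw [hz t (Ioc_subset_Icc_self ht)]) h12
  · refine (h.mode k).vel.congr (fun t ht => by rw [hz t ht]) ?_ h12
    filter_upwards [hψ] with t ht ht'
    rw [hz t (Ioc_subset_Icc_self ht'), ht ht']

theorem IsWeakSolution.concat (h : IsWeakSolution S Q B μ t₁ t₂ ψ z)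
    (h' : IsWeakSolution S Q B μ t₂ t₃ ψ z) (h12 : t₁ ≤ t₂) (h23 : t₂ ≤ t₃) :
    IsWeakSolution S Q B μ t₁ t₃ ψ z := by
  refine ⟨?_, fun k => ⟨(h.mode k).pos.concat (h'.mode k).pos h12,
    (h.mode k).vel.concat (h'.mode k).vel h12⟩⟩
  rw [← Icc_union_Icc_eq_Icc h12 h23]
  exact h.cont.union_of_isClosed h'.cont isClosed_Icc isClosed_Icc

theorem IsWeakSolution.comp_sub (h : IsWeakSolution S Q B μ t₁ t₂ ψ z) (c : ℝ) :
    IsWeakSolution S Q B μ (t₁ + c) (t₂ + c) (fun t => ψ (t - c)) (fun t => z (t - c)) := by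
  refine ⟨h.cont.comp (by fun_prop) fun t ht => ⟨by linarith [ht.1], by linarith [ht.2]⟩,
    fun k => ⟨(h.mode k).pos.comp_sub c, (h.mode k).vel.comp_sub c⟩⟩

theorem isWeakSolution_zero (hB : B 0 = 0) (t₁ t₂ : ℝ) :
    IsWeakSolution S Q B μ t₁ t₂ 0 0 := by
  refine ⟨continuousOn_const, fun k => ⟨⟨?_, ?_⟩, ⟨?_, ?_⟩⟩⟩ <;> simp [hB, Sob.coeff_zero]

/-! ### The action and controls -/

theorem eLpNorm_two_sq {α E : Type*} [MeasurableSpace α] [NormedAddCommGroup E] (f : α → E)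
    (ν : Measure α) : eLpNorm f 2 ν ^ 2 = ∫⁻ t, ‖f t‖ₑ ^ 2 ∂ν := by
  have h := eLpNorm_nnreal_pow_eq_lintegral (f := f) (μ := ν) (p := 2) (by norm_num)
  simpa using h

theorem memLp_two_iff_lintegral {α E : Type*} [MeasurableSpace α] [NormedAddCommGroup E]
    {f : α → E} {ν : Measure α} (hf : AEStronglyMeasurable f ν) :
    MemLp f 2 ν ↔ ∫⁻ t, ‖f t‖ₑ ^ 2 ∂ν ≠ ⊤ := by
  rw [← eLpNorm_two_sq]
  constructor
  · intro h
    exact ENNReal.pow_ne_top h.2.ne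
  · intro h
    refine ⟨hf, lt_top_iff_ne_top.2 fun h' => h ?_⟩
    simp [h']

theorem action_le (hB : Continuous B) (hμ : 0 < μ) (h12 : t₁ ≤ t₂)
    (hψ : MemLp ψ 2 (volume.restrict (Ioo t₁ t₂))) (h : IsWeakSolution S Q B μ t₁ t₂ ψ z) :
    action S Q B hμ t₁ t₂ z ≤ 2⁻¹ * ∫⁻ t in Ioo t₁ t₂, ‖ψ t‖ₑ ^ 2 := by
  refine mul_le_mul_right ?_ _
  rw [← eLpNorm_two_sq]
  exact iInf₂_le ψ ⟨hψ, (isMildSolution_iff hB hμ h12 hψ).2 h⟩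

theorem exists_control_of_action_lt (hB : Continuous B) (hμ : 0 < μ) (h12 : t₁ ≤ t₂) {m : ℝ≥0∞}
    (h : action S Q B hμ t₁ t₂ z < m) :
    ∃ ψ : ℝ → L2 D, MemLp ψ 2 (volume.restrict (Ioo t₁ t₂)) ∧
      IsWeakSolution S Q B μ t₁ t₂ ψ z ∧ 2⁻¹ * ∫⁻ t in Ioo t₁ t₂, ‖ψ t‖ₑ ^ 2 < m := by
  rw [action, ENNReal.mul_iInf_of_ne (by simp) (by simp)] at h
  obtain ⟨ψ, hψ⟩ := iInf_lt_iff.1 h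
  rw [ENNReal.mul_iInf_of_ne (by simp) (by simp)] at hψ
  obtain ⟨⟨h1, h2⟩, h3⟩ := iInf_lt_iff.1 hψ
  rw [eLpNorm_two_sq] at h3
  exact ⟨ψ, h1, (isMildSolution_iff hB hμ h12 h1).1 h2, h3⟩

/-! ### Weighted sums of squares -/

variable (S) in
/-- The square `∑ α_k^δ c_k²` of the norm of `H^δ`, with values in `[0, ∞]`. -/
def sobSum (δ : ℝ) (c : ℕ → ℝ) : ℝ≥0∞ := ∑' k, ENNReal.ofReal (S.α k ^ δ * c k ^ 2)

theorem sobSum_of_hasSum {δ x : ℝ} {c : ℕ → ℝ} (h : HasSum (fun k => S.α k ^ δ * c k ^ 2) x) :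
    sobSum S δ c = ENNReal.ofReal x := by
  rw [sobSum, ← h.tsum_eq, ENNReal.ofReal_tsum_of_nonneg _ h.summable]
  exact fun k => mul_nonneg (Real.rpow_nonneg (S.α_pos k).le _) (sq_nonneg _)

theorem summable_of_sobSum_ne_top {δ : ℝ} {c : ℕ → ℝ} (h : sobSum S δ c ≠ ⊤) :
    Summable fun k => S.α k ^ δ * c k ^ 2 := by
  refine (ENNReal.summable_toReal h).congr fun k => ?_
  exact ENNReal.toReal_ofReal (mul_nonneg (Real.rpow_nonneg (S.α_pos k).le _) (sq_nonneg _))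

theorem sobSum_coeff {δ : ℝ} (x : Sob S δ) : sobSum S δ x.coeff = ENNReal.ofReal (‖x‖ ^ 2) :=
  sobSum_of_hasSum x.hasSum_norm_sq

variable (S) in
theorem sobSum_inner (u : L2 D) :
    sobSum S 0 (fun k => inner ℝ (S.e k) u) = ENNReal.ofReal (‖u‖ ^ 2) :=
  sobSum_of_hasSum (by simpa using hasSum_inner_sq S u)

theorem ofReal_norm_sq {E : Type*} [NormedAddCommGroup E] (u : E) :
    ENNReal.ofReal (‖u‖ ^ 2) = ‖u‖ₑ ^ 2 := by
  rw [ENNReal.ofReal_pow (norm_nonneg _), ofReal_norm]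

theorem α_rpow_le {δ δ' : ℝ} (h : δ ≤ δ') (k : ℕ) :
    S.α k ^ δ ≤ S.α 0 ^ (δ - δ') * S.α k ^ δ' := by
  have h1 : S.α k ^ δ = S.α k ^ (δ - δ') * S.α k ^ δ' := by
    rw [← Real.rpow_add (S.α_pos k), sub_add_cancel]
  rw [h1]
  exact mul_le_mul_of_nonneg_right (Real.rpow_le_rpow_of_nonpos S.α_zero_pos
    (S.α_mono (Nat.zero_le k)) (sub_nonpos.2 h)) (Real.rpow_nonneg (S.α_pos k).le _)

theorem sobSum_mono {δ δ' : ℝ} (h : δ ≤ δ') (c : ℕ → ℝ) :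
    sobSum S δ c ≤ ENNReal.ofReal (S.α 0 ^ (δ - δ')) * sobSum S δ' c := by
  have h0 := Real.rpow_nonneg S.α_zero_pos.le (δ - δ')
  rw [sobSum, sobSum, ← ENNReal.tsum_mul_left]
  refine ENNReal.tsum_le_tsum fun k => ?_
  rw [← ENNReal.ofReal_mul h0]
  refine ENNReal.ofReal_le_ofReal ?_
  rw [← mul_assoc]
  exact mul_le_mul_of_nonneg_right (α_rpow_le h k) (sq_nonneg _)

/-- The free parameter keeps the coefficient of the first term close to `1`. That term will be the
nonlinearity, which has to fit under the dissipation with little room to spare; the constant in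
front of the control is irrelevant. -/
theorem sobSum_add_le {δ ε : ℝ} (hε : 0 < ε) (c c' : ℕ → ℝ) :
    sobSum S δ (fun k => c k + c' k) ≤
      ENNReal.ofReal (1 + ε) * sobSum S δ c + ENNReal.ofReal (1 + ε⁻¹) * sobSum S δ c' := by
  simp only [sobSum]
  rw [← ENNReal.tsum_mul_left, ← ENNReal.tsum_mul_left, ← ENNReal.tsum_add]
  refine ENNReal.tsum_le_tsum fun k => ?_
  have hw := Real.rpow_nonneg (S.α_pos k).le δ
  have hi := inv_pos.2 hε
  rw [← ENNReal.ofReal_mul (by positivity), ← ENNReal.ofReal_mul (by positivity),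
    ← ENNReal.ofReal_add (by positivity) (by positivity)]
  refine ENNReal.ofReal_le_ofReal ?_
  have h1 : (c k + c' k) ^ 2 ≤ (1 + ε) * c k ^ 2 + (1 + ε⁻¹) * c' k ^ 2 := by
    have : c' k = ε * (ε⁻¹ * c' k) := by field_simp
    have h2 : ε⁻¹ * c' k ^ 2 = ε * (ε⁻¹ * c' k) ^ 2 := by field_simp
    have h3 : c k * c' k = ε * (c k * (ε⁻¹ * c' k)) := by field_simp
    nlinarith [mul_nonneg hε.le (sq_nonneg (c k - ε⁻¹ * c' k))]
  nlinarith [mul_le_mul_of_nonneg_left h1 hw]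

/-! ### The assumptions on the coefficients -/

/-- In dimension one `β` may be negative, so only `1 + 2β`, and not `2β`, can be used as a
nonnegative Sobolev index. -/
theorem NoiseAssumption.one_add_two_mul_pos {β : ℝ} (hd : 1 ≤ d) (hQ : NoiseAssumption S β Q) :
    1 / 2 < 1 + 2 * β := by
  have h1 := hQ.β_gt
  have h2 : (1 : ℝ) ≤ d := by exact_mod_cast hd
  linarith

theorem NonlinearityAssumption.sobSum_le {β δ : ℝ} (hB : NonlinearityAssumption S β B)
    (hδ : δ ∈ Icc 0 (1 + 2 * β)) : ∃ γ : ℝ, 0 ≤ γ ∧ γ < S.α 0 ∧ ∀ u : L2 D,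
      sobSum S δ (fun k => inner ℝ (S.e k) (B u)) ≤
        ENNReal.ofReal (γ ^ 2) * sobSum S δ (fun k => inner ℝ (S.e k) u) := by
  obtain ⟨Bδ, hr, γ, hγ, hL⟩ := hB.lipschitz δ hδ
  have hγ0 : (0 : ℝ) ≤ γ := γ.2
  have hα := S.α_zero_pos
  -- The midpoint is still below `α₀` but strictly positive, so that the inequality in `[0, ∞]` also
  -- holds when `u ∉ H^δ`: a zero constant would give `0 · ∞ = 0`.
  have hlt : (γ : ℝ) < (γ + S.α 0) / 2 := by linarith
  refine ⟨(γ + S.α 0) / 2, by positivity, by linarith, fun u => ?_⟩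
  by_cases hu : sobSum S δ (fun k => inner ℝ (S.e k) u) = ⊤
  · rw [hu, ENNReal.mul_top]
    · exact le_top
    · simp only [ne_eq, ENNReal.ofReal_eq_zero, not_le]
      positivity
  · set x : Sob S δ := Sob.ofCoeff _ (summable_of_sobSum_ne_top hu) with hx
    have hxu : x.Represents u := fun k => Sob.coeff_ofCoeff _ _ k
    have h0 : Bδ 0 = 0 := by
      refine Sob.ext fun k => ?_
      have := hr 0 0 (fun k => by rw [Sob.coeff_zero, inner_zero_right]) k
      rw [this, hB.map_zero, inner_zero_right, Sob.coeff_zero]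
    have h1 : ‖Bδ x‖ ≤ (γ + S.α 0) / 2 * ‖x‖ := by
      have := hL.dist_le_mul x 0
      rw [h0, dist_zero_right, dist_zero_right] at this
      exact this.trans (mul_le_mul_of_nonneg_right hlt.le (norm_nonneg _))
    have e1 : (fun k => inner ℝ (S.e k) (B u)) = (Bδ x).coeff :=
      funext fun k => (hr x u hxu k).symm
    have e2 : (fun k => inner ℝ (S.e k) u) = x.coeff := funext fun k => (hxu k).symm
    rw [e1, e2, sobSum_coeff, sobSum_coeff, ← ENNReal.ofReal_mul (sq_nonneg _), ← mul_pow]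
    exact ENNReal.ofReal_le_ofReal (pow_le_pow_left₀ (norm_nonneg _) h1 2)

theorem NonlinearityAssumption.lipschitz_L2 {β : ℝ} (hB : NonlinearityAssumption S β B)
    (hβ : 0 ≤ 1 + 2 * β) : ∃ γ : ℝ, 0 ≤ γ ∧ γ < S.α 0 ∧ ∀ u v : L2 D, ‖B u - B v‖ ≤ γ * ‖u - v‖ := by
  obtain ⟨B₀, hr, γ, hγ, hL⟩ := hB.lipschitz 0 ⟨le_rfl, hβ⟩
  refine ⟨γ, γ.2, hγ, fun u v => ?_⟩
  have hs : ∀ u : L2 D, Summable fun k => S.α k ^ (0 : ℝ) * (inner ℝ (S.e k) u) ^ 2 := fun u => by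
    simpa using summable_coeff_L2 S u
  have hrep : ∀ u : L2 D, (Sob.ofCoeff _ (hs u)).Represents u := fun u k => Sob.coeff_ofCoeff _ _ k
  have hn : ∀ (x y : Sob S 0) (u v : L2 D), x.Represents u → y.Represents v →
      ‖x - y‖ = ‖u - v‖ := by
    intro x y u v hx hy
    have h1 := (x - y).hasSum_norm_sq
    have h2 := hasSum_inner_sq S (u - v)
    have h3 : (fun k => S.α k ^ (0 : ℝ) * (x - y).coeff k ^ 2) =
        fun k => (inner ℝ (S.e k) (u - v)) ^ 2 := by
      funext k
      rw [Real.rpow_zero, one_mul, Sob.coeff_sub, hx k, hy k, inner_sub_right]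
    rw [h3] at h1
    exact (sq_eq_sq₀ (norm_nonneg _) (norm_nonneg _)).1 (h1.unique h2)
  have h := hL.dist_le_mul (Sob.ofCoeff _ (hs u)) (Sob.ofCoeff _ (hs v))
  rwa [dist_eq_norm, dist_eq_norm, hn _ _ _ _ (hrep u) (hrep v),
    hn _ _ _ _ (hr _ _ (hrep u)) (hr _ _ (hrep v))] at h

theorem inner_apply_of_diagonal {lam : ℕ → ℝ} (h : ∀ k, Q (S.e k) = lam k • S.e k) (u : L2 D)
    (k : ℕ) : inner ℝ (S.e k) (Q u) = lam k * inner ℝ (S.e k) u := by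
  have h1 := ((S.e.hasSum_repr u).mapL Q).mapL (innerSL ℝ (S.e k))
  have h2 : ∀ j, innerSL ℝ (S.e k) (Q (S.e.repr u j • S.e j)) =
      if j = k then lam k * inner ℝ (S.e k) u else 0 := by
    intro j
    rw [map_smul, h j, map_smul, map_smul, innerSL_apply_apply,
      orthonormal_iff_ite.1 S.e.orthonormal k j, HilbertBasis.repr_apply_apply]
    by_cases hj : j = k
    · subst hj; simp [mul_comm]
    · simp [hj, Ne.symm hj]
  simp only [h2] at h1
  exact h1.unique (hasSum_ite_eq k _)

theorem NoiseAssumption.exists_eigenvalues {β : ℝ} (hQ : NoiseAssumption S β Q) :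
    ∃ lam : ℕ → ℝ, ∃ c : ℝ, 0 < c ∧ (∀ k, 0 < lam k) ∧
      (∀ k u, inner ℝ (S.e k) (Q u) = lam k * inner ℝ (S.e k) u) ∧
      (∀ k, lam k ^ 2 ≤ c ^ 2 * S.α k ^ (-(2 * β))) ∧
      ∀ k, (lam k)⁻¹ ^ 2 ≤ c ^ 2 * S.α k ^ (2 * β) := by
  obtain ⟨lam, h1, c, hc, h2⟩ := hQ.diagonal
  have hp : ∀ k, 0 < S.α k ^ (-β) := fun k => Real.rpow_pos_of_pos (S.α_pos k) _
  have hlam : ∀ k, 0 < lam k := fun k => lt_of_lt_of_le (mul_pos (inv_pos.2 hc) (hp k)) (h2 k).1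
  have e1 : ∀ k, S.α k ^ (-(2 * β)) = (S.α k ^ (-β)) ^ 2 := fun k => by
    rw [← Real.rpow_natCast, ← Real.rpow_mul (S.α_pos k).le]; congr 1; push_cast; ring
  have e2 : ∀ k, S.α k ^ (2 * β) = ((S.α k ^ (-β)) ^ 2)⁻¹ := fun k => by
    rw [← e1, ← Real.rpow_neg (S.α_pos k).le]; congr 1; ring
  refine ⟨lam, c, hc, hlam, fun k u => inner_apply_of_diagonal h1 u k, fun k => ?_, fun k => ?_⟩
  · rw [e1, ← mul_pow]
    exact pow_le_pow_left₀ (hlam k).le (h2 k).2 2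
  · rw [e2, ← inv_pow, ← mul_pow]
    refine pow_le_pow_left₀ (inv_pos.2 (hlam k)).le ?_ 2
    have := inv_anti₀ (mul_pos (inv_pos.2 hc) (hp k)) (h2 k).1
    rwa [mul_inv, inv_inv] at this

theorem NoiseAssumption.exists_sobSum_le {β : ℝ} (hQ : NoiseAssumption S β Q) :
    ∃ C : ℝ, 0 ≤ C ∧ ∀ u : L2 D, sobSum S (2 * β) (fun k => inner ℝ (S.e k) (Q u)) ≤
      ENNReal.ofReal C * ‖u‖ₑ ^ 2 := by
  obtain ⟨lam, c, hc, _, h1, h2, _⟩ := hQ.exists_eigenvalues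
  refine ⟨c ^ 2, sq_nonneg _, fun u => ?_⟩
  rw [← ofReal_norm_sq, ← sobSum_inner S u, sobSum, sobSum, ← ENNReal.tsum_mul_left]
  refine ENNReal.tsum_le_tsum fun k => ?_
  rw [← ENNReal.ofReal_mul (sq_nonneg _)]
  refine ENNReal.ofReal_le_ofReal ?_
  rw [h1, mul_pow, Real.rpow_zero, one_mul]
  have h3 := mul_le_mul_of_nonneg_left (h2 k) (Real.rpow_nonneg (S.α_pos k).le (2 * β))
  have h4 : S.α k ^ (2 * β) * S.α k ^ (-(2 * β)) = 1 := by
    rw [← Real.rpow_add (S.α_pos k), add_neg_cancel, Real.rpow_zero]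
  have h5 : S.α k ^ (2 * β) * lam k ^ 2 ≤ c ^ 2 := by nlinarith
  nlinarith [mul_le_mul_of_nonneg_right h5 (sq_nonneg (inner ℝ (S.e k) u : ℝ))]

end Operations

/-! ### Integrals over half-lines -/

theorem tendsto_setLIntegral_Ioc_atBot (f : ℝ → ℝ≥0∞) (t : ℝ) :
    Tendsto (fun a => ∫⁻ s in Ioc a t, f s) atBot (𝓝 (∫⁻ s in Iic t, f s)) := by
  have h := tendsto_measure_iUnion_atBot (μ := volume.withDensity f)
    (s := fun a : ℝ => Ioc a t) (monotone_id.Ioc antitone_const)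
  rw [iUnion_Ioc_left, withDensity_apply _ measurableSet_Iic] at h
  refine h.congr fun a => ?_
  simp only [Function.comp_apply, withDensity_apply _ measurableSet_Ioc]

theorem tendsto_setLIntegral_Iic_atBot {f : ℝ → ℝ≥0∞} {t : ℝ} (hf : ∫⁻ s in Iic t, f s ≠ ⊤) :
    Tendsto (fun a => ∫⁻ s in Iic a, f s) atBot (𝓝 0) := by
  have h := tendsto_measure_iInter_atBot (μ := volume.withDensity f) (s := fun a : ℝ => Iic a)
    (fun a => measurableSet_Iic.nullMeasurableSet) monotone_Iic
    ⟨t, by rwa [withDensity_apply _ measurableSet_Iic]⟩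
  have h0 : (⋂ a : ℝ, Iic a) = ∅ := by
    refine eq_empty_of_forall_notMem fun x hx => ?_
    have := mem_iInter.1 hx (x - 1)
    exact absurd (mem_Iic.1 this) (by linarith)
  rw [h0, measure_empty] at h
  refine h.congr fun a => ?_
  simp only [Function.comp_apply, withDensity_apply _ measurableSet_Iic]

theorem exists_lt_of_lintegral_Iic_ne_top {f : ℝ → ℝ≥0∞} {t : ℝ} (hf : ∫⁻ s in Iic t, f s ≠ ⊤)
    {ε : ℝ≥0∞} (hε : ε ≠ 0) : ∃ a < t, f a < ε := by
  by_contra! h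
  refine hf (top_le_iff.1 ?_)
  calc (⊤ : ℝ≥0∞) = ∫⁻ _ in Iio t, ε := by simp [ENNReal.mul_top hε]
    _ ≤ ∫⁻ s in Iio t, f s := setLIntegral_mono' measurableSet_Iio fun s hs => h s hs
    _ ≤ _ := lintegral_mono_set Iio_subset_Iic_self

/-- With values in `[0, ∞]` the inequality can be weighted and summed over the modes before anything
is known to be finite. -/
theorem IsModeSolution.lintegral_energy_le {μ a t₁ t₂ : ℝ} {f p r : ℝ → ℝ} (hμ : 0 < μ)
    (ha : 0 < a) (h12 : t₁ ≤ t₂) (h : IsModeSolution μ a t₁ t₂ f p r) :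
    ENNReal.ofReal (modeEnergy μ a (p t₂) (r t₂)) +
        ∫⁻ t in Ioc t₁ t₂, ENNReal.ofReal ((a * p t ^ 2 + μ * r t ^ 2) / 2) ≤
      ENNReal.ofReal (modeEnergy μ a (p t₁) (r t₁)) +
        ∫⁻ t in Ioc t₁ t₂, ENNReal.ofReal (((2 * a)⁻¹ + 2 * μ) * f t ^ 2) := by
  have hK : 0 < (2 * a)⁻¹ + 2 * μ := by positivity
  rcases eq_or_ne (∫⁻ t in Ioc t₁ t₂, ENNReal.ofReal (((2 * a)⁻¹ + 2 * μ) * f t ^ 2)) ⊤ with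
    htop | htop
  · rw [htop, add_top]; exact le_top
  have hpc : ContinuousOn p (Icc t₁ t₂) := h.pos.continuousOn h12
  have hrc : ContinuousOn r (Icc t₁ t₂) := (h.vel' hμ.ne').continuousOn h12
  -- The force is recovered from the integrable right-hand side of the velocity equation by removing
  -- its continuous part.
  have hfi : IntervalIntegrable f volume t₁ t₂ := by
    have h1 : IntervalIntegrable (fun t => a * p t + r t) volume t₁ t₂ := by
      apply ContinuousOn.intervalIntegrable
      rw [uIcc_of_le h12]
      fun_prop
    refine (h.vel.1.add h1).congr (fun t _ => ?_)
    change -(a * p t) - r t + f t + (a * p t + r t) = f t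
    ring
  have hfm : AEStronglyMeasurable (fun t => ((2 * a)⁻¹ + 2 * μ) * f t ^ 2)
      (volume.restrict (Ioc t₁ t₂)) := (hfi.1.aestronglyMeasurable.pow 2).const_mul _
  have hi2 : IntegrableOn (fun t => ((2 * a)⁻¹ + 2 * μ) * f t ^ 2) (Ioc t₁ t₂) :=
    (lintegral_ofReal_ne_top_iff_integrable hfm (Eventually.of_forall fun t => by positivity)).1 htop
  have hf2 : IntervalIntegrable (fun t => f t ^ 2) volume t₁ t₂ := by
    rw [intervalIntegrable_iff_integrableOn_Ioc_of_le h12]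
    have := hi2.const_mul ((2 * a)⁻¹ + 2 * μ)⁻¹
    simp only [inv_mul_cancel_left₀ hK.ne'] at this
    exact this
  have hi1 : IntegrableOn (fun t => (a * p t ^ 2 + μ * r t ^ 2) / 2) (Ioc t₁ t₂) := by
    refine (ContinuousOn.integrableOn_Icc ?_).mono_set Ioc_subset_Icc_self
    fun_prop
  have key := h.energy_le hμ ha h12 hf2
  rw [intervalIntegral.integral_of_le h12, intervalIntegral.integral_of_le h12] at key
  rw [← ofReal_integral_eq_lintegral_ofReal hi1 (Eventually.of_forall fun t => by positivity),
    ← ofReal_integral_eq_lintegral_ofReal hi2 (Eventually.of_forall fun t => by positivity),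
    ← ENNReal.ofReal_add (modeEnergy_nonneg hμ ha _ _) (integral_nonneg fun t => by positivity),
    ← ENNReal.ofReal_add (modeEnergy_nonneg hμ ha _ _) (integral_nonneg fun t => by positivity)]
  exact ENNReal.ofReal_le_ofReal key

section Weighted

variable {d : ℕ} {D : Set (EuclideanSpace ℝ (Fin d))} {S : DirichletEigensystem D}
  {Q : L2 D →L[ℝ] L2 D} {B : L2 D → L2 D} {μ t₁ t₂ : ℝ} {ψ : ℝ → L2 D} {z : ℝ → Phase S}

/-! ### Weighted energies -/

variable (S) in
/-- The energy of a state in `H^{δ+1} × H^δ`, with values in `[0, ∞]`. -/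
def sobEnergy (μ δ : ℝ) (z : Phase S) : ℝ≥0∞ :=
  ∑' k, ENNReal.ofReal (S.α k ^ δ * modeEnergy μ (S.α k) (phaseCoeff S z k).1 (phaseCoeff S z k).2)

/-- The `k`-th coefficient of the forcing. -/
def forceCoeff (S : DirichletEigensystem D) (Q : L2 D →L[ℝ] L2 D) (B : L2 D → L2 D)
    (ψ : ℝ → L2 D) (z : ℝ → Phase S) (t : ℝ) (k : ℕ) : ℝ :=
  inner ℝ (S.e k) (B (z t).1) + inner ℝ (S.e k) (Q (ψ t))

theorem aemeasurable_phaseCoeff_fst {s : Set ℝ} (hs : MeasurableSet s) (hz : ContinuousOn z s)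
    (k : ℕ) : AEMeasurable (fun t => (phaseCoeff S (z t) k).1) (volume.restrict s) :=
  ((continuous_fst.comp (phaseCoeffL S k).continuous).comp_continuousOn hz).aemeasurable hs

theorem aemeasurable_phaseCoeff_snd {s : Set ℝ} (hs : MeasurableSet s) (hz : ContinuousOn z s)
    (k : ℕ) : AEMeasurable (fun t => (phaseCoeff S (z t) k).2) (volume.restrict s) :=
  ((continuous_snd.comp (phaseCoeffL S k).continuous).comp_continuousOn hz).aemeasurable hs

theorem aemeasurable_inner_B {s : Set ℝ} (hB : Continuous B) (hs : MeasurableSet s)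
    (hz : ContinuousOn z s) (k : ℕ) :
    AEMeasurable (fun t => (inner ℝ (S.e k) (B (z t).1) : ℝ)) (volume.restrict s) :=
  (((innerSL ℝ (S.e k)).continuous.comp (hB.comp continuous_fst)).comp_continuousOn hz).aemeasurable
    hs

theorem aemeasurable_inner_Q {s : Set ℝ} (hψ : AEStronglyMeasurable ψ (volume.restrict s)) (k : ℕ) :
    AEMeasurable (fun t => (inner ℝ (S.e k) (Q (ψ t)) : ℝ)) (volume.restrict s) :=
  (((innerSL ℝ (S.e k)).comp Q).continuous.comp_aestronglyMeasurable hψ).aemeasurable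

theorem aemeasurable_forceCoeff {s : Set ℝ} (hB : Continuous B) (hs : MeasurableSet s)
    (hz : ContinuousOn z s) (hψ : AEStronglyMeasurable ψ (volume.restrict s)) (k : ℕ) :
    AEMeasurable (fun t => forceCoeff S Q B ψ z t k) (volume.restrict s) :=
  (aemeasurable_inner_B hB hs hz k).add (aemeasurable_inner_Q hψ k)

variable (S) in
/-- The dissipation of the `k`-th mode. -/
def modeDissipation (μ : ℝ) (z : Phase S) (k : ℕ) : ℝ :=
  (S.α k * (phaseCoeff S z k).1 ^ 2 + μ * (phaseCoeff S z k).2 ^ 2) / 2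

theorem aemeasurable_modeDissipation {s : Set ℝ} (hs : MeasurableSet s) (hz : ContinuousOn z s)
    (k : ℕ) : AEMeasurable (fun t => modeDissipation S μ (z t) k) (volume.restrict s) :=
  ((((aemeasurable_phaseCoeff_fst hs hz k).pow_const 2).const_mul _).add
    (((aemeasurable_phaseCoeff_snd hs hz k).pow_const 2).const_mul _)).div_const 2

/-- Weighting and summing an energy inequality of the modes. -/
theorem tsum_weighted_le {s : Set ℝ} {δ : ℝ} {E₁ E₂ : ℕ → ℝ} {g f : ℝ → ℕ → ℝ}
    (hg : ∀ k, AEMeasurable (fun t => g t k) (volume.restrict s))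
    (hf : ∀ k, AEMeasurable (fun t => f t k) (volume.restrict s))
    (h : ∀ k, ENNReal.ofReal (E₂ k) + ∫⁻ t in s, ENNReal.ofReal (g t k) ≤
      ENNReal.ofReal (E₁ k) + ∫⁻ t in s, ENNReal.ofReal (f t k)) :
    (∑' k, ENNReal.ofReal (S.α k ^ δ * E₂ k)) +
        ∫⁻ t in s, ∑' k, ENNReal.ofReal (S.α k ^ δ * g t k) ≤
      (∑' k, ENNReal.ofReal (S.α k ^ δ * E₁ k)) +
        ∫⁻ t in s, ∑' k, ENNReal.ofReal (S.α k ^ δ * f t k) := by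
  have hw : ∀ k, 0 ≤ S.α k ^ δ := fun k => Real.rpow_nonneg (S.α_pos k).le _
  rw [lintegral_tsum fun k => ((hg k).const_mul _).ennreal_ofReal,
    lintegral_tsum fun k => ((hf k).const_mul _).ennreal_ofReal, ← ENNReal.tsum_add,
    ← ENNReal.tsum_add]
  refine ENNReal.tsum_le_tsum fun k => ?_
  simp only [ENNReal.ofReal_mul (hw k)]
  rw [lintegral_const_mul'' _ (hg k).ennreal_ofReal, lintegral_const_mul'' _ (hf k).ennreal_ofReal,
    ← mul_add, ← mul_add]
  exact mul_le_mul_right (h k) _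

theorem IsWeakSolution.mode_energy_le (hμ : 0 < μ) (h12 : t₁ ≤ t₂)
    (h : IsWeakSolution S Q B μ t₁ t₂ ψ z) (k : ℕ) :
    ENNReal.ofReal (modeEnergy μ (S.α k) (phaseCoeff S (z t₂) k).1 (phaseCoeff S (z t₂) k).2) +
        ∫⁻ t in Ioc t₁ t₂, ENNReal.ofReal (modeDissipation S μ (z t) k) ≤
      ENNReal.ofReal (modeEnergy μ (S.α k) (phaseCoeff S (z t₁) k).1 (phaseCoeff S (z t₁) k).2) +
        ∫⁻ t in Ioc t₁ t₂, ENNReal.ofReal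
          (((2 * S.α k)⁻¹ + 2 * μ) * forceCoeff S Q B ψ z t k ^ 2) := by
  have := (h.mode k).lintegral_energy_le hμ (S.α_pos k) h12
  simp only [modeDissipation, phaseCoeff, forceCoeff]
  exact this

theorem IsWeakSolution.weighted_energy_le (hμ : 0 < μ) (hB : Continuous B) (h12 : t₁ ≤ t₂)
    (h : IsWeakSolution S Q B μ t₁ t₂ ψ z)
    (hψ : AEStronglyMeasurable ψ (volume.restrict (Ioc t₁ t₂))) (δ : ℝ) :
    sobEnergy S μ δ (z t₂) +
        ∫⁻ t in Ioc t₁ t₂, ∑' k, ENNReal.ofReal (S.α k ^ δ * modeDissipation S μ (z t) k) ≤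
      sobEnergy S μ δ (z t₁) +
        ∫⁻ t in Ioc t₁ t₂, ∑' k, ENNReal.ofReal (S.α k ^ δ *
          (((2 * S.α k)⁻¹ + 2 * μ) * forceCoeff S Q B ψ z t k ^ 2)) := by
  have hz := h.cont.mono Ioc_subset_Icc_self
  exact tsum_weighted_le (S := S) (δ := δ) (s := Ioc t₁ t₂)
    (E₁ := fun k => modeEnergy μ (S.α k) (phaseCoeff S (z t₁) k).1 (phaseCoeff S (z t₁) k).2)
    (E₂ := fun k => modeEnergy μ (S.α k) (phaseCoeff S (z t₂) k).1 (phaseCoeff S (z t₂) k).2)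
    (fun k => aemeasurable_modeDissipation (μ := μ) measurableSet_Ioc hz k)
    (fun k => ((aemeasurable_forceCoeff (Q := Q) hB measurableSet_Ioc hz hψ k).pow_const 2).const_mul
      ((2 * S.α k)⁻¹ + 2 * μ))
    fun k => h.mode_energy_le hμ h12 k

/-- The initial time is sent to `-∞` in each mode separately, before summation. Convergence in `𝓗`
makes every single mode energy vanish there, so no finiteness of the `δ`-energy in the past is
assumed; this is what allows regularity to be gained. -/
theorem weighted_energy_Iic_le (hμ : 0 < μ) (hB : Continuous B) {t : ℝ}
    (h : ∀ a < t, IsWeakSolution S Q B μ a t ψ z) (hz0 : Tendsto z atBot (𝓝 0))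
    (hψ : AEStronglyMeasurable ψ (volume.restrict (Iic t))) (δ : ℝ) :
    sobEnergy S μ δ (z t) +
        ∫⁻ s in Iic t, ∑' k, ENNReal.ofReal (S.α k ^ δ * modeDissipation S μ (z s) k) ≤
      ∫⁻ s in Iic t, ∑' k, ENNReal.ofReal (S.α k ^ δ *
          (((2 * S.α k)⁻¹ + 2 * μ) * forceCoeff S Q B ψ z s k ^ 2)) := by
  have hz : ContinuousOn z (Iic t) := by
    intro s hs
    have h1 := (h (s - 1) (by linarith [mem_Iic.1 hs])).cont s ⟨by linarith, hs⟩
    refine h1.mono_of_mem_nhdsWithin ?_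
    rw [← Ici_inter_Iic, inter_comm]
    exact inter_mem_nhdsWithin _ (Ici_mem_nhds (by linarith))
  have key := tsum_weighted_le (S := S) (δ := δ) (s := Iic t) (E₁ := 0)
    (E₂ := fun k => modeEnergy μ (S.α k) (phaseCoeff S (z t) k).1 (phaseCoeff S (z t) k).2)
    (fun k => aemeasurable_modeDissipation (μ := μ) measurableSet_Iic hz k)
    (fun k => ((aemeasurable_forceCoeff (Q := Q) hB measurableSet_Iic hz hψ k).pow_const 2).const_mul
      ((2 * S.α k)⁻¹ + 2 * μ)) (fun k => ?_)
  · simpa [sobEnergy] using key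
  · simp only [Pi.zero_apply, ENNReal.ofReal_zero, zero_add]
    have hE : Tendsto (fun a => ENNReal.ofReal (modeEnergy μ (S.α k) (phaseCoeff S (z a) k).1
        (phaseCoeff S (z a) k).2)) atBot (𝓝 0) := by
      have h1 := ((phaseCoeffL S k).continuous.tendsto 0).comp hz0
      have h2 : Continuous fun w : ℝ × ℝ => ENNReal.ofReal (modeEnergy μ (S.α k) w.1 w.2) := by
        refine ENNReal.continuous_ofReal.comp ?_
        unfold modeEnergy
        fun_prop
      have h3 := (h2.tendsto _).comp h1
      have h4 : ENNReal.ofReal (modeEnergy μ (S.α k) (phaseCoeffL S k 0).1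
          (phaseCoeffL S k 0).2) = 0 := by
        rw [map_zero]; simp [modeEnergy]
      rw [h4] at h3
      exact h3
    have h4 := (tendsto_setLIntegral_Ioc_atBot
      (fun s => ENNReal.ofReal (modeDissipation S μ (z s) k)) t).const_add
      (ENNReal.ofReal (modeEnergy μ (S.α k) (phaseCoeff S (z t) k).1 (phaseCoeff S (z t) k).2))
    have h5 := hE.add (tendsto_setLIntegral_Ioc_atBot (fun s =>
      ENNReal.ofReal (((2 * S.α k)⁻¹ + 2 * μ) * forceCoeff S Q B ψ z s k ^ 2)) t)
    rw [zero_add] at h5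
    refine le_of_tendsto_of_tendsto h4 h5 ?_
    filter_upwards [Iio_mem_atBot t] with a ha
    exact (h a ha).mode_energy_le hμ (le_of_lt ha) k

end Weighted

section APriori

variable {d : ℕ} {D : Set (EuclideanSpace ℝ (Fin d))} {S : DirichletEigensystem D}
  {Q : L2 D →L[ℝ] L2 D} {B : L2 D → L2 D} {μ t₁ t₂ : ℝ} {ψ : ℝ → L2 D} {z : ℝ → Phase S}

/-! ### Comparison of energies and norms -/

theorem α_rpow_add_one (δ : ℝ) (k : ℕ) : S.α k ^ (δ + 1) = S.α k ^ δ * S.α k := by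
  rw [Real.rpow_add (S.α_pos k), Real.rpow_one]

theorem sobEnergy_le (hμ : 0 < μ) (δ : ℝ) (z : Phase S) :
    sobEnergy S μ δ z ≤
      ENNReal.ofReal ((S.α 0)⁻¹ + μ) * sobSum S (δ + 1) (fun k => (phaseCoeff S z k).1) +
        ENNReal.ofReal (3 / 2 * μ ^ 2) * sobSum S δ (fun k => (phaseCoeff S z k).2) := by
  have h0 := S.α_zero_pos
  simp only [sobEnergy, sobSum]
  rw [← ENNReal.tsum_mul_left, ← ENNReal.tsum_mul_left, ← ENNReal.tsum_add]
  refine ENNReal.tsum_le_tsum fun k => ?_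
  have hk := S.α_pos k
  have hw := Real.rpow_nonneg hk.le δ
  have hw' := Real.rpow_nonneg hk.le (δ + 1)
  rw [← ENNReal.ofReal_mul (by positivity), ← ENNReal.ofReal_mul (by positivity),
    ← ENNReal.ofReal_add (by positivity) (by positivity)]
  refine ENNReal.ofReal_le_ofReal ?_
  rw [α_rpow_add_one]
  set p := (phaseCoeff S z k).1
  set r := (phaseCoeff S z k).2
  have h1 : 1 ≤ (S.α 0)⁻¹ * S.α k := by
    rw [← inv_mul_cancel₀ h0.ne']
    exact mul_le_mul_of_nonneg_left (S.α_mono (Nat.zero_le k)) (inv_pos.2 h0).le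
  have h2 := mul_le_mul_of_nonneg_left (modeEnergy_le μ (S.α k) p r) hw
  have h3 := mul_le_mul_of_nonneg_right h1 (mul_nonneg hw (sq_nonneg p))
  nlinarith

theorem sobSum_fst_le_sobEnergy (hμ : 0 < μ) (δ : ℝ) (z : Phase S) :
    sobSum S (δ + 1) (fun k => (phaseCoeff S z k).1) ≤
      ENNReal.ofReal μ⁻¹ * sobEnergy S μ δ z := by
  simp only [sobEnergy, sobSum]
  rw [← ENNReal.tsum_mul_left]
  refine ENNReal.tsum_le_tsum fun k => ?_
  rw [← ENNReal.ofReal_mul (by positivity)]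
  refine ENNReal.ofReal_le_ofReal ?_
  rw [α_rpow_add_one]
  have hw := Real.rpow_nonneg (S.α_pos k).le δ
  have h1 := le_modeEnergy μ (S.α k) (phaseCoeff S z k).1 (phaseCoeff S z k).2
  have h2 : μ * S.α k * (phaseCoeff S z k).1 ^ 2 ≤
      modeEnergy μ (S.α k) (phaseCoeff S z k).1 (phaseCoeff S z k).2 :=
    (le_add_of_nonneg_left (by positivity)).trans h1
  have h3 := mul_le_mul_of_nonneg_left h2 (mul_nonneg (inv_pos.2 hμ).le hw)
  calc _ = μ⁻¹ * S.α k ^ δ * (μ * S.α k * (phaseCoeff S z k).1 ^ 2) := by field_simp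
    _ ≤ _ := h3
    _ = _ := by ring

theorem sobSum_snd_le_sobEnergy (hμ : 0 < μ) (δ : ℝ) (z : Phase S) :
    sobSum S δ (fun k => (phaseCoeff S z k).2) ≤
      ENNReal.ofReal (2 * (μ ^ 2)⁻¹) * sobEnergy S μ δ z := by
  simp only [sobEnergy, sobSum]
  rw [← ENNReal.tsum_mul_left]
  refine ENNReal.tsum_le_tsum fun k => ?_
  rw [← ENNReal.ofReal_mul (by positivity)]
  refine ENNReal.ofReal_le_ofReal ?_
  have hk := S.α_pos k
  have hw := Real.rpow_nonneg hk.le δ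
  have h1 := le_modeEnergy μ (S.α k) (phaseCoeff S z k).1 (phaseCoeff S z k).2
  have h2 : (μ * (phaseCoeff S z k).2) ^ 2 / 2 ≤
      modeEnergy μ (S.α k) (phaseCoeff S z k).1 (phaseCoeff S z k).2 :=
    (le_add_of_nonneg_right (by positivity)).trans h1
  have h3 := mul_le_mul_of_nonneg_left h2
    (mul_nonneg (by positivity : (0 : ℝ) ≤ 2 * (μ ^ 2)⁻¹) hw)
  calc _ = 2 * (μ ^ 2)⁻¹ * S.α k ^ δ * ((μ * (phaseCoeff S z k).2) ^ 2 / 2) := by field_simp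
    _ ≤ _ := h3
    _ = _ := by ring

theorem tsum_dissipation (hμ : 0 < μ) (δ : ℝ) (z : Phase S) :
    ∑' k, ENNReal.ofReal (S.α k ^ δ * modeDissipation S μ z k) =
      ENNReal.ofReal (1 / 2) * sobSum S (δ + 1) (fun k => (phaseCoeff S z k).1) +
        ENNReal.ofReal (μ / 2) * sobSum S δ (fun k => (phaseCoeff S z k).2) := by
  simp only [sobSum]
  rw [← ENNReal.tsum_mul_left, ← ENNReal.tsum_mul_left, ← ENNReal.tsum_add]
  refine tsum_congr fun k => ?_
  have hw := Real.rpow_nonneg (S.α_pos k).le δ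
  have hw' := Real.rpow_nonneg (S.α_pos k).le (δ + 1)
  rw [← ENNReal.ofReal_mul (by positivity), ← ENNReal.ofReal_mul (by positivity),
    ← ENNReal.ofReal_add (by positivity) (by positivity)]
  congr 1
  rw [α_rpow_add_one, modeDissipation]
  ring

theorem tsum_force_le (hμ : 0 < μ) (δ : ℝ) (f : ℕ → ℝ) :
    ∑' k, ENNReal.ofReal (S.α k ^ δ * (((2 * S.α k)⁻¹ + 2 * μ) * f k ^ 2)) ≤
      ENNReal.ofReal ((2 * S.α 0)⁻¹ + 2 * μ) * sobSum S δ f := by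
  have h0 := S.α_zero_pos
  simp only [sobSum]
  rw [← ENNReal.tsum_mul_left]
  refine ENNReal.tsum_le_tsum fun k => ?_
  rw [← ENNReal.ofReal_mul (by positivity)]
  refine ENNReal.ofReal_le_ofReal ?_
  rw [mul_left_comm]
  refine mul_le_mul_of_nonneg_right ?_
    (mul_nonneg (Real.rpow_nonneg (S.α_pos k).le δ) (sq_nonneg _))
  gcongr
  exact S.α_mono (Nat.zero_le k)

/-- The square of the norm of `𝓗`. -/
def phaseNormSq (z : Phase S) : ℝ≥0∞ := ‖z.1‖ₑ ^ 2 + ‖z.2‖ₑ ^ 2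

theorem sobSum_phaseCoeff_fst (z : Phase S) :
    sobSum S 0 (fun k => (phaseCoeff S z k).1) = ‖z.1‖ₑ ^ 2 := by
  rw [← ofReal_norm_sq, ← sobSum_inner S z.1]; rfl

theorem sobSum_phaseCoeff_snd (z : Phase S) :
    sobSum S (-1) (fun k => (phaseCoeff S z k).2) = ‖z.2‖ₑ ^ 2 := by
  rw [← ofReal_norm_sq, ← sobSum_coeff z.2]; rfl

theorem exists_sobEnergy_le_phaseNormSq (S : DirichletEigensystem D) (hμ : 0 < μ) :
    ∃ C : ℝ≥0∞, C ≠ ⊤ ∧ ∀ z : Phase S, sobEnergy S μ (-1) z ≤ C * phaseNormSq z := by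
  refine ⟨ENNReal.ofReal ((S.α 0)⁻¹ + μ) + ENNReal.ofReal (3 / 2 * μ ^ 2), by finiteness,
    fun z => (sobEnergy_le hμ (-1) z).trans ?_⟩
  rw [show (-1 : ℝ) + 1 = 0 by norm_num, sobSum_phaseCoeff_fst, sobSum_phaseCoeff_snd, phaseNormSq,
    add_mul]
  gcongr
  · exact le_self_add
  · exact le_add_self

theorem exists_phaseNormSq_le_sobEnergy (S : DirichletEigensystem D) (hμ : 0 < μ) :
    ∃ C : ℝ≥0∞, C ≠ ⊤ ∧ ∀ z : Phase S, phaseNormSq z ≤ C * sobEnergy S μ (-1) z := by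
  refine ⟨ENNReal.ofReal μ⁻¹ + ENNReal.ofReal (2 * (μ ^ 2)⁻¹), by finiteness, fun z => ?_⟩
  have h1 := sobSum_fst_le_sobEnergy hμ (-1) z
  rw [show (-1 : ℝ) + 1 = 0 by norm_num, sobSum_phaseCoeff_fst] at h1
  have h2 := sobSum_snd_le_sobEnergy hμ (-1) z
  rw [sobSum_phaseCoeff_snd] at h2
  rw [add_mul]
  exact add_le_add h1 h2

theorem continuous_phaseNormSq : Continuous (phaseNormSq (S := S)) := by
  unfold phaseNormSq
  fun_prop

theorem phaseNormSq_zero : phaseNormSq (0 : Phase S) = 0 := by simp [phaseNormSq]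

theorem tendsto_zero_of_phaseNormSq {ι : Type*} {l : Filter ι} {F : ι → Phase S}
    (h : Tendsto (fun i => phaseNormSq (F i)) l (𝓝 0)) : Tendsto F l (𝓝 0) := by
  have key : ∀ {E : Type} [NormedAddCommGroup E] (G : ι → E),
      (∀ i, ‖G i‖ₑ ^ 2 ≤ phaseNormSq (F i)) → Tendsto G l (𝓝 0) := by
    intro E _ G hG
    apply tendsto_zero_of_sq
    have h1 := tendsto_of_tendsto_of_tendsto_of_le_of_le tendsto_const_nhds h
      (fun _ => zero_le) hG
    have h2 := (ENNReal.continuousAt_toReal ENNReal.zero_ne_top).tendsto.comp h1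
    refine h2.congr fun i => ?_
    simp
  exact (key _ fun i => le_self_add).prodMk_nhds (key _ fun i => le_add_self)

theorem phaseNormSq_ne_top (z : Phase S) : phaseNormSq z ≠ ⊤ := by
  unfold phaseNormSq; finiteness

/-! ### The basic a priori estimate -/

theorem exists_one_add_mul_lt {x y : ℝ} (hx : 0 ≤ x) (h : x < y) : ∃ ε > 0, (1 + ε) * x < y := by
  refine ⟨(y - x) / (x + 1), div_pos (sub_pos.2 h) (by linarith), ?_⟩
  have h1 : (y - x) / (x + 1) * x < y - x := by
    rw [div_mul_eq_mul_div, div_lt_iff₀ (by linarith)]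
    nlinarith
  linarith

theorem NoiseAssumption.exists_sobSum_le_of_le {β δ : ℝ} (hQ : NoiseAssumption S β Q)
    (hδ : δ ≤ 2 * β) : ∃ C : ℝ≥0∞, C ≠ ⊤ ∧ ∀ u : L2 D,
      sobSum S δ (fun k => inner ℝ (S.e k) (Q u)) ≤ C * ‖u‖ₑ ^ 2 := by
  obtain ⟨C, _, h⟩ := hQ.exists_sobSum_le
  refine ⟨ENNReal.ofReal (S.α 0 ^ (δ - 2 * β)) * ENNReal.ofReal C, by finiteness, fun u => ?_⟩
  rw [mul_assoc]
  exact (sobSum_mono hδ _).trans (mul_le_mul_right (h u) _)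

theorem lintegral_norm_sq_ne_top {E : Type*} [NormedAddCommGroup E] {u : ℝ → E} {a b : ℝ}
    (hu : ContinuousOn u (Icc a b)) : ∫⁻ t in Ioc a b, ‖u t‖ₑ ^ 2 ≠ ⊤ := by
  have h1 : IntegrableOn (fun t => ‖u t‖ ^ 2) (Ioc a b) :=
    (ContinuousOn.integrableOn_Icc (hu.norm.pow 2)).mono_set Ioc_subset_Icc_self
  simpa only [ofReal_norm_sq] using h1.lintegral_lt_top.ne

/-- The energy inequality at `δ = -1`, where the energy is equivalent to the squared norm of `𝓗` and
the dissipation contains `|u|²/2`. Since `|B(u)|²` in `H^{-1}` is at most `α₀⁻¹ γ² |u|²`, the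
smallness hypothesis lets the nonlinearity be absorbed. The constant does not depend on the
interval, so the past endpoint can be moved to `-∞`. -/
theorem exists_phase_estimate {β γ : ℝ} (hd : 1 ≤ d) (hQ : NoiseAssumption S β Q)
    (hBc : Continuous B) (hμ : 0 < μ)
    (hγ : ∀ u : L2 D, sobSum S 0 (fun k => inner ℝ (S.e k) (B u)) ≤
      ENNReal.ofReal (γ ^ 2) * sobSum S 0 (fun k => inner ℝ (S.e k) u))
    (hsmall : ((2 * S.α 0)⁻¹ + 2 * μ) * (S.α 0)⁻¹ * γ ^ 2 < 1 / 2) :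
    ∃ C : ℝ≥0∞, C ≠ ⊤ ∧ ∀ (t₁ t₂ : ℝ) (ψ : ℝ → L2 D) (z : ℝ → Phase S), t₁ ≤ t₂ →
      IsWeakSolution S Q B μ t₁ t₂ ψ z → AEStronglyMeasurable ψ (volume.restrict (Ioc t₁ t₂)) →
      sobEnergy S μ (-1) (z t₂) ≤
          C * (sobEnergy S μ (-1) (z t₁) + ∫⁻ t in Ioc t₁ t₂, ‖ψ t‖ₑ ^ 2) ∧
        ∫⁻ t in Ioc t₁ t₂, phaseNormSq (z t) ≤
          C * (sobEnergy S μ (-1) (z t₁) + ∫⁻ t in Ioc t₁ t₂, ‖ψ t‖ₑ ^ 2) := by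
  have h0 := S.α_zero_pos
  have hβ := hQ.one_add_two_mul_pos hd
  obtain ⟨Cq, hCq, hq⟩ := hQ.exists_sobSum_le_of_le (δ := -1) (by linarith)
  set K := (2 * S.α 0)⁻¹ + 2 * μ with hK
  have hK0 : 0 < K := by positivity
  -- The strict inequality leaves room for the factor `1 + ε` lost in separating the nonlinearity
  -- from the control.
  obtain ⟨ε, hε, hθ⟩ := exists_one_add_mul_lt (by positivity) hsmall
  set θ := (1 + ε) * (K * (S.α 0)⁻¹ * γ ^ 2) with hθdef
  have hθ0 : 0 ≤ θ := by positivity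
  have hpos : 0 < 1 / 2 - θ := by linarith
  set C₁ := ENNReal.ofReal (K * (1 + ε⁻¹)) * Cq with hC₁
  have hC₁t : C₁ ≠ ⊤ := by finiteness
  have hforce : ∀ (z : ℝ → Phase S) (ψ : ℝ → L2 D) t,
      ∑' k, ENNReal.ofReal (S.α k ^ (-1 : ℝ) *
          (((2 * S.α k)⁻¹ + 2 * μ) * forceCoeff S Q B ψ z t k ^ 2)) ≤
        ENNReal.ofReal θ * ‖(z t).1‖ₑ ^ 2 + C₁ * ‖ψ t‖ₑ ^ 2 := by
    intro z ψ t
    refine (tsum_force_le hμ (-1) _).trans ?_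
    have h1 := sobSum_add_le (S := S) (δ := -1) hε (fun k => inner ℝ (S.e k) (B (z t).1))
      (fun k => inner ℝ (S.e k) (Q (ψ t)))
    have h2 := (sobSum_mono (S := S) (by norm_num : (-1 : ℝ) ≤ 0)
      (fun k => inner ℝ (S.e k) (B (z t).1))).trans (mul_le_mul_right (hγ (z t).1) _)
    have e0 : sobSum S 0 (fun k => inner ℝ (S.e k) (z t).1) = ‖(z t).1‖ₑ ^ 2 :=
      sobSum_phaseCoeff_fst (z t)
    rw [e0, sub_zero, Real.rpow_neg_one] at h2
    calc ENNReal.ofReal K * sobSum S (-1) (fun k => forceCoeff S Q B ψ z t k)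
        ≤ ENNReal.ofReal K * (ENNReal.ofReal (1 + ε) * (ENNReal.ofReal (S.α 0)⁻¹ *
            (ENNReal.ofReal (γ ^ 2) * ‖(z t).1‖ₑ ^ 2)) +
            ENNReal.ofReal (1 + ε⁻¹) * (Cq * ‖ψ t‖ₑ ^ 2)) := by
          refine mul_le_mul_right (h1.trans ?_) _
          exact add_le_add (mul_le_mul_right h2 _) (mul_le_mul_right (hq _) _)
      _ = _ := by
          rw [hθdef, hC₁, ENNReal.ofReal_mul (by positivity), ENNReal.ofReal_mul (by positivity),
            ENNReal.ofReal_mul (by positivity), ENNReal.ofReal_mul (by positivity)]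
          ring
  set M := (1 : ℝ≥0∞) + C₁ with hM
  set C₂ := ENNReal.ofReal (1 / 2 - θ)⁻¹ + ENNReal.ofReal (μ / 2)⁻¹ with hC₂
  refine ⟨M + C₂ * M, by finiteness, fun t₁ t₂ ψ z h12 h hψ => ?_⟩
  have hmX : AEMeasurable (fun t => ‖(z t).1‖ₑ ^ 2) (volume.restrict (Ioc t₁ t₂)) :=
    ((continuous_fst.comp_continuousOn (h.cont.mono
      Ioc_subset_Icc_self)).enorm.aemeasurable measurableSet_Ioc).pow_const 2
  have hmY : AEMeasurable (fun t => ‖(z t).2‖ₑ ^ 2) (volume.restrict (Ioc t₁ t₂)) :=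
    ((continuous_snd.comp_continuousOn (h.cont.mono
      Ioc_subset_Icc_self)).enorm.aemeasurable measurableSet_Ioc).pow_const 2
  -- Finiteness, from continuity on the compact interval, is what permits cancelling `θ X` on both
  -- sides in `[0, ∞]`.
  have hX : ∫⁻ t in Ioc t₁ t₂, ‖(z t).1‖ₑ ^ 2 ≠ ⊤ :=
    lintegral_norm_sq_ne_top (continuous_fst.comp_continuousOn h.cont)
  have key := h.weighted_energy_le hμ hBc h12 hψ (-1)
  simp only [tsum_dissipation hμ, show (-1 : ℝ) + 1 = 0 by norm_num, sobSum_phaseCoeff_fst,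
    sobSum_phaseCoeff_snd] at key
  have key2 := key.trans (add_le_add le_rfl (lintegral_mono fun t => hforce z ψ t))
  rw [lintegral_add_left' (hmX.const_mul _), lintegral_add_left' (hmX.const_mul _),
    lintegral_const_mul'' _ hmX, lintegral_const_mul'' _ hmX, lintegral_const_mul'' _ hmY,
    lintegral_const_mul' _ _ hC₁t] at key2
  have hsum : ∫⁻ t in Ioc t₁ t₂, phaseNormSq (z t) = (∫⁻ t in Ioc t₁ t₂, ‖(z t).1‖ₑ ^ 2) +
      ∫⁻ t in Ioc t₁ t₂, ‖(z t).2‖ₑ ^ 2 := lintegral_add_left' hmX _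
  rw [hsum]
  generalize (∫⁻ t in Ioc t₁ t₂, ‖(z t).1‖ₑ ^ 2) = X at key2 hX ⊢
  generalize (∫⁻ t in Ioc t₁ t₂, ‖(z t).2‖ₑ ^ 2) = Y at key2 ⊢
  generalize (∫⁻ t in Ioc t₁ t₂, ‖ψ t‖ₑ ^ 2) = Ψ at key2 ⊢
  generalize sobEnergy S μ (-1) (z t₂) = A₂ at key2 ⊢
  generalize sobEnergy S μ (-1) (z t₁) = A₁ at key2 ⊢
  have e1 : ENNReal.ofReal (1 / 2) = ENNReal.ofReal (1 / 2 - θ) + ENNReal.ofReal θ := by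
    rw [← ENNReal.ofReal_add hpos.le hθ0, sub_add_cancel]
  have key3 : A₂ + (ENNReal.ofReal (1 / 2 - θ) * X + ENNReal.ofReal (μ / 2) * Y) ≤ A₁ + C₁ * Ψ := by
    have hfin : ENNReal.ofReal θ * X ≠ ⊤ := by finiteness
    refine (ENNReal.add_le_add_iff_right hfin).1 ?_
    rw [e1] at key2
    calc _ = A₂ + ((ENNReal.ofReal (1 / 2 - θ) + ENNReal.ofReal θ) * X +
          ENNReal.ofReal (μ / 2) * Y) := by ring
      _ ≤ _ := key2
      _ = _ := by ring
  have hR : A₁ + C₁ * Ψ ≤ M * (A₁ + Ψ) := by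
    rw [hM]
    calc A₁ + C₁ * Ψ ≤ (A₁ + C₁ * Ψ) + (Ψ + C₁ * A₁) := le_self_add
      _ = _ := by ring
  have key4 := key3.trans hR
  have hdiv : ∀ {x : ℝ} {W : ℝ≥0∞}, 0 < x → ENNReal.ofReal x * W ≤ M * (A₁ + Ψ) →
      W ≤ ENNReal.ofReal x⁻¹ * (M * (A₁ + Ψ)) := by
    intro x W hx hW
    refine le_trans (le_of_eq ?_) (mul_le_mul_right hW _)
    rw [← mul_assoc, ← ENNReal.ofReal_mul (by positivity), inv_mul_cancel₀ hx.ne']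
    simp
  constructor
  · have k0 : A₂ ≤ M * (A₁ + Ψ) := le_trans le_self_add key4
    calc A₂ ≤ M * (A₁ + Ψ) := k0
      _ ≤ _ := by rw [add_mul M]; exact le_self_add
  · have k1 : ENNReal.ofReal (1 / 2 - θ) * X ≤ M * (A₁ + Ψ) :=
      le_trans (le_trans le_self_add le_add_self) key4
    have k2 : ENNReal.ofReal (μ / 2) * Y ≤ M * (A₁ + Ψ) :=
      le_trans (le_trans le_add_self le_add_self) key4
    have hX' := hdiv hpos k1
    have hY' := hdiv (by positivity : 0 < μ / 2) k2
    calc X + Y ≤ C₂ * (M * (A₁ + Ψ)) := by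
          rw [hC₂, add_mul]; exact add_le_add hX' hY'
      _ ≤ _ := by rw [add_mul M, mul_assoc C₂]; exact le_add_self

/-! ### Solutions on a half-line -/

variable (S) in
/-- Solutions on `(-∞, t]`. -/
structure IsWeakSolutionIic (Q : L2 D →L[ℝ] L2 D) (B : L2 D → L2 D) (μ t : ℝ)
    (ψ : ℝ → L2 D) (z : ℝ → Phase S) : Prop where
  sol : ∀ a < t, IsWeakSolution S Q B μ a t ψ z
  meas : AEStronglyMeasurable ψ (volume.restrict (Iic t))

theorem IsWeakSolutionIic.mono {t s : ℝ} (h : IsWeakSolutionIic S Q B μ t ψ z) (hs : s ≤ t) :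
    IsWeakSolutionIic S Q B μ s ψ z :=
  ⟨fun a ha => (h.sol a (ha.trans_le hs)).mono le_rfl ha.le hs,
    h.meas.mono_measure (Measure.restrict_mono (Iic_subset_Iic.2 hs) le_rfl)⟩

theorem IsWeakSolutionIic.meas_Ioc {t s : ℝ} (h : IsWeakSolutionIic S Q B μ t ψ z) :
    AEStronglyMeasurable ψ (volume.restrict (Ioc s t)) :=
  h.meas.mono_measure (Measure.restrict_mono Ioc_subset_Iic_self le_rfl)

theorem IsWeakSolutionIic.continuousOn {t : ℝ} (h : IsWeakSolutionIic S Q B μ t ψ z) :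
    ContinuousOn z (Iic t) := by
  intro s hs
  have h1 := (h.sol (s - 1) (by linarith [mem_Iic.1 hs])).cont s ⟨by linarith, hs⟩
  refine h1.mono_of_mem_nhdsWithin ?_
  rw [← Ici_inter_Iic, inter_comm]
  exact inter_mem_nhdsWithin _ (Ici_mem_nhds (by linarith))

theorem tendsto_const_mul_zero {ι : Type*} {l : Filter ι} {f : ι → ℝ≥0∞} {C : ℝ≥0∞} (hC : C ≠ ⊤)
    (h : Tendsto f l (𝓝 0)) : Tendsto (fun i => C * f i) l (𝓝 0) := by
  have := ENNReal.Tendsto.const_mul h (Or.inr hC)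
  rwa [mul_zero] at this

theorem tendsto_zero_of_le {ι : Type*} {l : Filter ι} {f g : ι → ℝ≥0∞} (h : Tendsto g l (𝓝 0))
    (hfg : ∀ᶠ i in l, f i ≤ g i) : Tendsto f l (𝓝 0) :=
  tendsto_of_tendsto_of_tendsto_of_le_of_le' tendsto_const_nhds h
    (Eventually.of_forall fun _ => zero_le) hfg

/-- A bounded solution on a half-line with a square integrable control tends to zero. -/
theorem tendsto_zero_of_phaseNormSq_le {β γ t : ℝ} (hd : 1 ≤ d) (hQ : NoiseAssumption S β Q)
    (hBc : Continuous B) (hμ : 0 < μ)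
    (hγ : ∀ u : L2 D, sobSum S 0 (fun k => inner ℝ (S.e k) (B u)) ≤
      ENNReal.ofReal (γ ^ 2) * sobSum S 0 (fun k => inner ℝ (S.e k) u))
    (hsmall : ((2 * S.α 0)⁻¹ + 2 * μ) * (S.α 0)⁻¹ * γ ^ 2 < 1 / 2)
    (h : IsWeakSolutionIic S Q B μ t ψ z) (hψ : ∫⁻ s in Iic t, ‖ψ s‖ₑ ^ 2 ≠ ⊤)
    {M : ℝ≥0∞} (hM : M ≠ ⊤) (hb : ∀ a ≤ t, phaseNormSq (z a) ≤ M) : Tendsto z atBot (𝓝 0) := by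
  obtain ⟨C, hC, hest⟩ := exists_phase_estimate hd hQ hBc hμ hγ hsmall
  obtain ⟨C₁, hC₁, hE₁⟩ := exists_sobEnergy_le_phaseNormSq S hμ
  obtain ⟨C₂, hC₂, hE₂⟩ := exists_phaseNormSq_le_sobEnergy S hμ
  -- Boundedness controls the initial energy uniformly in the starting time, so the dissipation
  -- integral stays bounded as the starting time goes to `-∞`.
  have hfin : ∫⁻ s in Iic t, phaseNormSq (z s) ≠ ⊤ := by
    have hle : ∫⁻ s in Iic t, phaseNormSq (z s) ≤ C * (C₁ * M + ∫⁻ s in Iic t, ‖ψ s‖ₑ ^ 2) := by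
      refine le_of_tendsto (tendsto_setLIntegral_Ioc_atBot (fun s => phaseNormSq (z s)) t) ?_
      filter_upwards [Iio_mem_atBot t] with a ha
      refine (hest a t ψ z (le_of_lt ha) (h.sol a ha) h.meas_Ioc).2.trans ?_
      refine mul_le_mul_right (add_le_add ?_ (lintegral_mono_set Ioc_subset_Iic_self)) _
      exact (hE₁ _).trans (mul_le_mul_right (hb a (le_of_lt ha)) _)
    exact ne_top_of_le_ne_top (by finiteness) hle
  -- An integrable function is small at some earlier time; starting the estimate there leaves only
  -- the control energy spent before `s`, which is the tail of a convergent integral.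
  have hdecay : ∀ s ≤ t, sobEnergy S μ (-1) (z s) ≤ C * ∫⁻ r in Iic s, ‖ψ r‖ₑ ^ 2 := by
    intro s hs
    refine ENNReal.le_of_forall_pos_le_add fun ε hε _ => ?_
    have hfs : ∫⁻ r in Iic s, C * (C₁ * phaseNormSq (z r)) ≠ ⊤ := by
      rw [lintegral_const_mul' _ _ hC, lintegral_const_mul' _ _ hC₁]
      have := ne_top_of_le_ne_top hfin (lintegral_mono_set (Iic_subset_Iic.2 hs))
      finiteness
    obtain ⟨a, ha, hlt⟩ := exists_lt_of_lintegral_Iic_ne_top hfs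
      (ε := (ε : ℝ≥0∞)) (by simpa using hε.ne')
    have h' := h.mono hs
    refine (hest a s ψ z ha.le (h'.sol a ha) h'.meas_Ioc).1.trans ?_
    rw [mul_add, add_comm]
    refine add_le_add (mul_le_mul_right (lintegral_mono_set Ioc_subset_Iic_self) _) ?_
    exact (mul_le_mul_right (hE₁ _) _).trans hlt.le
  refine tendsto_zero_of_phaseNormSq (tendsto_zero_of_le (tendsto_const_mul_zero hC₂
    (tendsto_const_mul_zero hC (tendsto_setLIntegral_Iic_atBot hψ))) ?_)
  filter_upwards [Iic_mem_atBot t] with s hs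
  exact (hE₂ _).trans (mul_le_mul_right (hdecay s hs) _)

/-! ### Regularity of solutions that start at zero at time `-∞` -/

/-- If the position is square integrable in time with values in `H^θ`, then so is `B` of it, while
`Q` maps `H` to `H^{2β}`. The force thus lies in `H^{min(θ, 2β)}`, and the dissipation is one order
better in the position. No absorption is needed here, so the size of the Lipschitz constant plays no
role. -/
theorem exists_regularity_step {β θ : ℝ} (hQ : NoiseAssumption S β Q)
    (hB : NonlinearityAssumption S β B) (hBc : Continuous B) (hμ : 0 < μ)
    (hθ : θ ∈ Icc 0 (1 + 2 * β)) :
    ∃ C : ℝ≥0∞, C ≠ ⊤ ∧ ∀ (t : ℝ) (ψ : ℝ → L2 D) (z : ℝ → Phase S),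
      IsWeakSolutionIic S Q B μ t ψ z → Tendsto z atBot (𝓝 0) →
      sobEnergy S μ (min θ (2 * β)) (z t) ≤ C * ((∫⁻ s in Iic t, sobSum S θ
        (fun k => (phaseCoeff S (z s) k).1)) + ∫⁻ s in Iic t, ‖ψ s‖ₑ ^ 2) ∧
      ∫⁻ s in Iic t, sobSum S (min θ (2 * β) + 1) (fun k => (phaseCoeff S (z s) k).1) ≤
        C * ((∫⁻ s in Iic t, sobSum S θ
        (fun k => (phaseCoeff S (z s) k).1)) + ∫⁻ s in Iic t, ‖ψ s‖ₑ ^ 2) := by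
  have h0 := S.α_zero_pos
  set δ := min θ (2 * β) with hδ
  obtain ⟨Cq, hCq, hq⟩ := hQ.exists_sobSum_le_of_le (δ := δ) (min_le_right _ _)
  obtain ⟨γ, _, _, hγ⟩ := hB.sobSum_le hθ
  set K := (2 * S.α 0)⁻¹ + 2 * μ with hK
  set Cb := ENNReal.ofReal (S.α 0 ^ (δ - θ)) * ENNReal.ofReal (γ ^ 2) with hCb
  set E := ENNReal.ofReal K * ENNReal.ofReal 2 * (Cb + Cq) with hE
  have hEt : E ≠ ⊤ := by finiteness
  refine ⟨E + ENNReal.ofReal 2 * E, by finiteness, fun t ψ z h hz => ?_⟩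
  have hforce : ∀ s, ∑' k, ENNReal.ofReal (S.α k ^ δ *
          (((2 * S.α k)⁻¹ + 2 * μ) * forceCoeff S Q B ψ z s k ^ 2)) ≤
        E * (sobSum S θ (fun k => (phaseCoeff S (z s) k).1) + ‖ψ s‖ₑ ^ 2) := by
    intro s
    refine (tsum_force_le hμ δ _).trans ?_
    have h1 := sobSum_add_le (S := S) (δ := δ) one_pos (fun k => inner ℝ (S.e k) (B (z s).1))
      (fun k => inner ℝ (S.e k) (Q (ψ s)))
    rw [inv_one, one_add_one_eq_two] at h1
    have h2 := (sobSum_mono (S := S) (min_le_left θ (2 * β))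
      (fun k => inner ℝ (S.e k) (B (z s).1))).trans (mul_le_mul_right (hγ (z s).1) _)
    calc ENNReal.ofReal K * sobSum S δ (fun k => forceCoeff S Q B ψ z s k)
        ≤ ENNReal.ofReal K * (ENNReal.ofReal 2 *
            (Cb * sobSum S θ (fun k => (phaseCoeff S (z s) k).1)) +
            ENNReal.ofReal 2 * (Cq * ‖ψ s‖ₑ ^ 2)) := by
          refine mul_le_mul_right (h1.trans (add_le_add (mul_le_mul_right (h2.trans ?_) _)
            (mul_le_mul_right (hq _) _))) _
          rw [hCb, mul_assoc]
          rfl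
      _ ≤ ENNReal.ofReal K * (ENNReal.ofReal 2 *
            ((Cb + Cq) * sobSum S θ (fun k => (phaseCoeff S (z s) k).1)) +
            ENNReal.ofReal 2 * ((Cb + Cq) * ‖ψ s‖ₑ ^ 2)) := by
          gcongr
          · exact le_self_add
          · exact le_add_self
      _ = _ := by rw [hE]; ring
  have key := weighted_energy_Iic_le hμ hBc h.sol hz h.meas δ
  have hmeas : ∀ η : ℝ, AEMeasurable (fun s => sobSum S η (fun k => (phaseCoeff S (z s) k).1))
      (volume.restrict (Iic t)) := fun η => AEMeasurable.tsum fun k =>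
    (((aemeasurable_phaseCoeff_fst measurableSet_Iic h.continuousOn k).pow_const
      2).const_mul _).ennreal_ofReal
  have key2 := key.trans (lintegral_mono hforce)
  rw [lintegral_const_mul' _ _ hEt, lintegral_add_left' (hmeas θ)] at key2
  simp only [tsum_dissipation hμ] at key2
  rw [lintegral_add_left' ((hmeas _).const_mul _), lintegral_const_mul'' _ (hmeas _)] at key2
  constructor
  · refine (le_self_add.trans key2).trans ?_
    rw [add_mul]; exact le_self_add
  · have h3 := (le_self_add.trans le_add_self).trans key2
    have h4 := mul_le_mul_right h3 (ENNReal.ofReal 2)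
    rw [← mul_assoc, ← ENNReal.ofReal_mul (by norm_num)] at h4
    norm_num at h4
    refine h4.trans ?_
    rw [add_mul, mul_assoc (ENNReal.ofReal 2), ENNReal.ofReal_ofNat]
    exact le_add_self

/-- Bootstrap: the phase estimate gives index `0`, and each step raises the index by one until it is
capped at `1 + 2β`, the last index for which `B` is assumed to act. One more step at that index
yields the energy in `H^{1+2β} × H^{2β}`. -/
theorem exists_regularity_estimate {β γ : ℝ} (hd : 1 ≤ d) (hQ : NoiseAssumption S β Q)
    (hB : NonlinearityAssumption S β B) (hBc : Continuous B) (hμ : 0 < μ)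
    (hγ : ∀ u : L2 D, sobSum S 0 (fun k => inner ℝ (S.e k) (B u)) ≤
      ENNReal.ofReal (γ ^ 2) * sobSum S 0 (fun k => inner ℝ (S.e k) u))
    (hsmall : ((2 * S.α 0)⁻¹ + 2 * μ) * (S.α 0)⁻¹ * γ ^ 2 < 1 / 2) :
    ∃ C : ℝ≥0∞, C ≠ ⊤ ∧ ∀ (t : ℝ) (ψ : ℝ → L2 D) (z : ℝ → Phase S),
      IsWeakSolutionIic S Q B μ t ψ z → Tendsto z atBot (𝓝 0) →
      sobEnergy S μ (2 * β) (z t) ≤ C * ∫⁻ s in Iic t, ‖ψ s‖ₑ ^ 2 := by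
  have hβ := hQ.one_add_two_mul_pos hd
  have H : ∀ n : ℕ, ∃ C : ℝ≥0∞, C ≠ ⊤ ∧ ∀ (t : ℝ) (ψ : ℝ → L2 D) (z : ℝ → Phase S),
      IsWeakSolutionIic S Q B μ t ψ z → Tendsto z atBot (𝓝 0) →
      ∫⁻ s in Iic t, sobSum S (min n (1 + 2 * β)) (fun k => (phaseCoeff S (z s) k).1) ≤
        C * ∫⁻ s in Iic t, ‖ψ s‖ₑ ^ 2 := by
    intro n
    induction n with
    | zero =>
      obtain ⟨C, hC, hest⟩ := exists_phase_estimate hd hQ hBc hμ hγ hsmall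
      obtain ⟨C₁, hC₁, hE₁⟩ := exists_sobEnergy_le_phaseNormSq S hμ
      refine ⟨C, hC, fun t ψ z h hz => ?_⟩
      rw [Nat.cast_zero, min_eq_left (by linarith)]
      simp only [sobSum_phaseCoeff_fst]
      -- At index `-1` the energy is controlled by the norm of `𝓗`, so the initial term of the
      -- estimate vanishes in the limit.
      have hA : Tendsto (fun a => sobEnergy S μ (-1) (z a)) atBot (𝓝 0) := by
        have h1 := (continuous_phaseNormSq.tendsto 0).comp hz
        rw [phaseNormSq_zero] at h1
        exact tendsto_zero_of_le (tendsto_const_mul_zero hC₁ h1)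
          (Eventually.of_forall fun a => hE₁ _)
      have h2 := hA.add (tendsto_setLIntegral_Ioc_atBot (fun s => ‖ψ s‖ₑ ^ 2) t)
      rw [zero_add] at h2
      refine le_of_tendsto_of_tendsto (tendsto_setLIntegral_Ioc_atBot
        (fun s => ‖(z s).1‖ₑ ^ 2) t) (ENNReal.Tendsto.const_mul h2 (Or.inr hC)) ?_
      filter_upwards [Iio_mem_atBot t] with a ha
      refine le_trans (lintegral_mono fun s => ?_)
        (hest a t ψ z (le_of_lt ha) (h.sol a ha) h.meas_Ioc).2
      exact le_self_add
    | succ n ih =>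
      obtain ⟨C, hC, ih⟩ := ih
      obtain ⟨C', hC', hs⟩ := exists_regularity_step hQ hB hBc hμ
        (θ := min n (1 + 2 * β)) ⟨le_min n.cast_nonneg (by linarith), min_le_right _ _⟩
      refine ⟨C' * (C + 1), by finiteness, fun t ψ z h hz => ?_⟩
      have e : min (min (n : ℝ) (1 + 2 * β)) (2 * β) + 1 = min ((n + 1 : ℕ) : ℝ) (1 + 2 * β) := by
        rw [min_assoc, min_eq_right (by linarith : 2 * β ≤ 1 + 2 * β), ← min_add_add_right,
          Nat.cast_add, Nat.cast_one, add_comm (2 * β)]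
      have h1 := (hs t ψ z h hz).2
      rw [e] at h1
      refine h1.trans ?_
      rw [mul_assoc, add_mul, one_mul]
      exact mul_le_mul_right (add_le_add (ih t ψ z h hz) le_rfl) _
  obtain ⟨n, hn⟩ := exists_nat_ge (1 + 2 * β)
  obtain ⟨C, hC, hn'⟩ := H n
  rw [min_eq_right hn] at hn'
  obtain ⟨C', hC', hs⟩ := exists_regularity_step hQ hB hBc hμ
    (θ := 1 + 2 * β) ⟨by linarith, le_rfl⟩
  refine ⟨C' * (C + 1), by finiteness, fun t ψ z h hz => ?_⟩
  have h1 := (hs t ψ z h hz).1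
  rw [min_eq_right (by linarith : 2 * β ≤ 1 + 2 * β)] at h1
  refine h1.trans ?_
  rw [mul_assoc, add_mul, one_mul]
  exact mul_le_mul_right (add_le_add (hn' t ψ z h hz) le_rfl) _

end APriori

section Controllability

variable {d : ℕ} {D : Set (EuclideanSpace ℝ (Fin d))} {S : DirichletEigensystem D}
  {Q : L2 D →L[ℝ] L2 D} {B : L2 D → L2 D} {μ : ℝ}

/-! ### Controllability in unit time -/

theorem aestronglyMeasurable_of_inner {ν : Measure ℝ} {ψ : ℝ → L2 D}
    (h : ∀ k, AEMeasurable (fun t => (inner ℝ (S.e k) (ψ t) : ℝ)) ν) : AEStronglyMeasurable ψ ν := by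
  refine aestronglyMeasurable_of_tendsto_ae (u := atTop)
    (f := fun (n : ℕ) t => ∑ k ∈ Finset.range n, (inner ℝ (S.e k) (ψ t) : ℝ) • S.e k)
    (fun n => ?_) (Eventually.of_forall fun t => ?_)
  · exact Finset.aestronglyMeasurable_fun_sum _ fun k _ =>
      (h k).aestronglyMeasurable.smul_const _
  · have := (S.e.hasSum_repr (ψ t)).tendsto_sum_nat
    simpa only [HilbertBasis.repr_apply_apply] using this

/-- A smooth step, from `0` at time `-1` to `1` at time `0`. -/
def cutoff (t : ℝ) : ℝ := 3 * (t + 1) ^ 2 - 2 * (t + 1) ^ 3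

/-- The derivative of `cutoff`. -/
def cutoff' (t : ℝ) : ℝ := 6 * (t + 1) - 6 * (t + 1) ^ 2

theorem hasDerivAt_cutoff (t : ℝ) : HasDerivAt cutoff (cutoff' t) t := by
  have h := (hasDerivAt_id t).add_const (1 : ℝ)
  refine (((h.pow 2).const_mul 3).sub ((h.pow 3).const_mul 2)).congr_deriv ?_
  simp [cutoff']
  ring

theorem hasDerivAt_cutoff' (t : ℝ) : HasDerivAt cutoff' (6 - 12 * (t + 1)) t := by
  have h := (hasDerivAt_id t).add_const (1 : ℝ)
  refine ((h.const_mul 6).sub ((h.pow 2).const_mul 6)).congr_deriv ?_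
  simp
  ring

theorem continuous_cutoff : Continuous cutoff := by unfold cutoff; fun_prop

theorem continuous_cutoff' : Continuous cutoff' := by unfold cutoff'; fun_prop

theorem cutoff_sq_le {t : ℝ} (ht : t ∈ Icc (-1) 0) : cutoff t ^ 2 ≤ 1 := by
  have h0 : 0 ≤ t + 1 := by linarith [ht.1]
  have h1 : t + 1 ≤ 1 := by linarith [ht.2]
  have h2 : cutoff t = (t + 1) ^ 2 * (3 - 2 * (t + 1)) := by unfold cutoff; ring
  have h3 : 0 ≤ cutoff t := by
    rw [h2]; exact mul_nonneg (sq_nonneg _) (by linarith)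
  have h4 : cutoff t ≤ 1 := by
    have : 1 - cutoff t = (1 - (t + 1)) ^ 2 * (1 + 2 * (t + 1)) := by unfold cutoff; ring
    have : 0 ≤ 1 - cutoff t := by rw [this]; exact mul_nonneg (sq_nonneg _) (by linarith)
    linarith
  nlinarith

theorem abs_cutoff'_le {t : ℝ} (ht : t ∈ Icc (-1) 0) : |cutoff' t| ≤ 2 := by
  have h0 : 0 ≤ t + 1 := by linarith [ht.1]
  have h1 : t + 1 ≤ 1 := by linarith [ht.2]
  unfold cutoff'
  rw [abs_le]
  constructor <;> nlinarith [sq_nonneg (2 * (t + 1) - 1)]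

variable (S) in
/-- The path from `0` at time `-1` to `w` at time `0`. -/
def controlPath (hμ : 0 < μ) (w : Phase S) (t : ℝ) : Phase S :=
  cutoff t • semigroup S hμ t w + cutoff' t • ((0, embedNegOne S (semigroup S hμ t w).1) : Phase S)

theorem continuous_controlPath (hμ : 0 < μ) (w : Phase S) : Continuous (controlPath S hμ w) := by
  have h1 := continuous_semigroup_apply hμ w
  refine (continuous_cutoff.smul h1).add (continuous_cutoff'.smul ?_)
  exact continuous_const.prodMk (continuous_embedNegOne.comp (continuous_fst.comp h1))

theorem phaseCoeff_controlPath (hμ : 0 < μ) (w : Phase S) (t : ℝ) (k : ℕ) :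
    phaseCoeff S (controlPath S hμ w t) k =
      (cutoff t * (modeFlow μ (S.α k) t (phaseCoeff S w k)).1,
        cutoff t * (modeFlow μ (S.α k) t (phaseCoeff S w k)).2 +
          cutoff' t * (modeFlow μ (S.α k) t (phaseCoeff S w k)).1) := by
  rw [← phaseCoeff_semigroup S hμ, controlPath, ← phaseCoeffL_apply, map_add, map_smul, map_smul,
    phaseCoeffL_apply, phaseCoeffL_apply]
  simp [phaseCoeff, embedNegOne_coeff]

theorem controlPath_neg_one (hμ : 0 < μ) (w : Phase S) : controlPath S hμ w (-1) = 0 := by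
  simp [controlPath, cutoff, cutoff']

theorem controlPath_zero (hμ : 0 < μ) (w : Phase S) : controlPath S hμ w 0 = w := by
  refine phase_ext fun k => ?_
  rw [phaseCoeff_controlPath, modeFlow_zero]
  ext <;> norm_num [cutoff, cutoff']

/-- The force needed to drive the oscillator along the path. -/
def controlForce (μ : ℝ) (t : ℝ) (φ : ℝ × ℝ) : ℝ :=
  2 * μ * cutoff' t * φ.2 + (μ * (6 - 12 * (t + 1)) + cutoff' t) * φ.1

/-- The free flow solves the homogeneous equation, so every term of the force carries a derivative
of the cutoff and none carries the factor `a`. The oscillator energy therefore bounds the squared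
force uniformly in `a ≥ a₀`; the constants come from `|cutoff'| ≤ 2` and `|cutoff''| ≤ 6` on `[-1,
0]`. -/
theorem controlForce_sq_le {a a₀ t : ℝ} (hμ : 0 < μ) (ha₀ : 0 < a₀) (ha : a₀ ≤ a)
    (ht : t ∈ Icc (-1) 0) (φ : ℝ × ℝ) : controlForce μ t φ ^ 2 ≤
      (32 * μ + 2 * (6 * μ + 2) ^ 2 * a₀⁻¹) * (μ * φ.2 ^ 2 + a * φ.1 ^ 2) := by
  have h1 := abs_le.1 (abs_cutoff'_le ht)
  have hx : (2 * μ * cutoff' t) ^ 2 ≤ (4 * μ) ^ 2 := by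
    refine sq_le_sq' ?_ ?_ <;> nlinarith
  have hy : (μ * (6 - 12 * (t + 1)) + cutoff' t) ^ 2 ≤ (6 * μ + 2) ^ 2 := by
    refine sq_le_sq' ?_ ?_ <;> nlinarith [ht.1, ht.2]
  have h2 : controlForce μ t φ ^ 2 ≤
      2 * ((4 * μ) ^ 2 * φ.2 ^ 2) + 2 * ((6 * μ + 2) ^ 2 * φ.1 ^ 2) := by
    unfold controlForce
    nlinarith [mul_le_mul_of_nonneg_right hx (sq_nonneg φ.2),
      mul_le_mul_of_nonneg_right hy (sq_nonneg φ.1),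
      sq_nonneg (2 * μ * cutoff' t * φ.2 - (μ * (6 - 12 * (t + 1)) + cutoff' t) * φ.1)]
  have h3 : φ.1 ^ 2 ≤ a₀⁻¹ * (a * φ.1 ^ 2) := by
    have : a₀⁻¹ * (a₀ * φ.1 ^ 2) = φ.1 ^ 2 := by field_simp
    calc φ.1 ^ 2 = a₀⁻¹ * (a₀ * φ.1 ^ 2) := this.symm
      _ ≤ _ := by gcongr
  have h4 := mul_le_mul_of_nonneg_left h3 (sq_nonneg (6 * μ + 2))
  have h5 : 0 ≤ μ * (a * φ.1 ^ 2) := by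
    have := ha₀.trans_le ha; positivity
  have h6 : 0 ≤ (6 * μ + 2) ^ 2 * a₀⁻¹ * (μ * φ.2 ^ 2) := by positivity
  nlinarith

theorem isModeSolution_control {a : ℝ} (hμ : 0 < μ) (w : ℝ × ℝ) (t₁ t₂ : ℝ) :
    IsModeSolution μ a t₁ t₂ (fun t => controlForce μ t (modeFlow μ a t w))
      (fun t => cutoff t * (modeFlow μ a t w).1)
      (fun t => cutoff t * (modeFlow μ a t w).2 + cutoff' t * (modeFlow μ a t w).1) := by
  have h1 : ∀ t, HasDerivAt (fun s => (modeFlow μ a s w).1) (modeFlow μ a t w).2 t := fun t => by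
    have h := (ContinuousLinearMap.fst ℝ ℝ ℝ).hasFDerivAt.comp_hasDerivAt t
      (hasDerivAt_modeFlow μ a t w)
    rw [modeGenerator_apply] at h
    exact h
  have h2 : ∀ t, HasDerivAt (fun s => (modeFlow μ a s w).2)
      (μ⁻¹ * (-(a * (modeFlow μ a t w).1) - (modeFlow μ a t w).2)) t := fun t => by
    have h := (ContinuousLinearMap.snd ℝ ℝ ℝ).hasFDerivAt.comp_hasDerivAt t
      (hasDerivAt_modeFlow μ a t w)
    rw [modeGenerator_apply] at h
    exact h
  have c1 : Continuous fun t => (modeFlow μ a t w).1 :=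
    continuous_fst.comp (continuous_modeFlow μ a w)
  have c2 : Continuous fun t => (modeFlow μ a t w).2 :=
    continuous_snd.comp (continuous_modeFlow μ a w)
  have c3 := continuous_cutoff
  have c4 := continuous_cutoff'
  refine ⟨IsPrimitiveOn.of_hasDerivAt (fun t => ?_) (by fun_prop),
    IsPrimitiveOn.of_hasDerivAt (fun t => ?_) ?_⟩
  · refine ((hasDerivAt_cutoff t).mul (h1 t)).congr_deriv ?_
    ring
  · refine ((((hasDerivAt_cutoff t).mul (h2 t)).add
      ((hasDerivAt_cutoff' t).mul (h1 t))).const_mul μ).congr_deriv ?_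
    simp only [controlForce]
    field_simp
    ring
  · unfold controlForce
    fun_prop

/-- The free flow is run backwards from `w` and its position is switched off by the cutoff; the
velocity is the time derivative of the product, so the path ends at `w` and starts at `0`. The
required control is `Q⁻¹` of the force minus `B`, and applying `Q⁻¹` amounts to measuring in
`H^{2β}`. There the force is bounded by the conserved regularity of the flow, and `B` by the extra
order available for the position. -/
theorem exists_control_to {β : ℝ} (hd : 1 ≤ d) (hQ : NoiseAssumption S β Q)
    (hB : NonlinearityAssumption S β B) (hBc : Continuous B) (hμ : 0 < μ) :
    ∃ C : ℝ≥0∞, C ≠ ⊤ ∧ ∀ w : Phase S, sobEnergy S μ (2 * β) w ≠ ⊤ →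
      ∃ (ψ : ℝ → L2 D) (z : ℝ → Phase S), IsWeakSolution S Q B μ (-1) 0 ψ z ∧ z (-1) = 0 ∧
        z 0 = w ∧ AEStronglyMeasurable ψ (volume.restrict (Icc (-1) 0)) ∧
        ∫⁻ t in Icc (-1) 0, ‖ψ t‖ₑ ^ 2 ≤ C * sobEnergy S μ (2 * β) w := by
  have h0 := S.α_zero_pos
  have hβ := hQ.one_add_two_mul_pos hd
  obtain ⟨lam, c, hc, hlam, hQe, _, hlinv⟩ := hQ.exists_eigenvalues
  -- `B` is bounded only on spaces of nonnegative index, and `2β` may be negative; `δ` lies between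
  -- `2β` and the index `1 + 2β` of the position.
  set δ := max 0 (2 * β) with hδ
  have hδ1 : δ ≤ 1 + 2 * β := max_le (by linarith) (by linarith)
  obtain ⟨γ, _, _, hγ⟩ := hB.sobSum_le (δ := δ) ⟨le_max_left _ _, hδ1⟩
  set Ke := Real.exp (2 * 1 / μ) * (3 * μ⁻¹) with hKe
  have hKe0 : 0 ≤ Ke := by positivity
  set Kg := 32 * μ + 2 * (6 * μ + 2) ^ 2 * (S.α 0)⁻¹ with hKg
  have hKg0 : 0 ≤ Kg := by positivity
  set Kb := ENNReal.ofReal (S.α 0 ^ (2 * β - δ)) * (ENNReal.ofReal (γ ^ 2) *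
    (ENNReal.ofReal (S.α 0 ^ (δ - (2 * β + 1))) * ENNReal.ofReal Ke)) with hKb
  set C := ENNReal.ofReal (c ^ 2) * (ENNReal.ofReal 2 * ENNReal.ofReal (Kg * Ke) +
    ENNReal.ofReal 2 * Kb) with hC
  have hCt : C ≠ ⊤ := by finiteness
  refine ⟨C, hCt, fun w hw => ?_⟩
  set φ : ℕ → ℝ → ℝ × ℝ := fun k t => modeFlow μ (S.α k) t (phaseCoeff S w k) with hφ
  set E : ℕ → ℝ := fun k => modeEnergy μ (S.α k) (phaseCoeff S w k).1 (phaseCoeff S w k).2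
  set z := controlPath S hμ w with hz
  have hzc : Continuous z := continuous_controlPath hμ w
  set b : ℕ → ℝ → ℝ := fun k t => inner ℝ (S.e k) (B (z t).1) with hb
  set g : ℕ → ℝ → ℝ := fun k t => controlForce μ t (φ k t) with hg
  set cf : ℕ → ℝ → ℝ := fun k t => (lam k)⁻¹ * (g k t + -b k t) with hcf
  have hen : ∀ t ∈ Icc (-1 : ℝ) 0, ∀ k,
      μ * (φ k t).2 ^ 2 + S.α k * (φ k t).1 ^ 2 ≤ Ke * E k := by
    intro t ht k
    have hk := S.α_pos k
    refine (modeFlow_energy hμ hk t (phaseCoeff S w k)).trans ?_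
    rw [hKe, mul_assoc]
    have ht1 : |t| ≤ 1 := abs_le.2 ⟨ht.1, ht.2.trans zero_le_one⟩
    have h1 := le_modeEnergy μ (S.α k) (phaseCoeff S w k).1 (phaseCoeff S w k).2
    have h2 : μ * (phaseCoeff S w k).2 ^ 2 + S.α k * (phaseCoeff S w k).1 ^ 2 ≤
        3 * μ⁻¹ * E k := by
      have h3 := mul_le_mul_of_nonneg_left h1 (by positivity : 0 ≤ 3 * μ⁻¹)
      refine le_trans ?_ h3
      have e : 3 * μ⁻¹ * ((μ * (phaseCoeff S w k).2) ^ 2 / 2 +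
          μ * S.α k * (phaseCoeff S w k).1 ^ 2) = 3 / 2 * (μ * (phaseCoeff S w k).2 ^ 2) +
          3 * (S.α k * (phaseCoeff S w k).1 ^ 2) := by field_simp
      rw [e]
      have p1 : 0 ≤ μ * (phaseCoeff S w k).2 ^ 2 := by positivity
      have p2 : 0 ≤ S.α k * (phaseCoeff S w k).1 ^ 2 := by positivity
      linarith
    refine mul_le_mul ?_ h2 (by positivity) (by positivity)
    gcongr
  have hgb : ∀ t ∈ Icc (-1 : ℝ) 0, sobSum S (2 * β) (fun k => g k t) ≤
      ENNReal.ofReal (Kg * Ke) * sobEnergy S μ (2 * β) w := by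
    intro t ht
    rw [sobSum, sobEnergy, ← ENNReal.tsum_mul_left]
    refine ENNReal.tsum_le_tsum fun k => ?_
    rw [← ENNReal.ofReal_mul (by positivity)]
    refine ENNReal.ofReal_le_ofReal ?_
    have h1 := controlForce_sq_le hμ h0 (S.α_mono (Nat.zero_le k)) ht (φ k t)
    have h2 := h1.trans (mul_le_mul_of_nonneg_left (hen t ht k) hKg0)
    have h3 := mul_le_mul_of_nonneg_left h2 (Real.rpow_nonneg (S.α_pos k).le (2 * β))
    calc _ ≤ _ := h3
      _ = _ := by ring
  have hbb : ∀ t ∈ Icc (-1 : ℝ) 0, sobSum S (2 * β) (fun k => b k t) ≤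
      Kb * sobEnergy S μ (2 * β) w := by
    intro t ht
    have h1 : sobSum S (2 * β + 1) (fun k => inner ℝ (S.e k) (z t).1) ≤
        ENNReal.ofReal Ke * sobEnergy S μ (2 * β) w := by
      rw [sobSum, sobEnergy, ← ENNReal.tsum_mul_left]
      refine ENNReal.tsum_le_tsum fun k => ?_
      rw [← ENNReal.ofReal_mul (by positivity)]
      refine ENNReal.ofReal_le_ofReal ?_
      have e : (inner ℝ (S.e k) (z t).1 : ℝ) = cutoff t * (φ k t).1 :=
        congrArg Prod.fst (phaseCoeff_controlPath hμ w t k)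
      have hk := S.α_pos k
      have h2 : S.α k * (cutoff t * (φ k t).1) ^ 2 ≤ Ke * E k := by
        refine le_trans ?_ (hen t ht k)
        have h3 := mul_le_mul_of_nonneg_right (cutoff_sq_le ht)
          (by positivity : 0 ≤ S.α k * (φ k t).1 ^ 2)
        have h4 : 0 ≤ μ * (φ k t).2 ^ 2 := by positivity
        nlinarith
      rw [e, α_rpow_add_one]
      have h3 := mul_le_mul_of_nonneg_left h2 (Real.rpow_nonneg hk.le (2 * β))
      calc _ = _ := by ring
        _ ≤ _ := h3
        _ = _ := by ring
    refine (sobSum_mono (le_max_right 0 (2 * β)) _).trans ?_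
    rw [hKb, mul_assoc, mul_assoc, mul_assoc]
    refine mul_le_mul_right ((hγ _).trans (mul_le_mul_right ?_ _)) _
    exact (sobSum_mono (by linarith) _).trans (mul_le_mul_right h1 _)
  have hcb : ∀ t ∈ Icc (-1 : ℝ) 0, sobSum S 0 (fun k => cf k t) ≤
      C * sobEnergy S μ (2 * β) w := by
    intro t ht
    have h1 := sobSum_add_le (S := S) (δ := 2 * β) one_pos (fun k => g k t) (fun k => -b k t)
    have h2 : sobSum S (2 * β) (fun k => -b k t) = sobSum S (2 * β) (fun k => b k t) := by
      simp [sobSum]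
    rw [inv_one, one_add_one_eq_two, h2] at h1
    have h3 : sobSum S 0 (fun k => cf k t) ≤
        ENNReal.ofReal (c ^ 2) * sobSum S (2 * β) (fun k => g k t + -b k t) := by
      rw [sobSum, sobSum, ← ENNReal.tsum_mul_left]
      refine ENNReal.tsum_le_tsum fun k => ?_
      rw [← ENNReal.ofReal_mul (by positivity)]
      refine ENNReal.ofReal_le_ofReal ?_
      rw [Real.rpow_zero, one_mul, mul_pow, ← mul_assoc]
      exact mul_le_mul_of_nonneg_right (hlinv k) (sq_nonneg _)
    refine h3.trans ?_
    rw [hC, mul_assoc, add_mul, mul_assoc, mul_assoc]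
    exact mul_le_mul_right (h1.trans (add_le_add (mul_le_mul_right (hgb t ht) _)
      (mul_le_mul_right (hbb t ht) _))) _
  have hsum : ∀ t ∈ Icc (-1 : ℝ) 0, Summable fun k => cf k t ^ 2 := by
    intro t ht
    have := summable_of_sobSum_ne_top
      (ne_top_of_le_ne_top (ENNReal.mul_ne_top hCt hw) (hcb t ht))
    simpa using this
  classical
  -- The coefficients are square summable on `[-1, 0]`; the value zero at other times is immaterial.
  set ψ : ℝ → L2 D := fun t => if h : Summable (fun k => cf k t ^ 2) then L2ofCoeff S _ h else 0
    with hψ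
  have hψe : ∀ t ∈ Icc (-1 : ℝ) 0, ∀ k, inner ℝ (S.e k) (ψ t) = cf k t := by
    intro t ht k
    simp only [hψ, dif_pos (hsum t ht)]
    exact inner_L2ofCoeff _ _ k
  have hbc : ∀ k, Continuous (b k) := fun k =>
    (innerSL ℝ (S.e k)).continuous.comp (hBc.comp (continuous_fst.comp hzc))
  have hgc : ∀ k, Continuous (g k) := fun k => by
    have h1 : Continuous (φ k) := continuous_modeFlow μ (S.α k) _
    have h2 := continuous_cutoff'
    simp only [hg, controlForce]
    fun_prop
  have hcc : ∀ k, Continuous (cf k) := fun k => continuous_const.mul ((hgc k).add (hbc k).neg)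
  refine ⟨ψ, z, ⟨hzc.continuousOn, fun k => ?_⟩, controlPath_neg_one hμ w, controlPath_zero hμ w,
    ?_, ?_⟩
  · have h1 := isModeSolution_control (a := S.α k) hμ (phaseCoeff S w k) (-1) 0
    have e1 : ∀ t, (inner ℝ (S.e k) (z t).1 : ℝ) = cutoff t * (φ k t).1 := fun t =>
      congrArg Prod.fst (phaseCoeff_controlPath hμ w t k)
    have e2 : ∀ t, (z t).2.coeff k = cutoff t * (φ k t).2 + cutoff' t * (φ k t).1 := fun t =>
      congrArg Prod.snd (phaseCoeff_controlPath hμ w t k)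
    refine ⟨h1.pos.congr (fun t _ => (e1 t).symm) (Eventually.of_forall fun t _ => (e2 t).symm)
      (by norm_num), h1.vel.congr (fun t _ => by rw [e2 t])
      (Eventually.of_forall fun t ht => ?_) (by norm_num)⟩
    rw [e1 t, e2 t, hQe, hψe t (Ioc_subset_Icc_self ht)]
    have : lam k * cf k t = g k t + -b k t := mul_inv_cancel_left₀ (hlam k).ne' _
    rw [this]
    simp only [hg, hb, hφ]
    ring
  · refine aestronglyMeasurable_of_inner (S := S) fun k => ?_
    refine ((hcc k).aemeasurable).congr ?_
    exact (ae_restrict_iff' measurableSet_Icc).2 (Eventually.of_forall fun t ht =>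
      (hψe t ht k).symm)
  · calc ∫⁻ t in Icc (-1) 0, ‖ψ t‖ₑ ^ 2
        ≤ ∫⁻ _ in Icc (-1 : ℝ) 0, C * sobEnergy S μ (2 * β) w := by
          refine setLIntegral_mono' measurableSet_Icc fun t ht => ?_
          rw [← ofReal_norm_sq, ← sobSum_inner S]
          simp only [hψe t ht]
          exact hcb t ht
      _ = _ := by simp

end Controllability

section Compactness

variable {d : ℕ} {D : Set (EuclideanSpace ℝ (Fin d))} {S : DirichletEigensystem D}
  {Q : L2 D →L[ℝ] L2 D} {B : L2 D → L2 D} {μ t₁ t₂ : ℝ} {ψ : ℝ → L2 D} {z : ℝ → Phase S}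

/-! ### Compact sets of the phase space -/

variable (S) in
/-- The points of `𝓗` whose Fourier coefficients are dominated by a given sequence. -/
def coeffBox (g : ℕ → ℝ) : Set (Phase S) :=
  {z | ∀ k, (phaseCoeff S z k).1 ^ 2 ≤ g k ∧ S.α k ^ (-1 : ℝ) * (phaseCoeff S z k).2 ^ 2 ≤ g k}

/-- A Hilbert cube. Along an ultrafilter each coefficient converges in a bounded set of the plane,
and the summable majorant upgrades this to convergence in norm. -/
theorem isCompact_coeffBox {g : ℕ → ℝ} (hg : Summable g) : IsCompact (coeffBox S g) := by
  rw [isCompact_iff_ultrafilter_le_nhds]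
  intro f hf
  have hbox : ∀ᶠ z in (f : Filter (Phase S)), z ∈ coeffBox S g := hf (mem_principal_self _)
  have hpos : ∀ k, 0 < S.α k ^ (-1 : ℝ) := fun k => Real.rpow_pos_of_pos (S.α_pos k) _
  have hlim : ∀ k, ∃ c : ℝ × ℝ, Tendsto (fun z => phaseCoeff S z k) f (𝓝 c) := by
    intro k
    -- The bound `x² ≤ y` gives `|x| ≤ y + 1`, which avoids square roots in the choice of the
    -- compact rectangle.
    obtain ⟨c, -, hc⟩ := isCompact_iff_ultrafilter_le_nhds.1
      ((isCompact_Icc (a := -(g k + 1)) (b := g k + 1)).prod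
        (isCompact_Icc (a := -(S.α k ^ (-1 : ℝ))⁻¹ * g k - 1) (b := (S.α k ^ (-1 : ℝ))⁻¹ * g k + 1)))
      (f.map fun z => phaseCoeff S z k) (by
        rw [Ultrafilter.coe_map, le_principal_iff, mem_map]
        filter_upwards [hbox] with z hz
        obtain ⟨h1, h2⟩ := hz k
        have h2' : (phaseCoeff S z k).2 ^ 2 ≤ (S.α k ^ (-1 : ℝ))⁻¹ * g k := by
          rwa [← div_eq_inv_mul, le_div_iff₀' (hpos k)]
        refine ⟨⟨?_, ?_⟩, ?_, ?_⟩
        · nlinarith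
        · nlinarith
        · nlinarith
        · nlinarith)
    exact ⟨c, hc⟩
  choose c hc using hlim
  have hcb : ∀ k, (c k).1 ^ 2 ≤ g k ∧ S.α k ^ (-1 : ℝ) * (c k).2 ^ 2 ≤ g k := fun k =>
    ⟨le_of_tendsto (((continuous_fst.tendsto _).comp (hc k)).pow 2) (hbox.mono fun z hz => (hz k).1),
      le_of_tendsto ((((continuous_snd.tendsto _).comp (hc k)).pow 2).const_mul _)
        (hbox.mono fun z hz => (hz k).2)⟩
  have hs1 : Summable fun k => (c k).1 ^ 2 :=
    hg.of_nonneg_of_le (fun k => sq_nonneg _) fun k => (hcb k).1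
  have hs2 : Summable fun k => S.α k ^ (-1 : ℝ) * (c k).2 ^ 2 :=
    hg.of_nonneg_of_le (fun k => mul_nonneg (hpos k).le (sq_nonneg _)) fun k => (hcb k).2
  let w : Phase S := (L2ofCoeff S (fun k => (c k).1) hs1, Sob.ofCoeff (fun k => (c k).2) hs2)
  have hw : ∀ k, phaseCoeff S w k = c k := fun k =>
    Prod.ext (inner_L2ofCoeff _ hs1 k) (Sob.coeff_ofCoeff _ hs2 k)
  refine ⟨w, fun k => by rw [hw]; exact hcb k, ?_⟩
  exact tendsto_phase_of_dominated (F := id) (fun k => by rw [hw]; exact hc k) hg hbox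

/-- On a compact set, convergence of the Fourier coefficients implies convergence. -/
theorem tendsto_sub_of_isCompact {ι : Type*} {l : Filter ι} {K : Set (Phase S)} (hK : IsCompact K)
    {F G : ι → Phase S} (hF : ∀ᶠ i in l, F i ∈ K) (hG : ∀ᶠ i in l, G i ∈ K)
    (h : ∀ k, Tendsto (fun i => phaseCoeff S (F i) k - phaseCoeff S (G i) k) l (𝓝 0)) :
    Tendsto (fun i => F i - G i) l (𝓝 0) := by
  rw [tendsto_iff_ultrafilter]
  intro u hu
  rw [isCompact_iff_ultrafilter_le_nhds] at hK
  obtain ⟨x, -, hx⟩ := hK (u.map F) (by rw [le_principal_iff]; exact hu hF)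
  obtain ⟨y, -, hy⟩ := hK (u.map G) (by rw [le_principal_iff]; exact hu hG)
  have hx' : Tendsto F u (𝓝 x) := hx
  have hy' : Tendsto G u (𝓝 y) := hy
  have hxy : x = y := phase_ext fun k => by
    have h1 := (((phaseCoeffL S k).continuous.tendsto x).comp hx').sub
      (((phaseCoeffL S k).continuous.tendsto y).comp hy')
    exact sub_eq_zero.1 (tendsto_nhds_unique h1 ((h k).mono_left hu))
  have := hx'.sub hy'
  rwa [hxy, sub_self] at this

/-- Comparison with the series of `k^{-(2/d)(2β+1)}`, whose exponent exceeds one in absolute value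
exactly when `β > (d-2)/4`. -/
theorem summable_α_rpow (hd : 1 ≤ d)
    (hα : S.α =Θ[atTop] fun k : ℕ => ((k : ℝ) + 1) ^ (2 / (d : ℝ))) {β : ℝ}
    (hQ : NoiseAssumption S β Q) : Summable fun k => S.α k ^ (-(2 * β + 1)) := by
  have hd' : (0 : ℝ) < d := by exact_mod_cast hd
  have hβ : (d : ℝ) / 2 < 2 * β + 1 := by linarith [hQ.β_gt]
  have hs : 0 ≤ 2 * β + 1 := by linarith
  have h1 := (hα.2.rpow hs (Eventually.of_forall fun k => (S.α_pos k).le)).inv_rev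
    (Eventually.of_forall fun k h => absurd h (by positivity))
  have h2 : Summable fun k : ℕ => ((k : ℝ) + 1) ^ (-(2 / (d : ℝ) * (2 * β + 1))) := by
    have h3 : Summable fun k : ℕ => (k : ℝ) ^ (-(2 / (d : ℝ) * (2 * β + 1))) := by
      rw [Real.summable_nat_rpow, neg_lt_neg_iff, div_mul_eq_mul_div, lt_div_iff₀ hd']
      linarith
    simpa using (summable_nat_add_iff 1).2 h3
  refine summable_of_isBigO_nat h2 ?_
  refine (h1.congr_left fun k => ?_).congr_right fun k => ?_
  · exact (Real.rpow_neg (S.α_pos k).le _).symm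
  · rw [Real.rpow_neg (by positivity), Real.rpow_mul (by positivity)]

/-- Balls of the Sobolev scale are relatively compact in `𝓗`. -/
theorem exists_coeffBox (hd : 1 ≤ d)
    (hα : S.α =Θ[atTop] fun k : ℕ => ((k : ℝ) + 1) ^ (2 / (d : ℝ))) {β : ℝ}
    (hQ : NoiseAssumption S β Q) (hμ : 0 < μ) {M : ℝ≥0∞} (hM : M ≠ ⊤) :
    ∃ g : ℕ → ℝ, Summable g ∧ ∀ w : Phase S, sobEnergy S μ (2 * β) w ≤ M → w ∈ coeffBox S g := by
  set N : ℝ≥0∞ := ENNReal.ofReal μ⁻¹ * M + ENNReal.ofReal (2 * (μ ^ 2)⁻¹) * M with hN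
  have hNt : N ≠ ⊤ := by finiteness
  refine ⟨fun k => N.toReal * S.α k ^ (-(2 * β + 1)), (summable_α_rpow hd hα hQ).mul_left _,
    fun w hw k => ?_⟩
  have key : ∀ (δ : ℝ) (c : ℕ → ℝ), sobSum S δ c ≤ N → S.α k ^ δ * c k ^ 2 ≤ N.toReal := by
    intro δ c h
    rw [← ENNReal.ofReal_le_iff_le_toReal hNt]
    exact (ENNReal.le_tsum k).trans h
  have h1 := key (2 * β + 1) (fun k => (phaseCoeff S w k).1)
    ((sobSum_fst_le_sobEnergy hμ (2 * β) w).trans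
      ((mul_le_mul_right hw _).trans le_self_add))
  have h2 := key (2 * β) (fun k => (phaseCoeff S w k).2)
    ((sobSum_snd_le_sobEnergy hμ (2 * β) w).trans
      ((mul_le_mul_right hw _).trans le_add_self))
  have hp := Real.rpow_pos_of_pos (S.α_pos k) (2 * β + 1)
  -- Both components drop by `2β + 1` orders between `H^{2β+1} × H^{2β}` and `𝓗`, so one majorant
  -- serves for both; it is enough that each term is at most the whole sum.
  have ha : S.α k ^ (-1 : ℝ) = S.α k ^ (2 * β) * S.α k ^ (-(2 * β + 1)) := by
    rw [← Real.rpow_add (S.α_pos k)]; ring_nf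
  change _ ≤ N.toReal * _ ∧ _ ≤ N.toReal * _
  rw [ha, Real.rpow_neg (S.α_pos k).le]
  constructor
  · rw [← div_eq_mul_inv, le_div_iff₀ hp]; linarith
  · rw [← div_eq_mul_inv N.toReal, le_div_iff₀ hp]
    calc _ = S.α k ^ (2 * β) * (phaseCoeff S w k).2 ^ 2 := by field_simp
      _ ≤ _ := h2

end Compactness

/-! ### Weak limits -/

/-- Banach–Alaoglu along an ultrafilter. Norm bounds converging to `M`, rather than one fixed bound,
give the sharp estimate on the limit: this is the weak lower semicontinuity that produces
minimizers. -/
theorem exists_weak_limit {ι E : Type*} [NormedAddCommGroup E] [InnerProductSpace ℝ E]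
    [CompleteSpace E] (l : Ultrafilter ι) {x : ι → E} {m : ι → ℝ} {M : ℝ}
    (hx : ∀ᶠ i in (l : Filter ι), ‖x i‖ ≤ m i) (hm : Tendsto m l (𝓝 M)) :
    ∃ y : E, ‖y‖ ≤ M ∧ ∀ v : E, Tendsto (fun i => inner ℝ v (x i)) l (𝓝 (inner ℝ v y)) := by
  let T : ι → WeakDual ℝ E := fun i => StrongDual.toWeakDual (InnerProductSpace.toDual ℝ E (x i))
  have hb : ∀ᶠ i in (l : Filter ι), ‖x i‖ ≤ M + 1 := by
    filter_upwards [hx, hm.eventually_le_const (lt_add_one M)] with i h1 h2 using h1.trans h2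
  obtain ⟨φ, -, hφ⟩ := isCompact_iff_ultrafilter_le_nhds.1
    (WeakDual.isCompact_closedBall (𝕜 := ℝ) (0 : StrongDual ℝ E) (M + 1)) (l.map T) (by
      rw [le_principal_iff]
      change ∀ᶠ i in (l : Filter ι), _
      filter_upwards [hb] with i hi
      simpa [T] using hi)
  set y := (InnerProductSpace.toDual ℝ E).symm (WeakDual.toStrongDual φ) with hy
  have hlim : ∀ v : E, Tendsto (fun i => inner ℝ v (x i)) l (𝓝 (inner ℝ v y)) := by
    intro v
    have h1 : Tendsto (fun i => T i v) l (𝓝 (φ v)) :=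
      ((WeakDual.eval_continuous v).tendsto φ).comp hφ
    have h2 : φ v = inner ℝ v y := by
      rw [real_inner_comm, hy, InnerProductSpace.toDual_symm_apply]; rfl
    rw [← h2]
    refine h1.congr fun i => ?_
    rw [real_inner_comm]
    exact InnerProductSpace.toDual_apply_apply
  refine ⟨y, ?_, hlim⟩
  -- The limit is tested against itself.
  have h1 : inner ℝ y y ≤ ‖y‖ * M := le_of_tendsto_of_tendsto (hlim y) (hm.const_mul ‖y‖) (by
    filter_upwards [hx] with i hi
    exact (real_inner_le_norm y (x i)).trans (mul_le_mul_of_nonneg_left hi (norm_nonneg _)))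
  rw [real_inner_self_eq_norm_sq] at h1
  rcases (norm_nonneg y).eq_or_lt with h0 | h0
  · rw [← h0]
    exact ge_of_tendsto hm (hx.mono fun i hi => (norm_nonneg _).trans hi)
  · nlinarith

theorem tendsto_integral_of_tendstoUniformlyOn {ι : Type*} {l : Filter ι} {F : ι → ℝ → ℝ}
    {f : ℝ → ℝ} {a b : ℝ} (hab : a ≤ b) (hF : ∀ᶠ i in l, ContinuousOn (F i) (Icc a b))
    (hf : ContinuousOn f (Icc a b)) (h : TendstoUniformlyOn F f l (Icc a b)) :
    Tendsto (fun i => ∫ s in a..b, F i s) l (𝓝 (∫ s in a..b, f s)) := by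
  rw [Metric.tendsto_nhds]
  intro ε hε
  rw [Metric.tendstoUniformlyOn_iff] at h
  have hba : 0 ≤ b - a := sub_nonneg.2 hab
  filter_upwards [hF, h (ε / (b - a + 1)) (by positivity)] with i h1 h2
  rw [Real.dist_eq, ← intervalIntegral.integral_sub (h1.intervalIntegrable_of_Icc hab)
    (hf.intervalIntegrable_of_Icc hab), ← Real.norm_eq_abs]
  have h3 := intervalIntegral.norm_integral_le_of_norm_le_const (a := a) (b := b)
    (f := fun s => F i s - f s) (C := ε / (b - a + 1)) fun s hs => by
      rw [uIoc_of_le hab] at hs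
      have := h2 s (Ioc_subset_Icc_self hs)
      rw [dist_comm, Real.dist_eq] at this
      exact this.le
  refine h3.trans_lt ?_
  rw [abs_of_nonneg hba, div_mul_eq_mul_div, div_lt_iff₀ (by positivity)]
  nlinarith

/-! ### Passing to the limit in the controlled equation -/

section Limits

/-- The space `L²((-∞, 0]; H)` of controls. -/
abbrev Control {d : ℕ} (D : Set (EuclideanSpace ℝ (Fin d))) : Type :=
  Lp (L2 D) 2 (volume.restrict (Iic (0 : ℝ)))

variable {d : ℕ} {D : Set (EuclideanSpace ℝ (Fin d))} {S : DirichletEigensystem D}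
  {Q : L2 D →L[ℝ] L2 D} {B : L2 D → L2 D} {μ : ℝ}

theorem enorm_control_sq (Ψ : Control D) :
    ‖Ψ‖ₑ ^ 2 = ∫⁻ t in Iic (0 : ℝ), ‖Ψ t‖ₑ ^ 2 := by
  rw [Lp.enorm_def, eLpNorm_two_sq]

/-- The function equal to `v` on `(a, b]` and to `0` elsewhere. -/
def controlStep (v : L2 D) (a b : ℝ) : Control D :=
  indicatorConstLp 2 (measurableSet_Ioc (a := a) (b := b))
    ((Measure.restrict_apply_le _ _).trans_lt measure_Ioc_lt_top).ne v

theorem norm_controlStep_le (v : L2 D) {a b : ℝ} (hab : a ≤ b) :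
    ‖controlStep v a b‖ ≤ ‖v‖ * √(b - a) := by
  refine norm_indicatorConstLp_le.trans ?_
  rw [ENNReal.toReal_ofNat, ← Real.sqrt_eq_rpow]
  refine mul_le_mul_of_nonneg_left (Real.sqrt_le_sqrt ?_) (norm_nonneg _)
  have h : volume.restrict (Iic (0 : ℝ)) (Ioc a b) ≤ ENNReal.ofReal (b - a) :=
    (Measure.restrict_apply_le _ _).trans_eq Real.volume_Ioc
  exact ENNReal.toReal_le_of_le_ofReal (sub_nonneg.2 hab) h

theorem inner_controlStep (v : L2 D) {a b : ℝ} (hab : a ≤ b) (hb : b ≤ 0) (Ψ : Control D) :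
    inner ℝ (controlStep v a b) Ψ = ∫ t in a..b, inner ℝ v (Ψ t) := by
  rw [controlStep, L2.inner_indicatorConstLp_eq_setIntegral_inner,
    Measure.restrict_restrict measurableSet_Ioc, intervalIntegral.integral_of_le hab,
    inter_eq_left.2 fun _ ht => mem_Iic.2 (ht.2.trans hb)]

theorem intervalIntegrable_control (Ψ : Control D) {a b : ℝ} (hab : a ≤ b) (hb : b ≤ 0) :
    IntervalIntegrable Ψ volume a b :=
  intervalIntegrable_of_memLp hab ((Lp.memLp Ψ).mono_measure
    (Measure.restrict_mono (fun _ ht => mem_Iic.2 (ht.2.le.trans hb)) le_rfl))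

/-- The uncontrolled part of `μ dr_k/dt`. -/
def driftCoeff (S : DirichletEigensystem D) (B : L2 D → L2 D) (k : ℕ) (w : Phase S) : ℝ :=
  -(S.α k * (phaseCoeff S w k).1) - (phaseCoeff S w k).2 + inner ℝ (S.e k) (B w.1)

theorem continuous_driftCoeff (hB : Continuous B) (k : ℕ) : Continuous (driftCoeff S B k) := by
  have hc := (phaseCoeffL S k).continuous
  exact ((((continuous_fst.comp hc).const_mul (S.α k)).neg).sub (continuous_snd.comp hc)).add
    ((innerSL ℝ (S.e k)).continuous.comp (hB.comp continuous_fst))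

theorem uniformContinuous_driftCoeff (hB : UniformContinuous B) (k : ℕ) :
    UniformContinuous (driftCoeff S B k) := by
  have h := (phaseCoeffL S k).uniformContinuous
  have h1 : UniformContinuous fun w : Phase S => -(S.α k * (phaseCoeff S w k).1) :=
    ((uniformContinuous_fst.comp h).const_mul' (S.α k)).neg
  have h3 : UniformContinuous fun w : Phase S => inner ℝ (S.e k) (B w.1) :=
    (innerSL ℝ (S.e k)).uniformContinuous.comp (hB.comp uniformContinuous_fst)
  exact (h1.sub (uniformContinuous_snd.comp h)).add h3

/-- The equation in integrated form, in which the control enters linearly. -/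
theorem isWeakSolution_iff (hB : Continuous B) {a b : ℝ} (hab : a ≤ b) (hb : b ≤ 0)
    {Ψ : Control D} {z : ℝ → Phase S} :
    IsWeakSolution S Q B μ a b Ψ z ↔ ContinuousOn z (Icc a b) ∧ ∀ k, ∀ t ∈ Icc a b,
      (phaseCoeff S (z t) k).1 = (phaseCoeff S (z a) k).1 + ∫ s in a..t, (phaseCoeff S (z s) k).2 ∧
      μ * (phaseCoeff S (z t) k).2 = μ * (phaseCoeff S (z a) k).2 +
        ((∫ s in a..t, driftCoeff S B k (z s)) +
          inner ℝ (controlStep (Q.adjoint (S.e k)) a t) Ψ) := by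
  have key : ContinuousOn z (Icc a b) → ∀ k,
      IntervalIntegrable (fun s => (phaseCoeff S (z s) k).2) volume a b ∧
      (∀ t ∈ Icc a b, IntervalIntegrable (fun s => driftCoeff S B k (z s)) volume a t) ∧
      ∀ t ∈ Icc a b, IntervalIntegrable (fun s => inner ℝ (S.e k) (Q (Ψ s))) volume a t := by
    intro hz k
    have hc := (phaseCoeffL S k).continuous
    have hd := continuous_driftCoeff (S := S) hB k
    refine ⟨ContinuousOn.intervalIntegrable_of_Icc hab
      ((continuous_snd.comp hc).comp_continuousOn hz), fun t ht => ?_, fun t ht => ?_⟩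
    · exact ContinuousOn.intervalIntegrable_of_Icc ht.1
        (hd.comp_continuousOn (hz.mono (Icc_subset_Icc_right ht.2)))
    · have := intervalIntegrable_control Ψ ht.1 (ht.2.trans hb)
      rw [intervalIntegrable_iff] at this ⊢
      exact ((innerSL ℝ (S.e k)).comp Q).integrable_comp this
  -- Moving `Q` to the other side turns the control term into the pairing of `Ψ` with a fixed
  -- element of `L²((-∞, 0]; H)`, so it is continuous under weak convergence.
  have hvel : ContinuousOn z (Icc a b) → ∀ k, ∀ t ∈ Icc a b,
      (∫ s in a..t, -(S.α k * inner ℝ (S.e k) (z s).1) - (z s).2.coeff k +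
        (inner ℝ (S.e k) (B (z s).1) + inner ℝ (S.e k) (Q (Ψ s)))) =
      (∫ s in a..t, driftCoeff S B k (z s)) +
        inner ℝ (controlStep (Q.adjoint (S.e k)) a t) Ψ := by
    intro hz k t ht
    rw [inner_controlStep _ ht.1 (ht.2.trans hb)]
    simp only [ContinuousLinearMap.adjoint_inner_left]
    rw [← intervalIntegral.integral_add ((key hz k).2.1 t ht) ((key hz k).2.2 t ht)]
    refine intervalIntegral.integral_congr fun s _ => ?_
    simp only [driftCoeff, phaseCoeff]
    ring
  constructor
  · intro h
    refine ⟨h.cont, fun k t ht => ⟨(h.mode k).pos.2 t ht, ?_⟩⟩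
    rw [← hvel h.cont k t ht]
    exact (h.mode k).vel.2 t ht
  · rintro ⟨hz, h⟩
    refine ⟨hz, fun k => ⟨⟨(key hz k).1, fun t ht => (h k t ht).1⟩, ?_, fun t ht => ?_⟩⟩
    · have h1 := ((key hz k).2.1 b ⟨hab, le_rfl⟩).add ((key hz k).2.2 b ⟨hab, le_rfl⟩)
      refine h1.congr fun s _ => ?_
      simp only [driftCoeff, phaseCoeff]
      ring
    · rw [hvel hz k t ht]
      exact (h k t ht).2

/-- In the integrated equation the drift integrals converge by uniform convergence of the states and
uniform continuity of `B`, and the control term by weak convergence; no strong convergence of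
controls is needed. -/
theorem isWeakSolution_of_tendsto (hB : UniformContinuous B) {ι : Type*} {l : Filter ι} [l.NeBot]
    {a : ℝ} (ha : a ≤ 0) {Ψ : ι → Control D} {Ψ' : Control D} {z : ι → ℝ → Phase S}
    {z' : ℝ → Phase S} (h : ∀ᶠ i in l, IsWeakSolution S Q B μ a 0 (Ψ i) (z i))
    (hz : TendstoUniformlyOn z z' l (Icc a 0))
    (hΨ : ∀ v : Control D, Tendsto (fun i => inner ℝ v (Ψ i)) l (𝓝 (inner ℝ v Ψ'))) :
    IsWeakSolution S Q B μ a 0 Ψ' z' := by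
  have hzc : ∀ᶠ i in l, ContinuousOn (z i) (Icc a 0) := h.mono fun i hi => hi.cont
  have hz'c : ContinuousOn z' (Icc a 0) := hz.continuousOn hzc.frequently
  rw [isWeakSolution_iff hB.continuous ha le_rfl]
  refine ⟨hz'c, fun k t ht => ?_⟩
  have hU := (phaseCoeffL S k).uniformContinuous
  have hUs := uniformContinuous_snd.comp hU
  have hUd := uniformContinuous_driftCoeff (S := S) hB k
  have hsub : Icc a t ⊆ Icc a 0 := Icc_subset_Icc_right ht.2
  have hp : ∀ s ∈ Icc a 0, Tendsto (fun i => phaseCoeff S (z i s) k) l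
      (𝓝 (phaseCoeff S (z' s) k)) := fun s hs =>
    ((phaseCoeffL S k).continuous.tendsto _).comp (hz.tendsto_at hs)
  have hint : ∀ f : Phase S → ℝ, UniformContinuous f → Tendsto (fun i => ∫ s in a..t, f (z i s)) l
      (𝓝 (∫ s in a..t, f (z' s))) := fun f hf =>
    tendsto_integral_of_tendstoUniformlyOn ht.1
      (hzc.mono fun i hi => hf.continuous.comp_continuousOn (hi.mono hsub))
      (hf.continuous.comp_continuousOn (hz'c.mono hsub)) (hf.comp_tendstoUniformlyOn (hz.mono hsub))
  have ha' : a ∈ Icc a 0 := ⟨le_rfl, ha⟩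
  have h' := h.mono fun i hi => ((isWeakSolution_iff hB.continuous ha le_rfl).1 hi).2 k t ht
  constructor
  · exact tendsto_nhds_unique_of_eventuallyEq ((continuous_fst.tendsto _).comp (hp t ht))
      (((continuous_fst.tendsto _).comp (hp a ha')).add (hint _ hUs)) (h'.mono fun i hi => hi.1)
  · exact tendsto_nhds_unique_of_eventuallyEq
      (((continuous_snd.tendsto _).comp (hp t ht)).const_mul μ)
      ((((continuous_snd.tendsto _).comp (hp a ha')).const_mul μ).add
        ((hint _ hUd).add (hΨ _))) (h'.mono fun i hi => hi.2)

/-- The modulus of continuity of the Fourier coefficients of a bounded solution. -/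
theorem IsWeakSolution.norm_phaseCoeff_sub_le (hB : Continuous B) (hμ : 0 < μ) {a : ℝ}
    {Ψ : Control D} {z : ℝ → Phase S} (h : IsWeakSolution S Q B μ a 0 Ψ z) {k : ℕ} {N R : ℝ}
    (hN : ∀ s ∈ Icc a 0, |(phaseCoeff S (z s) k).2| ≤ N ∧ |driftCoeff S B k (z s)| ≤ N)
    (hR : ‖Ψ‖ ≤ R) {s t : ℝ} (hs : s ∈ Icc a 0) (ht : t ∈ Icc a 0) :
    ‖phaseCoeff S (z s) k - phaseCoeff S (z t) k‖ ≤
      (1 + μ⁻¹) * (N * |s - t| + ‖Q.adjoint (S.e k)‖ * √|s - t| * R) := by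
  wlog hst : s ≤ t generalizing s t
  · rw [norm_sub_rev, abs_sub_comm]
    exact this ht hs (not_le.1 hst).le
  obtain ⟨h1, h2⟩ := ((isWeakSolution_iff hB hst ht.2).1 (h.mono hs.1 hst ht.2)).2 k t ⟨hst, le_rfl⟩
  have hI : ∀ f : ℝ → ℝ, (∀ r ∈ Icc a 0, |f r| ≤ N) → |∫ r in s..t, f r| ≤ N * |s - t| := by
    intro f hf
    rw [abs_sub_comm]
    refine intervalIntegral.norm_integral_le_of_norm_le_const (f := f) fun r hr => hf r ?_
    rw [uIoc_of_le hst] at hr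
    exact ⟨hs.1.trans hr.1.le, hr.2.trans ht.2⟩
  have hN0 : 0 ≤ N := (abs_nonneg _).trans (hN s hs).1
  have hR0 : 0 ≤ R := (norm_nonneg _).trans hR
  have h3 := hI _ fun r hr => (hN r hr).1
  have h4 := hI _ fun r hr => (hN r hr).2
  have h5 : |inner ℝ (controlStep (Q.adjoint (S.e k)) s t) Ψ| ≤
      ‖Q.adjoint (S.e k)‖ * √|s - t| * R := by
    refine (abs_real_inner_le_norm _ _).trans (mul_le_mul ?_ hR (norm_nonneg _) (by positivity))
    rw [abs_sub_comm, abs_of_nonneg (sub_nonneg.2 hst)]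
    exact norm_controlStep_le _ hst
  have hμ' : 0 < μ⁻¹ := inv_pos.2 hμ
  have e0 : 0 ≤ N * |s - t| := by positivity
  have e1 : 0 ≤ ‖Q.adjoint (S.e k)‖ * √|s - t| * R := by positivity
  refine norm_prod_le_iff.2 ⟨?_, ?_⟩
  · rw [Prod.fst_sub, h1, sub_add_cancel_left, norm_neg, Real.norm_eq_abs]
    nlinarith
  · have h6 : (phaseCoeff S (z s) k).2 - (phaseCoeff S (z t) k).2 =
        -(μ⁻¹ * ((∫ r in s..t, driftCoeff S B k (z r)) +
          inner ℝ (controlStep (Q.adjoint (S.e k)) s t) Ψ)) := by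
      field_simp
      linarith
    rw [Prod.snd_sub, h6, norm_neg, norm_mul, Real.norm_of_nonneg hμ'.le, Real.norm_eq_abs]
    have h7 := abs_add_le (∫ r in s..t, driftCoeff S B k (z r))
      (inner ℝ (controlStep (Q.adjoint (S.e k)) s t) Ψ)
    nlinarith [mul_le_mul_of_nonneg_left (h7.trans (add_le_add h4 h5)) hμ'.le]

/-- Solutions with values in a compact set converge uniformly as soon as they converge pointwise. -/
theorem tendstoUniformlyOn_of_isCompact (hB : Continuous B) (hμ : 0 < μ) {a R : ℝ}
    {K : Set (Phase S)} (hK : IsCompact K) {ι : Type*} {l : Filter ι} {Ψ : ι → Control D}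
    {z : ι → ℝ → Phase S} {z' : ℝ → Phase S}
    (h : ∀ i, IsWeakSolution S Q B μ a 0 (Ψ i) (z i)) (hΨ : ∀ i, ‖Ψ i‖ ≤ R)
    (hzK : ∀ i, ∀ t ∈ Icc a 0, z i t ∈ K)
    (hz : ∀ t ∈ Icc a 0, Tendsto (fun i => z i t) l (𝓝 (z' t))) :
    TendstoUniformlyOn z z' l (Icc a 0) := by
  have hcoeff : ∀ k, ∃ N, ∀ w ∈ K, |(phaseCoeff S w k).2| ≤ N ∧ |driftCoeff S B k w| ≤ N := by
    intro k
    have hc := (phaseCoeffL S k).continuous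
    have hd := continuous_driftCoeff (S := S) hB k
    obtain ⟨N₁, h1⟩ := hK.exists_bound_of_continuousOn (continuous_snd.comp hc).continuousOn
    obtain ⟨N₂, h2⟩ := hK.exists_bound_of_continuousOn hd.continuousOn
    exact ⟨max N₁ N₂, fun w hw => ⟨(h1 w hw).trans (le_max_left _ _),
      (h2 w hw).trans (le_max_right _ _)⟩⟩
  -- Equicontinuity at `t`: the product with the filter `⊤` makes the limit uniform in the index.
  -- The coefficients share a modulus of continuity for each `k`, and compactness of `K` turns this
  -- into a statement in norm.
  have hequi : ∀ t ∈ Icc a 0, Tendsto (fun q : ι × ℝ => z q.1 q.2 - z q.1 t)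
      (⊤ ×ˢ 𝓝[Icc a 0] t) (𝓝 0) := by
    intro t ht
    have hmem : ∀ᶠ q : ι × ℝ in ⊤ ×ˢ 𝓝[Icc a 0] t, q.2 ∈ Icc a 0 :=
      tendsto_snd.eventually self_mem_nhdsWithin
    refine tendsto_sub_of_isCompact hK (hmem.mono fun q hq => hzK _ _ hq)
      (Eventually.of_forall fun q => hzK _ _ ht) fun k => ?_
    obtain ⟨N, hN⟩ := hcoeff k
    have hlim : Tendsto (fun q : ι × ℝ => (1 + μ⁻¹) * (N * |q.2 - t| +
        ‖Q.adjoint (S.e k)‖ * √|q.2 - t| * R)) (⊤ ×ˢ 𝓝[Icc a 0] t) (𝓝 0) := by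
      have hcont : Continuous fun s : ℝ => (1 + μ⁻¹) * (N * |s - t| +
        ‖Q.adjoint (S.e k)‖ * √|s - t| * R) := by fun_prop
      have h1 := (hcont.tendsto t).comp ((tendsto_snd (f := (⊤ : Filter ι))
        (g := 𝓝[Icc a 0] t)).mono_right nhdsWithin_le_nhds)
      simpa [Function.comp_def] using h1
    refine squeeze_zero_norm' (hmem.mono fun q hq => ?_) hlim
    exact (h q.1).norm_phaseCoeff_sub_le hB hμ (fun s hs => hN _ (hzK q.1 s hs)) (hΨ q.1) hq ht
  have hE : Equicontinuous fun (i : ι) (t : Icc a 0) => z i t := by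
    intro t
    rw [Metric.equicontinuousAt_iff_right]
    intro ε hε
    have h1 : ∀ᶠ q : ι × ℝ in ⊤ ×ˢ 𝓝[Icc a 0] (t : ℝ), ‖z q.1 q.2 - z q.1 t‖ < ε :=
      (hequi t t.2).norm.eventually_lt_const (by rwa [norm_zero])
    obtain ⟨A, hA, A', hA', hAA⟩ := eventually_prod_iff.1 h1
    rw [eventually_top] at hA
    filter_upwards [preimage_coe_mem_nhds_subtype.2 hA'] with s hs i
    rw [dist_comm, dist_eq_norm]
    exact hAA (hA i) hs
  rw [tendstoUniformlyOn_iff_tendstoUniformly_comp_coe]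
  -- For an equicontinuous family on a compact interval, pointwise and uniform convergence agree.
  exact UniformFun.tendsto_iff_tendstoUniformly.1
    ((hE.tendsto_uniformFun_iff_pi l _).2 (tendsto_pi_nhds.2 fun t => hz t t.2))

end Limits

/-! ### Controls on the half-line, extension and translation of paths -/

section Paths

variable {d : ℕ} {D : Set (EuclideanSpace ℝ (Fin d))} {S : DirichletEigensystem D}
  {Q : L2 D →L[ℝ] L2 D} {B : L2 D → L2 D} {μ : ℝ}

theorem half_enorm_sq_le_iff {E : Type*} [NormedAddCommGroup E] {x : E} {C : ℝ≥0∞} (hC : C ≠ ⊤) :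
    2⁻¹ * ‖x‖ₑ ^ 2 ≤ C ↔ ‖x‖ ≤ √(2 * C.toReal) := by
  rw [← ENNReal.toReal_le_toReal (by finiteness) hC, Real.le_sqrt (norm_nonneg x) (by positivity),
    ENNReal.toReal_mul, ENNReal.toReal_pow, toReal_enorm, ENNReal.toReal_inv, ENNReal.toReal_ofNat]
  constructor <;> intro h <;> linarith

theorem tendsto_toReal_add_inv {V : ℝ≥0∞} (hV : V ≠ ⊤) :
    Tendsto (fun n : ℕ => √(2 * (V + ((n : ℝ≥0∞) + 1)⁻¹).toReal)) atTop (𝓝 √(2 * V.toReal)) := by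
  have h1 : Tendsto (fun n : ℕ => V + ((n : ℝ≥0∞) + 1)⁻¹) atTop (𝓝 (V + 0)) := by
    refine tendsto_const_nhds.add ?_
    have := (tendsto_add_atTop_iff_nat 1).2 ENNReal.tendsto_inv_nat_nhds_zero
    simpa using this
  rw [add_zero] at h1
  exact (Real.continuous_sqrt.tendsto _).comp
    (((ENNReal.continuousAt_toReal hV).tendsto.comp h1).const_mul 2)

/-- Extension of a control by zero. -/
theorem exists_control_eq_indicator {s : Set ℝ} (hs : MeasurableSet s) (h0 : s ⊆ Iic 0)
    {ψ : ℝ → L2 D} (hψ : MemLp ψ 2 (volume.restrict s)) :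
    ∃ Ψ : Control D, (∀ᵐ t, t ∈ Iic (0 : ℝ) → Ψ t = s.indicator ψ t) ∧
      ‖Ψ‖ₑ ^ 2 = ∫⁻ t in s, ‖ψ t‖ₑ ^ 2 := by
  have h1 : (volume.restrict (Iic (0 : ℝ))).restrict s = volume.restrict s := by
    rw [Measure.restrict_restrict hs, inter_eq_left.2 h0]
  have h2 : MemLp (s.indicator ψ) 2 (volume.restrict (Iic (0 : ℝ))) := by
    rwa [memLp_indicator_iff_restrict hs, h1]
  refine ⟨h2.toLp _, (ae_restrict_iff' measurableSet_Iic).1 h2.coeFn_toLp, ?_⟩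
  rw [Lp.enorm_def, eLpNorm_congr_ae h2.coeFn_toLp, eLpNorm_indicator_eq_eLpNorm_restrict hs, h1,
    eLpNorm_two_sq]

theorem actionInfty_le (hB : Continuous B) (hμ : 0 < μ) {Ψ : Control D} {z : ℝ → Phase S}
    (h : IsWeakSolutionIic S Q B μ 0 Ψ z) : actionInfty S Q B hμ z ≤ 2⁻¹ * ‖Ψ‖ₑ ^ 2 := by
  refine iSup₂_le fun t ht => ?_
  have ht' : -t < 0 := neg_lt_zero.2 ht
  have hsub : Ioo (-t) 0 ⊆ Iic 0 := fun _ hs => mem_Iic.2 hs.2.le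
  refine (action_le hB hμ ht'.le ((Lp.memLp Ψ).mono_measure
    (Measure.restrict_mono hsub le_rfl)) (h.sol _ ht')).trans ?_
  rw [enorm_control_sq]
  exact mul_le_mul_right (lintegral_mono_set hsub) _

/-- The action is a supremum of infima over finite intervals, with a different control for each
interval. Almost optimal controls on `[-(n+1), 0]`, extended by zero, have a weak limit that drives
`z` on every `[a, 0]` and costs at most the supremum. -/
theorem exists_control_of_actionInfty_ne_top (hB : UniformContinuous B) (hμ : 0 < μ)
    {z : ℝ → Phase S} (hz : actionInfty S Q B hμ z ≠ ⊤) :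
    ∃ Ψ : Control D, IsWeakSolutionIic S Q B μ 0 Ψ z ∧ 2⁻¹ * ‖Ψ‖ₑ ^ 2 ≤ actionInfty S Q B hμ z := by
  set A := actionInfty S Q B hμ z with hA
  have hn : ∀ n : ℕ, ∃ Ψ : Control D, IsWeakSolution S Q B μ (-((n : ℝ) + 1)) 0 Ψ z ∧
      2⁻¹ * ‖Ψ‖ₑ ^ 2 ≤ A + ((n : ℝ≥0∞) + 1)⁻¹ := by
    intro n
    have hpos : (0 : ℝ) < n + 1 := by positivity
    have h1 : action S Q B hμ (-((n : ℝ) + 1)) 0 z ≤ A :=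
      le_iSup₂ (f := fun t (_ : t ∈ Ioi (0 : ℝ)) => action S Q B hμ (-t) 0 z) _ hpos
    have h2 : A < A + ((n : ℝ≥0∞) + 1)⁻¹ :=
      ENNReal.lt_add_right hz (ENNReal.inv_ne_zero.2 (by finiteness))
    obtain ⟨ψ, h3, h4, h5⟩ := exists_control_of_action_lt hB.continuous hμ (by linarith)
      (h1.trans_lt h2)
    rw [restrict_Ioo_eq_restrict_Ioc] at h3 h5
    obtain ⟨Ψ, h6, h7⟩ := exists_control_eq_indicator measurableSet_Ioc Ioc_subset_Iic_self h3
    refine ⟨Ψ, h4.congr (by linarith) (fun _ _ => rfl) ?_, by rw [h7]; exact h5.le⟩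
    filter_upwards [h6] with t ht hts
    rw [ht hts.2, indicator_of_mem hts]
  choose Ψ h1 h2 using hn
  obtain ⟨Ψ', h3, h4⟩ := exists_weak_limit (hyperfilter ℕ) (x := Ψ)
    (m := fun n : ℕ => √(2 * (A + ((n : ℝ≥0∞) + 1)⁻¹).toReal))
    (Eventually.of_forall fun n => (half_enorm_sq_le_iff
      (ENNReal.add_ne_top.2 ⟨hz, ENNReal.inv_ne_top.2 (by positivity)⟩)).1 (h2 n))
    ((tendsto_toReal_add_inv hz).mono_left Nat.hyperfilter_le_atTop)
  refine ⟨Ψ', ⟨fun a ha => ?_, Lp.aestronglyMeasurable Ψ'⟩, (half_enorm_sq_le_iff hz).2 h3⟩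
  -- The path is the same for all `n`; only the controls vary.
  refine isWeakSolution_of_tendsto hB ha.le (l := (hyperfilter ℕ : Filter ℕ)) (Ψ := Ψ)
    (z := fun _ => z) ?_ (fun u hu => Eventually.of_forall fun _ _ _ => refl_mem_uniformity hu) h4
  refine Eventually.filter_mono Nat.hyperfilter_le_atTop ?_
  obtain ⟨N, hN⟩ := exists_nat_ge (-a)
  filter_upwards [eventually_ge_atTop N] with n hn
  refine (h1 n).mono ?_ ha.le le_rfl
  have : (N : ℝ) ≤ n := by exact_mod_cast hn
  linarith

theorem measurePreserving_restrict_add (c a b : ℝ) :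
    MeasurePreserving (fun t : ℝ => t + c) (volume.restrict (Ioo (a - c) (b - c)))
      (volume.restrict (Ioo a b)) := by
  have := (measurePreserving_add_right volume c).restrict_preimage_emb
    (measurableEmbedding_addRight c) (Ioo a b)
  rwa [preimage_add_const_Ioo] at this

/-- A path from `0` on a finite interval, extended by zero to the past. -/
theorem exists_extension (hB0 : B 0 = 0) {T : ℝ} (hT : 0 < T) {ψ : ℝ → L2 D} {z : ℝ → Phase S}
    (hψ : MemLp ψ 2 (volume.restrict (Ioo 0 T))) (h : IsWeakSolution S Q B μ 0 T ψ z)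
    (hz : z 0 = 0) :
    ∃ (Ψ : Control D) (z' : ℝ → Phase S), IsWeakSolutionIic S Q B μ 0 Ψ z' ∧
      Tendsto z' atBot (𝓝 0) ∧ z' 0 = z T ∧ ‖Ψ‖ₑ ^ 2 = ∫⁻ t in Ioo 0 T, ‖ψ t‖ₑ ^ 2 := by
  have hmp := measurePreserving_restrict_add T 0 T
  rw [zero_sub, sub_self] at hmp
  have h1 : MemLp (fun t => ψ (t + T)) 2 (volume.restrict (Ioc (-T) 0)) := by
    rw [← restrict_Ioo_eq_restrict_Ioc]
    exact hψ.comp_measurePreserving hmp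
  obtain ⟨Ψ, h2, h3⟩ := exists_control_eq_indicator measurableSet_Ioc Ioc_subset_Iic_self h1
  -- At rest until time `-T`, then the shifted path; the pieces match because `z 0 = 0`, and rest
  -- needs no control because `B 0 = 0`.
  let z' : ℝ → Phase S := fun t => if t ≤ -T then 0 else z (t + T)
  have hz' : ∀ t, t ≤ -T → z' t = 0 := fun t ht => if_pos ht
  have hz'' : ∀ t ∈ Icc (-T) 0, z' t = z (t + T) := by
    intro t ht
    rcases ht.1.eq_or_lt with h' | h'
    · rw [hz' t h'.ge, ← h', neg_add_cancel, hz]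
    · exact if_neg (not_le.2 h')
  refine ⟨Ψ, z', ⟨fun a ha => ?_, Lp.aestronglyMeasurable Ψ⟩, ?_, ?_, ?_⟩
  · have k1 : IsWeakSolution S Q B μ (-T) 0 Ψ z' := by
      have := h.comp_sub (-T)
      simp only [zero_add, add_neg_cancel, sub_neg_eq_add] at this
      refine this.congr (by linarith) (fun t ht => (hz'' t ht).symm) ?_
      filter_upwards [h2] with t ht hts
      rw [ht hts.2, indicator_of_mem hts]
    have k2 : IsWeakSolution S Q B μ (min a (-T)) (-T) Ψ z' := by
      refine (isWeakSolution_zero hB0 _ _).congr (min_le_right _ _)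
        (fun t ht => (hz' t ht.2).symm) ?_
      filter_upwards [h2] with t ht hts
      rw [ht (mem_Iic.2 (hts.2.trans (by linarith))), indicator_of_notMem fun hh =>
        not_le.2 hh.1 hts.2, Pi.zero_apply]
    exact (k2.concat k1 (min_le_right _ _) (by linarith)).mono (min_le_left _ _) ha.le le_rfl
  · exact tendsto_const_nhds.congr' ((eventually_le_atBot (-T)).mono fun t ht => (hz' t ht).symm)
  · rw [hz'' 0 ⟨by linarith, le_rfl⟩, zero_add]
  · rw [h3, ← restrict_Ioo_eq_restrict_Ioc]
    exact hmp.lintegral_comp_emb (measurableEmbedding_addRight T) fun t => ‖ψ t‖ₑ ^ 2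

/-- The equation is autonomous, so a path from zero on any interval may be translated to start at
time zero without changing its cost. -/
theorem quasipotential_le (hB : Continuous B) (hμ : 0 < μ) {a b : ℝ} (hab : a < b) {ψ : ℝ → L2 D}
    {z : ℝ → Phase S} (hψ : MemLp ψ 2 (volume.restrict (Ioo a b)))
    (h : IsWeakSolution S Q B μ a b ψ z) (hz : z a = 0) :
    quasipotential S Q B hμ (z b).1 (z b).2 ≤ 2⁻¹ * ∫⁻ t in Ioo a b, ‖ψ t‖ₑ ^ 2 := by
  have hmp := measurePreserving_restrict_add a a b
  rw [sub_self] at hmp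
  have h1 := h.comp_sub (-a)
  simp only [add_neg_cancel, sub_neg_eq_add, ← sub_eq_add_neg] at h1
  have hpos : 0 < b - a := sub_pos.2 hab
  have h2 := action_le hB hμ hpos.le (hψ.comp_measurePreserving hmp) h1
  have h3 : (fun t => z (t + a)) ∈ {w : ℝ → Phase S | ContinuousOn w (Icc 0 (b - a)) ∧ w 0 = 0 ∧
      w (b - a) = ((z b).1, (z b).2)} := ⟨h1.cont, by simpa using hz, by simp⟩
  refine (iInf₂_le (b - a) hpos).trans ((iInf₂_le _ h3).trans (h2.trans_eq ?_))
  congr 1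
  exact hmp.lintegral_comp_emb (measurableEmbedding_addRight a) fun t => ‖ψ t‖ₑ ^ 2

end Paths

/-! ### The two inequalities for the quasi-potentials -/

section Main

variable {d : ℕ} {D : Set (EuclideanSpace ℝ (Fin d))} {S : DirichletEigensystem D}
  {Q : L2 D →L[ℝ] L2 D} {B : L2 D → L2 D} {μ β γ : ℝ}

/-- Compactness of the set of solutions starting from zero at `-∞` with bounded controls. -/
theorem exists_limit_solution (hd : 1 ≤ d)
    (hα : S.α =Θ[atTop] fun k : ℕ => ((k : ℝ) + 1) ^ (2 / (d : ℝ)))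
    (hQ : NoiseAssumption S β Q) (hB : NonlinearityAssumption S β B) (hBu : UniformContinuous B)
    (hμ : 0 < μ)
    (hγ : ∀ u : L2 D, sobSum S 0 (fun k => inner ℝ (S.e k) (B u)) ≤
      ENNReal.ofReal (γ ^ 2) * sobSum S 0 (fun k => inner ℝ (S.e k) u))
    (hsmall : ((2 * S.α 0)⁻¹ + 2 * μ) * (S.α 0)⁻¹ * γ ^ 2 < 1 / 2)
    {Ψ : ℕ → Control D} {z : ℕ → ℝ → Phase S} (h : ∀ n, IsWeakSolutionIic S Q B μ 0 (Ψ n) (z n))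
    (hz : ∀ n, Tendsto (z n) atBot (𝓝 0)) {m : ℕ → ℝ} {M : ℝ} (hΨ : ∀ n, ‖Ψ n‖ ≤ m n)
    (hm : Tendsto m atTop (𝓝 M)) {F : Set (Phase S)} (hF : IsClosed F) (hzF : ∀ n, z n 0 ∈ F) :
    ∃ (Ψ' : Control D) (z' : ℝ → Phase S), IsWeakSolutionIic S Q B μ 0 Ψ' z' ∧
      Tendsto z' atBot (𝓝 0) ∧ ‖Ψ'‖ ≤ M ∧ z' 0 ∈ F := by
  set l := hyperfilter ℕ
  obtain ⟨R, hR⟩ := hm.bddAbove_range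
  have hΨR : ∀ n, ‖Ψ n‖ ≤ R := fun n => (hΨ n).trans (hR (mem_range_self n))
  obtain ⟨C, hC, hreg⟩ := exists_regularity_estimate hd hQ hB hBu.continuous hμ hγ hsmall
  obtain ⟨g, hg, hbox⟩ :=
    exists_coeffBox hd hα hQ hμ (M := C * ENNReal.ofReal R ^ 2) (by finiteness)
  have hK := isCompact_coeffBox (S := S) hg
  have hzK : ∀ n, ∀ t ≤ 0, z n t ∈ coeffBox S g := by
    intro n t ht
    refine hbox _ ((hreg t _ _ ((h n).mono ht) (hz n)).trans (mul_le_mul_right ?_ _))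
    refine (lintegral_mono_set (Iic_subset_Iic.2 ht)).trans ?_
    rw [← enorm_control_sq, ← ofReal_norm]
    gcongr
    exact hΨR n
  -- A single ultrafilter provides limits at all times simultaneously, without a diagonal
  -- extraction; the value at positive times is arbitrary.
  have hlim : ∀ t, ∃ w, t ≤ 0 → w ∈ coeffBox S g ∧ Tendsto (fun n => z n t) l (𝓝 w) := by
    intro t
    by_cases ht : t ≤ 0
    · obtain ⟨w, hw, hw'⟩ := isCompact_iff_ultrafilter_le_nhds.1 hK (l.map fun n => z n t) (by
        rw [le_principal_iff]
        change ∀ᶠ n in (l : Filter ℕ), z n t ∈ coeffBox S g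
        exact Eventually.of_forall fun n => hzK n t ht)
      exact ⟨w, fun _ => ⟨hw, hw'⟩⟩
    · exact ⟨0, fun h => absurd h ht⟩
  choose z' hz' using hlim
  obtain ⟨Ψ', hΨ', hweak⟩ := exists_weak_limit l (Eventually.of_forall hΨ)
    (hm.mono_left Nat.hyperfilter_le_atTop)
  have hsol : IsWeakSolutionIic S Q B μ 0 Ψ' z' := by
    refine ⟨fun a ha => ?_, Lp.aestronglyMeasurable Ψ'⟩
    exact isWeakSolution_of_tendsto hBu ha.le (Eventually.of_forall fun n => (h n).sol a ha)
      (tendstoUniformlyOn_of_isCompact hBu.continuous hμ hK (fun n => (h n).sol a ha) hΨR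
        (fun n t ht => hzK n t ht.2) fun t ht => (hz' t ht.2).2) hweak
  refine ⟨Ψ', z', hsol, ?_, hΨ', hF.mem_of_tendsto (hz' 0 le_rfl).2 (Eventually.of_forall hzF)⟩
  -- Decay at `-∞` is not inherited by locally uniform limits. It is recovered from the boundedness
  -- of the compact set and the square integrability of the limit control.
  obtain ⟨x, -, hx⟩ := hK.exists_isMaxOn ⟨_, (hz' 0 le_rfl).1⟩
    (continuous_phaseNormSq (S := S)).continuousOn
  refine tendsto_zero_of_phaseNormSq_le hd hQ hBu.continuous hμ hγ hsmall hsol ?_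
    (phaseNormSq_ne_top x) fun a ha => hx (hz' a ha).1
  rw [← enorm_control_sq]
  finiteness

/-- The remote past of the path is replaced by a unit-time bridge from zero to `z(a)`. The
regularity estimate makes `z(a)` reachable, at a cost bounded by the control energy spent before
`a`, which vanishes as `a → -∞`. -/
theorem quasipotential_le_actionInfty (hd : 1 ≤ d)
    (hQ : NoiseAssumption S β Q) (hB : NonlinearityAssumption S β B) (hBu : UniformContinuous B)
    (hμ : 0 < μ)
    (hγ : ∀ u : L2 D, sobSum S 0 (fun k => inner ℝ (S.e k) (B u)) ≤
      ENNReal.ofReal (γ ^ 2) * sobSum S 0 (fun k => inner ℝ (S.e k) u))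
    (hsmall : ((2 * S.α 0)⁻¹ + 2 * μ) * (S.α 0)⁻¹ * γ ^ 2 < 1 / 2)
    {z : ℝ → Phase S} (hz : z ∈ pathsFromZero S) :
    quasipotential S Q B hμ (z 0).1 (z 0).2 ≤ actionInfty S Q B hμ z := by
  by_cases hA : actionInfty S Q B hμ z = ⊤
  · rw [hA]; exact le_top
  obtain ⟨Ψ, hsol, hΨ⟩ := exists_control_of_actionInfty_ne_top hBu hμ hA
  obtain ⟨C, hC, hreg⟩ := exists_regularity_estimate hd hQ hB hBu.continuous hμ hγ hsmall
  obtain ⟨C', hC', hctrl⟩ := exists_control_to hd hQ hB hBu.continuous hμ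
  have hfin : ∫⁻ s in Iic (0 : ℝ), ‖Ψ s‖ₑ ^ 2 ≠ ⊤ := by
    rw [← enorm_control_sq]; finiteness
  have hsmallness : Tendsto (fun a : ℝ => C' * (C * ∫⁻ s in Iic a, ‖Ψ s‖ₑ ^ 2)) atBot (𝓝 0) :=
    tendsto_const_mul_zero hC' (tendsto_const_mul_zero hC (tendsto_setLIntegral_Iic_atBot hfin))
  have key : ∀ a < 0, quasipotential S Q B hμ (z 0).1 (z 0).2 ≤
      2⁻¹ * (C' * (C * ∫⁻ s in Iic a, ‖Ψ s‖ₑ ^ 2) + ‖Ψ‖ₑ ^ 2) := by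
    intro a ha
    have hE := hreg a _ _ (hsol.mono ha.le) hz.2
    have hEt : sobEnergy S μ (2 * β) (z a) ≠ ⊤ := by
      refine ne_top_of_le_ne_top (ENNReal.mul_ne_top hC ?_) hE
      exact ne_top_of_le_ne_top hfin (lintegral_mono_set (Iic_subset_Iic.2 ha.le))
    obtain ⟨ψ₁, z₁, h1, h2, h3, h4, h5⟩ := hctrl (z a) hEt
    have hmp := measurePreserving_restrict_add (-a) (-1) 0
    rw [zero_sub, neg_neg, sub_neg_eq_add] at hmp
    have h6 := h1.comp_sub a
    rw [zero_add] at h6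
    -- The bridge, shifted to `[a - 1, a]`, followed by the original control and path on `[a, 0]`.
    let ψ₂ : ℝ → L2 D := fun t => if t ≤ a then ψ₁ (t - a) else Ψ t
    let z₂ : ℝ → Phase S := fun t => if t ≤ a then z₁ (t - a) else z t
    have hψ1 : ∀ t ≤ a, ψ₂ t = ψ₁ (t - a) := fun t ht => if_pos ht
    have hψ2 : ∀ t, a < t → ψ₂ t = Ψ t := fun t ht => if_neg (not_le.2 ht)
    have hz1 : ∀ t ≤ a, z₂ t = z₁ (t - a) := fun t ht => if_pos ht
    have hz2 : ∀ t, a ≤ t → z₂ t = z t := fun t ht => by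
      rcases ht.eq_or_lt with rfl | ht'
      · rw [hz1 _ le_rfl, sub_self, h3]
      · exact if_neg (not_le.2 ht')
    have k1 : IsWeakSolution S Q B μ (-1 + a) a ψ₂ z₂ :=
      h6.congr (by linarith) (fun t ht => (hz1 t ht.2).symm)
        (Eventually.of_forall fun t ht => (hψ1 t ht.2).symm)
    have k2 : IsWeakSolution S Q B μ a 0 ψ₂ z₂ :=
      (hsol.sol a ha).congr ha.le (fun t ht => (hz2 t ht.1).symm)
        (Eventually.of_forall fun t ht => (hψ2 t ht.1).symm)
    have k3 := k1.concat k2 (by linarith) ha.le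
    have hsplit : Ioo (-1 + a) 0 = Ioo (-1 + a) a ∪ Ico a 0 :=
      (Ioo_union_Ico_eq_Ioo (by linarith) ha.le).symm
    have hae1 : ∀ᵐ t ∂volume.restrict (Ioo (-1 + a) a), ψ₂ t = ψ₁ (t + -a) :=
      (ae_restrict_iff' measurableSet_Ioo).2 (Eventually.of_forall fun t ht => hψ1 t ht.2.le)
    have hae2 : ∀ᵐ t ∂volume.restrict (Ico a 0), ψ₂ t = Ψ t := by
      rw [← restrict_Ioo_eq_restrict_Ico]
      exact (ae_restrict_iff' measurableSet_Ioo).2 (Eventually.of_forall fun t ht => hψ2 t ht.1)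
    have hmeas : AEStronglyMeasurable ψ₂ (volume.restrict (Ioo (-1 + a) 0)) := by
      rw [hsplit, aestronglyMeasurable_union_iff]
      refine ⟨AEStronglyMeasurable.congr ?_ (hae1.mono fun t ht => ht.symm),
        AEStronglyMeasurable.congr ?_ (hae2.mono fun t ht => ht.symm)⟩
      · exact (h4.mono_measure
          (Measure.restrict_mono Ioo_subset_Icc_self le_rfl)).comp_measurePreserving
          hmp
      · exact hsol.meas.mono_measure (Measure.restrict_mono (fun t ht => mem_Iic.2 ht.2.le) le_rfl)
    -- The bridge costs at most the first term; the remaining part of `Ψ` is bounded by its full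
    -- norm.
    have hcost : ∫⁻ t in Ioo (-1 + a) 0, ‖ψ₂ t‖ₑ ^ 2 ≤
        C' * (C * ∫⁻ s in Iic a, ‖Ψ s‖ₑ ^ 2) + ‖Ψ‖ₑ ^ 2 := by
      rw [hsplit]
      refine (lintegral_union_le _ _ _).trans (add_le_add ?_ ?_)
      · calc _ = ∫⁻ t in Ioo (-1 + a) a, ‖ψ₁ (t + -a)‖ₑ ^ 2 :=
              lintegral_congr_ae (hae1.mono fun t ht => by simp only [ht])
          _ = ∫⁻ t in Ioo (-1) 0, ‖ψ₁ t‖ₑ ^ 2 :=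
              hmp.lintegral_comp_emb (measurableEmbedding_addRight (-a)) fun t => ‖ψ₁ t‖ₑ ^ 2
          _ ≤ ∫⁻ t in Icc (-1) 0, ‖ψ₁ t‖ₑ ^ 2 := lintegral_mono_set Ioo_subset_Icc_self
          _ ≤ _ := h5.trans (mul_le_mul_right hE _)
      · calc _ = ∫⁻ t in Ico a 0, ‖Ψ t‖ₑ ^ 2 :=
              lintegral_congr_ae (hae2.mono fun t ht => by simp only [ht])
          _ ≤ _ := lintegral_mono_set fun t ht => mem_Iic.2 ht.2.le
          _ = _ := (enorm_control_sq Ψ).symm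
    have hcost' : ∫⁻ t in Ioo (-1 + a) 0, ‖ψ₂ t‖ₑ ^ 2 ≠ ⊤ := by
      refine ne_top_of_le_ne_top ?_ hcost
      have : ∫⁻ s in Iic a, ‖Ψ s‖ₑ ^ 2 ≠ ⊤ :=
        ne_top_of_le_ne_top hfin (lintegral_mono_set (Iic_subset_Iic.2 ha.le))
      finiteness
    have k4 := quasipotential_le hBu.continuous hμ (by linarith)
      ((memLp_two_iff_lintegral hmeas).2 hcost') k3
      (by rw [hz1 _ (by linarith), add_sub_cancel_right, h2])
    rw [hz2 0 ha.le] at k4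
    exact k4.trans (mul_le_mul_right hcost _)
  refine le_trans ?_ hΨ
  have hlim : Tendsto (fun a : ℝ => 2⁻¹ * (C' * (C * ∫⁻ s in Iic a, ‖Ψ s‖ₑ ^ 2) + ‖Ψ‖ₑ ^ 2)) atBot
      (𝓝 (2⁻¹ * (0 + ‖Ψ‖ₑ ^ 2))) :=
    ENNReal.Tendsto.const_mul (hsmallness.add tendsto_const_nhds) (Or.inr (by simp))
  rw [zero_add] at hlim
  exact ge_of_tendsto hlim ((eventually_lt_atBot 0).mono key)

/-- The direct method, for an arbitrary closed set `F` of endpoints: a point gives the statement for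
`V^μ(x, y)`, and the closed affine subspace of states with given position gives the one for
`V_μ(x)`. The endpoint condition survives the limit because `F` is closed. -/
theorem exists_minimizer (hd : 1 ≤ d)
    (hα : S.α =Θ[atTop] fun k : ℕ => ((k : ℝ) + 1) ^ (2 / (d : ℝ)))
    (hQ : NoiseAssumption S β Q) (hB : NonlinearityAssumption S β B) (hBu : UniformContinuous B)
    (hμ : 0 < μ)
    (hγ : ∀ u : L2 D, sobSum S 0 (fun k => inner ℝ (S.e k) (B u)) ≤
      ENNReal.ofReal (γ ^ 2) * sobSum S 0 (fun k => inner ℝ (S.e k) u))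
    (hsmall : ((2 * S.α 0)⁻¹ + 2 * μ) * (S.α 0)⁻¹ * γ ^ 2 < 1 / 2)
    {F : Set (Phase S)} (hF : IsClosed F) {V : ℝ≥0∞} (hV : V ≠ ⊤)
    (hinf : ∀ c > V, ∃ p ∈ F, quasipotential S Q B hμ p.1 p.2 < c) :
    ∃ z ∈ pathsFromZero S, z 0 ∈ F ∧ actionInfty S Q B hμ z ≤ V := by
  have hn : ∀ n : ℕ, ∃ (Ψ : Control D) (z : ℝ → Phase S), IsWeakSolutionIic S Q B μ 0 Ψ z ∧
      Tendsto z atBot (𝓝 0) ∧ z 0 ∈ F ∧ ‖Ψ‖ ≤ √(2 * (V + ((n : ℝ≥0∞) + 1)⁻¹).toReal) := by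
    intro n
    have hVn : V + ((n : ℝ≥0∞) + 1)⁻¹ ≠ ⊤ :=
      ENNReal.add_ne_top.2 ⟨hV, ENNReal.inv_ne_top.2 (by positivity)⟩
    obtain ⟨p, hp, hlt⟩ := hinf (V + ((n : ℝ≥0∞) + 1)⁻¹)
      (ENNReal.lt_add_right hV (ENNReal.inv_ne_zero.2 (by finiteness)))
    simp only [quasipotential, iInf_lt_iff] at hlt
    obtain ⟨T, hT, w, ⟨-, hw0, hwT⟩, hlt⟩ := hlt
    obtain ⟨ψ, h1, h2, h3⟩ := exists_control_of_action_lt hBu.continuous hμ (le_of_lt hT) hlt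
    obtain ⟨Ψ, z, h4, h5, h6, h7⟩ := exists_extension hB.map_zero hT h1 h2 hw0
    refine ⟨Ψ, z, h4, h5, by rw [h6, hwT]; exact hp, (half_enorm_sq_le_iff hVn).1 ?_⟩
    rw [h7]
    exact h3.le
  choose Ψ z h1 h2 h3 h4 using hn
  obtain ⟨Ψ', z', h5, h6, h7, h8⟩ := exists_limit_solution hd hα hQ hB hBu hμ hγ hsmall h1 h2 h4
    (tendsto_toReal_add_inv hV) hF h3
  exact ⟨z', ⟨h5.continuousOn, h6⟩, h8, (actionInfty_le hBu.continuous hμ h5).trans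
    ((half_enorm_sq_le_iff hV).2 h7)⟩

end Main

end WaveQuasipotential

end

theorem mainTheorem3 {d : ℕ} (hd : 1 ≤ d) (D : Set (EuclideanSpace ℝ (Fin d)))
    (hD_open : IsOpen D) (hD_bounded : Bornology.IsBounded D)
    (S : WaveQuasipotential.DirichletEigensystem D)
    (hα : S.α =Θ[atTop] fun k : ℕ => ((k : ℝ) + 1) ^ (2 / (d : ℝ)))
    (β : ℝ) (Q : WaveQuasipotential.L2 D →L[ℝ] WaveQuasipotential.L2 D)
    (hQ : WaveQuasipotential.NoiseAssumption S β Q)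
    (B : WaveQuasipotential.L2 D → WaveQuasipotential.L2 D)
    (hB : WaveQuasipotential.NonlinearityAssumption S β B) :
    ∃ μ₀ : ℝ, 0 < μ₀ ∧ ∀ (μ : ℝ) (hμ : 0 < μ), μ < μ₀ →
      (∀ (x : WaveQuasipotential.L2 D) (y : WaveQuasipotential.Sob S (-1)),
        WaveQuasipotential.quasipotential S Q B hμ x y =
            (⨅ z ∈ {z ∈ WaveQuasipotential.pathsFromZero S | z 0 = (x, y)},
              WaveQuasipotential.actionInfty S Q B hμ z) ∧
        (WaveQuasipotential.quasipotential S Q B hμ x y ≠ ⊤ →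
          ∃ z ∈ WaveQuasipotential.pathsFromZero S, z 0 = (x, y) ∧
            WaveQuasipotential.actionInfty S Q B hμ z =
              WaveQuasipotential.quasipotential S Q B hμ x y)) ∧
      (∀ x : WaveQuasipotential.L2 D,
        WaveQuasipotential.quasipotentialFst S Q B hμ x =
            (⨅ z ∈ {z ∈ WaveQuasipotential.pathsFromZero S | (z 0).1 = x},
              WaveQuasipotential.actionInfty S Q B hμ z) ∧
        (WaveQuasipotential.quasipotentialFst S Q B hμ x ≠ ⊤ →
          ∃ z ∈ WaveQuasipotential.pathsFromZero S, (z 0).1 = x ∧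
            WaveQuasipotential.actionInfty S Q B hμ z =
              WaveQuasipotential.quasipotentialFst S Q B hμ x)) := by
  have hβ := hQ.one_add_two_mul_pos hd
  have h0 := S.α_zero_pos
  obtain ⟨γ, hγ0, hγ1, hγ⟩ := hB.sobSum_le (δ := 0) ⟨le_rfl, by linarith⟩
  obtain ⟨γ', hγ', -, hlip⟩ := hB.lipschitz_L2 (by linarith)
  have hBu : UniformContinuous B :=
    (LipschitzWith.of_dist_le_mul (K := ⟨γ', hγ'⟩) fun u v => by
      rw [dist_eq_norm, dist_eq_norm]
      exact hlip u v).uniformContinuous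
  -- The absorption condition at `μ = 0` is `γ²/(2α₀²) < 1/2`, that is `γ < α₀`.
  have hgap : 0 < 1 / 2 - γ ^ 2 / (2 * S.α 0 ^ 2) := by
    rw [sub_pos, div_lt_div_iff₀ (by positivity) (by norm_num)]
    nlinarith
  -- The condition is affine in `μ` with slope `2 α₀⁻¹ γ²`; the gap is divided by the slope plus
  -- one, which avoids a zero denominator when `γ = 0`.
  refine ⟨(1 / 2 - γ ^ 2 / (2 * S.α 0 ^ 2)) / (2 * (S.α 0)⁻¹ * γ ^ 2 + 1), by positivity,
    fun μ hμ hμ₀ => ?_⟩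
  have hsmall : ((2 * S.α 0)⁻¹ + 2 * μ) * (S.α 0)⁻¹ * γ ^ 2 < 1 / 2 := by
    rw [lt_div_iff₀ (by positivity)] at hμ₀
    have e : ((2 * S.α 0)⁻¹ + 2 * μ) * (S.α 0)⁻¹ * γ ^ 2 =
        γ ^ 2 / (2 * S.α 0 ^ 2) + μ * (2 * (S.α 0)⁻¹ * γ ^ 2) := by field_simp
    rw [e]
    linarith
  have hle := fun z hz => WaveQuasipotential.quasipotential_le_actionInfty hd hQ hB hBu hμ hγ hsmall
    (z := z) hz
  constructor
  · intro x y
    have hmin := fun hV => WaveQuasipotential.exists_minimizer hd hα hQ hB hBu hμ hγ hsmall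
      (F := {(x, y)}) isClosed_singleton (V := WaveQuasipotential.quasipotential S Q B hμ x y) hV
      fun c hc => ⟨(x, y), rfl, hc⟩
    have hlb : ∀ z ∈ WaveQuasipotential.pathsFromZero S, z 0 = (x, y) →
        WaveQuasipotential.quasipotential S Q B hμ x y ≤
          WaveQuasipotential.actionInfty S Q B hμ z := by
      intro z hz hz0
      have := hle z hz
      rwa [hz0] at this
    refine ⟨le_antisymm (le_iInf₂ fun z hz => hlb z hz.1 hz.2) ?_, fun hV => ?_⟩
    · by_cases hV : WaveQuasipotential.quasipotential S Q B hμ x y = ⊤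
      · rw [hV]; exact le_top
      · obtain ⟨z, h1, h2, h3⟩ := hmin hV
        exact (iInf₂_le z ⟨h1, h2⟩).trans h3
    · obtain ⟨z, h1, h2, h3⟩ := hmin hV
      exact ⟨z, h1, h2, h3.antisymm (hlb z h1 h2)⟩
  · intro x
    have hmin := fun hV => WaveQuasipotential.exists_minimizer hd hα hQ hB hBu hμ hγ hsmall
      (F := {p | p.1 = x}) (isClosed_eq continuous_fst continuous_const)
      (V := WaveQuasipotential.quasipotentialFst S Q B hμ x) hV
      -- A level above the infimum over velocities is undercut by the quasi-potential at some
      -- velocity `y`; the minimizing sequence may use a different terminal velocity each time.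
      fun c hc => by
        obtain ⟨y, hy⟩ := iInf_lt_iff.1 hc
        exact ⟨(x, y), rfl, hy⟩
    have hlb : ∀ z ∈ WaveQuasipotential.pathsFromZero S, (z 0).1 = x →
        WaveQuasipotential.quasipotentialFst S Q B hμ x ≤
          WaveQuasipotential.actionInfty S Q B hμ z := by
      intro z hz hz0
      have := hle z hz
      rw [hz0] at this
      exact (iInf_le _ (z 0).2).trans this
    refine ⟨le_antisymm (le_iInf₂ fun z hz => hlb z hz.1 hz.2) ?_, fun hV => ?_⟩
    · by_cases hV : WaveQuasipotential.quasipotentialFst S Q B hμ x = ⊤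
      · rw [hV]; exact le_top
      · obtain ⟨z, h1, h2, h3⟩ := hmin hV
        exact (iInf₂_le z ⟨h1, h2⟩).trans h3
    · obtain ⟨z, h1, h2, h3⟩ := hmin hV
      exact ⟨z, h1, h2, h3.antisymm (hlb z h1 h2)⟩
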